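/- Let $\Bbbk$ be a field of characteristic $0$ and let $K_1=\Bbbk[\partial]v\oplus\Bbbk[\partial]g$ be the Neveu--Schwartz Lie conformal superalgebra, with $v$ even, $g$ odd and $$[v_\lambda v]=(\partial+2\lambda)v,\quad [g_\lambda v]=\tfrac12\partial g+\tfrac32\lambda g,\quad [g_\lambda g]=-\tfrac12 v .$$ Let $X=\{v,g\}$, $v<g$, $N(v,v)=3$, $N(v,g)=N(g,v)=N(g,g)=2$. Let $U=U(K_1;X,N)$ be the universal associative conformal envelope: the initial object among pairs $(C,\varphi)$ where $C$ is an associative conformal superalgebra with products $(\cdot\,_{(n)}\,\cdot)$, $n\ge 0$, generated by $\varphi(K_1)$, where $\varphi$ is an even $\Bbbk[\partial]$-linear map with $\varphi([x_{(n)}y])=\varphi(x)_{(n)}\varphi(y)-(-1)^{|x||y|}\{\varphi(y)_{(n)}\varphi(x)\}$ for homogeneous $x,y$, $\{a_{(n)}b\}=\sum_{s\ge0}(-1)^{n+s}\frac{\partial^s}{s!}(a_{(n+s)}b)$, and $\varphi(a)_{(n)}\varphi(b)=0$ for $a,b\in X$, $n\ge N(a,b)$. This universal envelope exists. Let $A=A(X,K_1)$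 be the associative algebra generated by $\partial$, $L_n^x$, $R_n^x$ ($n\ge0$, $x\in X$) with the defining relations ($x,y\in X$) $$\begin{gathered} \partial L_0^x=L_0^x\partial,\quad \partial L_1^x=L_1^x\partial-L_0^x,\quad L_n^x\partial=\partial L_n^x+nL_{n-1}^x\ (n\ge2),\\ R_n^x\partial=\partial R_n^x+nR_{n-1}^x\ (n\ge0),\quad R_n^xL_m^y=L_m^yR_n^x\ (n,m\ge0),\\ L_n^vL_m^v=L_m^vL_n^v+(n-m)L_{n+m-1}^v\ (n>m\ge0),\quad L_n^vL_m^g=L_m^gL_n^v+(\tfrac12n-m)L_{n+m-1}^g\ (n>m\ge0),\\ L_n^gL_m^v=L_m^vL_n^g+(n-\tfrac12m)L_{n+m-1}^g\ (n\ge m\ge0),\\ L_n^gL_m^g=-L_m^gL_n^g-\tfrac12L_{n+m}^v\ (n>m\ge0),\quad L_n^gL_n^g=-\tfrac14L_{2n}^v\ (n\ge0). \end{gathered}$$ It acts on $U$ by $\partial$, $L_n^xf=x_{(n)}f$, $R_n^xf=\{f_{(n)}x\}$. Order the letters by $L_0^v<L_0^g<L_1^v<L_1^g<\partial<L_2^v<L_2^g<\cdots$,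 $R_0^v<R_0^g<R_1^v<\cdots$, every $L_n^x$ and $\partial$ being smaller than every $R_m^y$. Compare words first by the degree in the letters $R_n^x$, then by length, then lexicographically; put $ux\prec wy$ for words $u,w$ and $x,y\in X$ iff $u\prec w$, or $u=w$ and $x<y$. Consider the relations $$\begin{gathered} L_n^xy=0\ (n\ge N(x,y)),\qquad R_n^xy=0\ (n\ge N(y,x)),\\ R_0^vv=L_0^vv-\partial L_1^vv+\tfrac12\partial^2L_2^vv,\quad R_1^vv=-L_1^vv+\partial L_2^vv,\quad R_2^vv=L_2^vv,\\ R_n^xy=(-1)^n(L_n^yx-\partial L_{n+1}^yx)\ (\{x,y\}=X,\ n=0,1),\\ R_0^gg=L_0^gg-\partial L_1^gg,\quad R_1^gg=-L_1^gg,\quad R_0^vv=L_0^vv-\partial v,\quad R_1^vv=L_1^vv-2v,\\ R_0^vg=L_0^vg-\partial g,\quad R_1^vg=L_1^vg-\tfrac32g,\quad R_0^gv=L_0^gv-\tfrac12\partial g,\quad R_1^gv=L_1^gv-\tfrac32g,\\ R_0^gg=-L_0^gg-\tfrac12v \end{gathered}\tag{1}$$ and $$\begin{gathered} L_2^vv=-2L_1^gg,\quad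 L_1^vv=-2L_0^gg+\tfrac12v,\quad L_1^gv=-L_1^vg+\tfrac32g,\quad L_1^vL_1^vg=\tfrac32L_1^vg-\tfrac12g,\\ L_1^vL_1^gg=\tfrac12L_1^gg,\quad L_0^gL_1^vg=\tfrac12L_0^vL_1^gg+\tfrac12L_0^gg,\quad L_0^gL_1^gg=-\tfrac12L_1^vg+\tfrac14g,\\ L_1^v\partial^sv=-2L_0^g\partial^sg+\tfrac12\partial^sv+sL_0^v\partial^{s-1}v,\\ L_1^g\partial^sv=-L_0^v\partial^{s-1}g+\partial^sg+(s+1)L_0^g\partial^{s-1}v,\\ L_1^v\partial^sg=-L_0^g\partial^{s-1}v+\tfrac12\partial^sg+(s+1)L_0^v\partial^{s-1}g,\\ L_1^g\partial^sg=(s+2)L_0^g\partial^{s-1}g+\tfrac12\partial^{s-1}v\qquad(s\ge1). \end{gathered}\tag{2}$$ Then $U$ is the $A$-module generated by $X$ with the defining relations (1), equivalently with the relations (1) and (2), and (1) together with (2) is a Gröbner--Shirshov basis of this $A$-module: with respect to $\prec$ all relations are monic, and all compositions among the relations of $A$, (1) and (2) (of the relations of $A$ with each other, of the relations of $A$ with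 (1) and (2), and of the relations (1) and (2) with each other) are trivial. -/

import Mathlib

universe u

/-! ### Words, polynomials and Gröbner–Shirshov bases of modules -/

namespace GS

/-- The free associative algebra on the alphabet `Z`: linear combinations of words in `Z`. -/
abbrev FreeAlg (𝕜 Z : Type*) [Field 𝕜] := MonoidAlgebra 𝕜 (FreeMonoid Z)

/-- The free left module over the free algebra on `Z`, with free generators `Y`. -/
abbrev FreeMod (𝕜 Z Y : Type*) [Field 𝕜] := Y →₀ FreeAlg 𝕜 Z

variable {𝕜 Z Y : Type*} [Field 𝕜]

/-- A word regarded as a polynomial. -/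
noncomputable def word (𝕜 : Type*) [Field 𝕜] {Z : Type*} (w : FreeMonoid Z) : FreeAlg 𝕜 Z :=
  MonoidAlgebra.of 𝕜 (FreeMonoid Z) w

/-- A letter regarded as a polynomial. -/
noncomputable def letter (𝕜 : Type*) [Field 𝕜] {Z : Type*} (z : Z) : FreeAlg 𝕜 Z :=
  word 𝕜 (FreeMonoid.of z)

/-- A free generator of the free module. -/
noncomputable def gen (𝕜 Z : Type*) [Field 𝕜] {Y : Type*} (y : Y) : FreeMod 𝕜 Z Y :=
  Finsupp.single y 1

/-- The order on module monomials `u y` induced by an order on words and an order on generators: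
`u x ≺ v y` iff `u ≺ v`, or `u = v` and `x < y`. -/
def modLt (lt : FreeMonoid Z → FreeMonoid Z → Prop) (ltY : Y → Y → Prop)
    (p q : FreeMonoid Z × Y) : Prop :=
  lt p.1 q.1 ∨ (p.1 = q.1 ∧ ltY p.2 q.2)

/-- `f` is monic with principal word `w`. -/
def IsLead (lt : FreeMonoid Z → FreeMonoid Z → Prop) (f : FreeAlg 𝕜 Z) (w : FreeMonoid Z) : Prop :=
  f.coeff w = 1 ∧ ∀ v, f.coeff v ≠ 0 → v ≠ w → lt v w

/-- `f` is monic with principal module monomial `p`. -/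
def IsModLead (lt : FreeMonoid Z → FreeMonoid Z → Prop) (ltY : Y → Y → Prop)
    (f : FreeMod 𝕜 Z Y) (p : FreeMonoid Z × Y) : Prop :=
  (f p.2).coeff p.1 = 1 ∧
    ∀ q : FreeMonoid Z × Y, (f q.2).coeff q.1 ≠ 0 → q ≠ p → modLt lt ltY q p

/-- The polynomials that are trivial modulo `S` and the word `w`: the linear combinations of
`a s b` with `s ∈ S`, `a`, `b` words, whose principal words are smaller than `w`. -/
noncomputable def trivialAlg (lt : FreeMonoid Z → FreeMonoid Z → Prop) (S : Set (FreeAlg 𝕜 Z))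
    (w : FreeMonoid Z) : Submodule 𝕜 (FreeAlg 𝕜 Z) :=
  Submodule.span 𝕜 {f | ∃ s ∈ S, ∃ a b ws : FreeMonoid Z,
    IsLead lt s ws ∧ lt (a * ws * b) w ∧ f = word 𝕜 a * s * word 𝕜 b}

/-- The module elements that are trivial modulo `(S, T)` and the module monomial `p`: the linear
combinations of `a s b y` (with `s ∈ S`) and of `a t` (with `t ∈ T`) whose principal module
monomials are smaller than `p`. -/
noncomputable def trivialMod (lt : FreeMonoid Z → FreeMonoid Z → Prop) (ltY : Y → Y → Prop)
    (S : Set (FreeAlg 𝕜 Z)) (T : Set (FreeMod 𝕜 Z Y)) (p : FreeMonoid Z × Y) :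
    Submodule 𝕜 (FreeMod 𝕜 Z Y) :=
  Submodule.span 𝕜
    ({f | ∃ s ∈ S, ∃ (a b ws : FreeMonoid Z) (y : Y), IsLead lt s ws ∧
        modLt lt ltY (a * ws * b, y) p ∧ f = (word 𝕜 a * s * word 𝕜 b) • gen 𝕜 Z y} ∪
     {f | ∃ t ∈ T, ∃ (a : FreeMonoid Z) (q : FreeMonoid Z × Y), IsModLead lt ltY t q ∧
        modLt lt ltY (a * q.1, q.2) p ∧ f = word 𝕜 a • t})

/-- `S` is a Gröbner–Shirshov basis of the associative algebra with generators `Z` and defining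
relations `s = 0`, `s ∈ S`: all elements are monic and all compositions are trivial. -/
structure IsAlgGSB (lt : FreeMonoid Z → FreeMonoid Z → Prop) (S : Set (FreeAlg 𝕜 Z)) : Prop where
  monic : ∀ s ∈ S, ∃ w, IsLead lt s w
  /-- compositions of intersection -/
  intersection : ∀ s ∈ S, ∀ s' ∈ S, ∀ a b c : FreeMonoid Z, c ≠ 1 →
    IsLead lt s (a * c) → IsLead lt s' (c * b) →
    s * word 𝕜 b - word 𝕜 a * s' ∈ trivialAlg lt S (a * c * b)
  /-- compositions of inclusion -/
  inclusion : ∀ s ∈ S, ∀ s' ∈ S, ∀ a b w : FreeMonoid Z,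
    IsLead lt s (a * w * b) → IsLead lt s' w →
    s - word 𝕜 a * s' * word 𝕜 b ∈ trivialAlg lt S (a * w * b)

/-- `T` is a Gröbner–Shirshov basis of the left module with generators `Y` and defining relations
`t = 0`, `t ∈ T`, over the associative algebra with generators `Z` and defining relations
`s = 0`, `s ∈ S`: `S` is a Gröbner–Shirshov basis of the algebra, the elements of `T` are monic,
and all compositions of elements of `T` with each other and with elements of `S` are trivial. -/
structure IsModGSB (lt : FreeMonoid Z → FreeMonoid Z → Prop) (ltY : Y → Y → Prop)
    (S : Set (FreeAlg 𝕜 Z)) (T : Set (FreeMod 𝕜 Z Y)) : Prop where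
  alg : IsAlgGSB lt S
  monic : ∀ t ∈ T, ∃ p, IsModLead lt ltY t p
  /-- intersection of a principal word `a c` in the algebra with a principal monomial `c b y` -/
  intersection : ∀ s ∈ S, ∀ t ∈ T, ∀ (a b c : FreeMonoid Z) (y : Y), c ≠ 1 →
    IsLead lt s (a * c) → IsModLead lt ltY t (c * b, y) →
    (s * word 𝕜 b) • gen 𝕜 Z y - word 𝕜 a • t ∈ trivialMod lt ltY S T (a * c * b, y)
  /-- inclusion of a principal word `w` in the algebra into a principal monomial `a w b y` -/
  inclusion_alg : ∀ s ∈ S, ∀ t ∈ T, ∀ (a b w : FreeMonoid Z) (y : Y),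
    IsLead lt s w → IsModLead lt ltY t (a * w * b, y) →
    t - (word 𝕜 a * s * word 𝕜 b) • gen 𝕜 Z y ∈ trivialMod lt ltY S T (a * w * b, y)
  /-- inclusion of a principal monomial `w y` into a principal monomial `a w y` -/
  inclusion_mod : ∀ t ∈ T, ∀ t' ∈ T, ∀ (a w : FreeMonoid Z) (y : Y),
    IsModLead lt ltY t (a * w, y) → IsModLead lt ltY t' (w, y) →
    t - word 𝕜 a • t' ∈ trivialMod lt ltY S T (a * w, y)

end GS

/-! ### Conformal superalgebras and universal associative envelopes -/

/-- A conformal superalgebra over `𝕜` on the space `C`: a `ℤ/2`-graded `𝕜[∂]`-module with even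
bilinear products `(· (n) ·)`, `n ≥ 0`, that are local and sesquilinear. -/
structure ConformalSuperalgebra (𝕜 C : Type*) [Field 𝕜] [AddCommGroup C] [Module 𝕜 C] where
  /-- the action of `∂` -/
  der : C →ₗ[𝕜] C
  /-- the `n`-th product -/
  prod : ℕ → C →ₗ[𝕜] C →ₗ[𝕜] C
  /-- the even part `grade 0` and the odd part `grade 1` -/
  grade : ZMod 2 → Submodule 𝕜 C
  isCompl_grade : IsCompl (grade 0) (grade 1)
  der_mem : ∀ i, ∀ x ∈ grade i, der x ∈ grade i
  prod_mem : ∀ n i j, ∀ x ∈ grade i, ∀ y ∈ grade j, prod n x y ∈ grade (i + j)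
  locality : ∀ x y, ∃ N, ∀ n, N ≤ n → prod n x y = 0
  der_prod : ∀ n x y, prod n (der x) y = -((n : 𝕜) • prod (n - 1) x y)
  prod_der : ∀ n x y, prod n x (der y) = der (prod n x y) + (n : 𝕜) • prod (n - 1) x y

namespace ConformalSuperalgebra

variable {𝕜 C D L ι : Type*} [Field 𝕜] [AddCommGroup C] [Module 𝕜 C] [AddCommGroup D] [Module 𝕜 D]
  [AddCommGroup L] [Module 𝕜 L]

/-- Associativity of a conformal superalgebra. -/
def IsAssociative (S : ConformalSuperalgebra 𝕜 C) : Prop :=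
  ∀ (n m : ℕ) (x y z : C), S.prod n x (S.prod m y z) =
    ∑ s ∈ Finset.range (n + 1), (n.choose s : 𝕜) • S.prod (n + m - s) (S.prod s x y) z

/-- `{y (n) x} = ∑ₛ (-1)^(n+s) ∂^s / s! (y (n+s) x)`; the sum is finite by locality. -/
noncomputable def curly (S : ConformalSuperalgebra 𝕜 C) (n : ℕ) (y x : C) : C :=
  ∑ᶠ s : ℕ, ((-1 : 𝕜) ^ (n + s) * (s.factorial : 𝕜)⁻¹) • (S.der ^ s) (S.prod (n + s) y x)

/-- The conformal super-commutator `(x (n) y) - (-1)^{|x||y|} {y (n) x}` of homogeneous elements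
`x`, `y` of parities `i`, `j`. -/
noncomputable def superComm (S : ConformalSuperalgebra 𝕜 C) (i j : ZMod 2) (n : ℕ) (x y : C) : C :=
  S.prod n x y - (-1 : 𝕜) ^ (i.val * j.val) • S.curly n y x

/-- Homomorphisms of conformal superalgebras. -/
structure IsHom (S : ConformalSuperalgebra 𝕜 C) (S' : ConformalSuperalgebra 𝕜 D)
    (f : C →ₗ[𝕜] D) : Prop where
  map_der : ∀ x, f (S.der x) = S'.der (f x)
  map_prod : ∀ n x y, f (S.prod n x y) = S'.prod n (f x) (f y)
  map_grade : ∀ i, ∀ x ∈ S.grade i, f x ∈ S'.grade i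

/-- `(C, φ)` is an associative envelope of the (Lie) conformal superalgebra `L` whose locality on
the family `X` of elements of `L` is bounded by `N`: `C` is an associative conformal superalgebra,
`φ : L → C⁽⁻⁾` is a homomorphism, `C` is generated by `φ(L)` as a conformal algebra, and
`N_C(φ(X a), φ(X b)) ≤ N a b`. -/
structure IsEnvelope (SL : ConformalSuperalgebra 𝕜 L) (X : ι → L) (N : ι → ι → ℕ)
    (S : ConformalSuperalgebra 𝕜 C) (φ : L →ₗ[𝕜] C) : Prop where
  assoc : S.IsAssociative
  map_der : ∀ x, φ (SL.der x) = S.der (φ x)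
  map_grade : ∀ i, ∀ x ∈ SL.grade i, φ x ∈ S.grade i
  map_bracket : ∀ (n : ℕ) (i j : ZMod 2), ∀ x ∈ SL.grade i, ∀ y ∈ SL.grade j,
    φ (SL.prod n x y) = S.superComm i j n (φ x) (φ y)
  generates : ∀ p : Submodule 𝕜 C, (∀ x, φ x ∈ p) → (∀ c ∈ p, S.der c ∈ p) →
    (∀ n, ∀ c ∈ p, ∀ d ∈ p, S.prod n c d ∈ p) → p = ⊤
  bounded : ∀ a b n, N a b ≤ n → S.prod n (φ (X a)) (φ (X b)) = 0

/-- `(C, φ)` is the universal associative envelope `U(L; X, N)`: it is initial among the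
associative envelopes of `L` with locality on `X` bounded by `N`. -/
def IsUniversalEnvelope {𝕜 C L : Type u} {ι : Type*} [Field 𝕜] [AddCommGroup C] [Module 𝕜 C]
    [AddCommGroup L] [Module 𝕜 L] (SL : ConformalSuperalgebra 𝕜 L) (X : ι → L) (N : ι → ι → ℕ)
    (S : ConformalSuperalgebra 𝕜 C) (φ : L →ₗ[𝕜] C) : Prop :=
  IsEnvelope SL X N S φ ∧
    ∀ (D : Type u) [AddCommGroup D] [Module 𝕜 D] (S' : ConformalSuperalgebra 𝕜 D) (ψ : L →ₗ[𝕜] D),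
      IsEnvelope SL X N S' ψ → ∃! f : C →ₗ[𝕜] D, IsHom S S' f ∧ f ∘ₗ φ = ψ

end ConformalSuperalgebra

/-! ### The Neveu–Schwartz conformal superalgebra `K₁` -/

namespace NeveuSchwartz

open Polynomial

/-- The generators `v` (even) and `g` (odd). -/
inductive Gen : Type
  | v
  | g
  deriving DecidableEq

instance : Fintype Gen := ⟨{.v, .g}, by intro x; cases x <;> simp⟩

/-- The number of a generator in the order `v < g`. -/
def Gen.idx : Gen → ℕ
  | .v => 0
  | .g => 1

/-- `v < g`. -/
def Gen.Lt (x y : Gen) : Prop := x.idx < y.idx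

/-- The free `𝕜[∂]`-module with basis `v`, `g`; the variable of `𝕜[X]` is `∂`. -/
abbrev K1 (𝕜 : Type*) [Field 𝕜] := Gen → 𝕜[X]

variable {𝕜 : Type*} [Field 𝕜]

/-- The basis elements `v` and `g` of `K₁`. -/
noncomputable def K1.gen (𝕜 : Type*) [Field 𝕜] (a : Gen) : K1 𝕜 := Pi.single a 1

/-- The coefficient at the generator `c` of `[a_λ b]`, a polynomial in `∂` (the inner variable) and
`λ` (the outer variable):
`[v_λ v] = ∂v + 2λv`, `[g_λ v] = ½∂g + (3/2)λg`, `[g_λ g] = -½v`, and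
`[v_λ g] = -[g_{-∂-λ} v] = ∂g + (3/2)λg`. -/
noncomputable def structConst (𝕜 : Type*) [Field 𝕜] : Gen → Gen → Gen → 𝕜[X][X]
  | .v, .v, .v => C X + C (C 2) * X
  | .v, .g, .g => C X + C (C (3 / 2)) * X
  | .g, .v, .g => C (C (1 / 2)) * C X + C (C (3 / 2)) * X
  | .g, .g, .v => C (C (-1 / 2))
  | _, _, _ => 0

/-- The `λ`-bracket of `K₁`, componentwise as a polynomial in `∂` (inner) and `λ` (outer):
`[p(∂)a_λ q(∂)b] = p(-λ) q(∂+λ) [a_λ b]`. -/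
noncomputable def lambdaBracket (x y : K1 𝕜) (c : Gen) : 𝕜[X][X] :=
  ∑ a, ∑ b, aeval (-X : 𝕜[X][X]) (x a) * aeval (C X + X : 𝕜[X][X]) (y b) * structConst 𝕜 a b c

/-- The `n`-th product of `K₁`: the coefficient of the `λ`-bracket at `λ^n / n!`. -/
noncomputable def bracket (n : ℕ) : K1 𝕜 →ₗ[𝕜] K1 𝕜 →ₗ[𝕜] K1 𝕜 :=
  LinearMap.mk₂ 𝕜 (fun x y c => (n.factorial : 𝕜) • (lambdaBracket x y c).coeff n)
    (by intros; funext c; simp [lambdaBracket, add_mul, Finset.sum_add_distrib])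
    (by
      intro r x y; funext c
      simp [lambdaBracket, Finset.smul_sum, smul_comm r])
    (by intros; funext c; simp [lambdaBracket, add_mul, mul_add, Finset.sum_add_distrib])
    (by
      intro r x y; funext c
      simp [lambdaBracket, Finset.smul_sum, smul_comm r])

theorem bracket_apply (n : ℕ) (x y : K1 𝕜) (c : Gen) :
    bracket n x y c = (n.factorial : 𝕜) • (lambdaBracket x y c).coeff n := rfl

theorem sum_gen {M : Type*} [AddCommMonoid M] (f : Gen → M) : ∑ a, f a = f .v + f .g := by
  change ∑ a ∈ ({.v, .g} : Finset Gen), f a = _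
  simp

/-- The action of `∂` on `K₁`. -/
noncomputable def der (𝕜 : Type*) [Field 𝕜] : K1 𝕜 →ₗ[𝕜] K1 𝕜 :=
  LinearMap.pi fun a => LinearMap.mulLeft 𝕜 (X : 𝕜[X]) ∘ₗ LinearMap.proj a

theorem der_apply (x : K1 𝕜) (a : Gen) : der 𝕜 x a = X * x a := rfl

theorem lambdaBracket_der_left (x y : K1 𝕜) (c : Gen) :
    lambdaBracket (der 𝕜 x) y c = -(X * lambdaBracket x y c) := by
  simp only [lambdaBracket, sum_gen, der_apply, map_mul, aeval_X]
  ring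

theorem lambdaBracket_der_right (x y : K1 𝕜) (c : Gen) :
    lambdaBracket x (der 𝕜 y) c = C X * lambdaBracket x y c + X * lambdaBracket x y c := by
  simp only [lambdaBracket, sum_gen, der_apply, map_mul, aeval_X]
  ring

/-- Even elements have no `g`-component, odd elements have no `v`-component. -/
noncomputable def grade (𝕜 : Type*) [Field 𝕜] (i : ZMod 2) : Submodule 𝕜 (K1 𝕜) :=
  LinearMap.ker (LinearMap.proj (R := 𝕜) (φ := fun _ : Gen => 𝕜[X]) (if i = 0 then .g else .v))

theorem mem_grade (i : ZMod 2) (x : K1 𝕜) :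
    x ∈ grade 𝕜 i ↔ x (if i = 0 then .g else .v) = 0 := Iff.rfl

/-- The Neveu–Schwartz conformal superalgebra `K₁`. -/
noncomputable def K1.alg (𝕜 : Type*) [Field 𝕜] : ConformalSuperalgebra 𝕜 (K1 𝕜) where
  der := der 𝕜
  prod := bracket
  grade := grade 𝕜
  isCompl_grade := by
    rw [isCompl_iff, Submodule.disjoint_def, codisjoint_iff_le_sup]
    refine ⟨fun x h0 h1 => ?_, fun x _ => ?_⟩
    · rw [mem_grade] at h0 h1
      funext a
      cases a
      · simpa using h1
      · simpa using h0
    · refine Submodule.mem_sup.2 ⟨Pi.single .v (x .v), ?_, Pi.single .g (x .g), ?_, ?_⟩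
      · simp [mem_grade]
      · simp [mem_grade]
      · funext a
        cases a <;> simp
  der_mem := by
    intro i x hx
    rw [mem_grade] at hx ⊢
    rw [der_apply, hx, mul_zero]
  prod_mem := by
    intro n i j x hx y hy
    rw [mem_grade] at hx hy ⊢
    have h2 : ∀ k : ZMod 2, k = 0 ∨ k = 1 := by decide
    have h11 : (1 + 1 : ZMod 2) = 0 := by decide
    rw [bracket_apply]
    rcases h2 i with rfl | rfl <;> rcases h2 j with rfl | rfl <;>
      simp only [h11, add_zero, zero_add, if_true, one_ne_zero, if_false] at hx hy ⊢ <;>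
      simp [lambdaBracket, sum_gen, structConst, hx, hy]
  locality := by
    intro x y
    refine ⟨(∑ c, (lambdaBracket x y c).natDegree) + 1, fun n hn => ?_⟩
    funext c
    have hc : (lambdaBracket x y c).natDegree ≤ ∑ c, (lambdaBracket x y c).natDegree :=
      Finset.single_le_sum (f := fun c => (lambdaBracket x y c).natDegree)
        (fun _ _ => Nat.zero_le _) (Finset.mem_univ c)
    rw [bracket_apply, coeff_eq_zero_of_natDegree_lt (by omega)]
    simp
  der_prod := by
    intro n x y
    funext c
    rw [bracket_apply]
    have h := lambdaBracket_der_left x y c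
    cases n with
    | zero =>
      have h0 := congrArg (fun p => coeff p 0) h
      simpa using h0
    | succ n =>
      have h1 := congrArg (fun p => coeff p (n + 1)) h
      simp only [coeff_neg, coeff_X_mul] at h1
      refine (congrArg _ h1).trans ?_
      simp [bracket_apply, Nat.factorial_succ, mul_smul]
  prod_der := by
    intro n x y
    funext c
    rw [bracket_apply]
    have h := lambdaBracket_der_right x y c
    cases n with
    | zero =>
      have h0 := congrArg (fun p => coeff p 0) h
      simpa [bracket_apply, der_apply] using h0
    | succ n =>
      have h1 := congrArg (fun p => coeff p (n + 1)) h
      simp only [coeff_add, coeff_C_mul, coeff_X_mul] at h1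
      refine (congrArg _ h1).trans ?_
      simp [bracket_apply, der_apply, Nat.factorial_succ, mul_smul]

/-- `N(v,v) = 3`, `N(v,g) = N(g,v) = N(g,g) = 2`. -/
def N : Gen → Gen → ℕ
  | .v, .v => 3
  | _, _ => 2

/-! ### The algebra `A(X, K₁)` and the relations -/

/-- The generators `∂`, `L_n^a`, `R_n^a` of the algebra `A(X, K₁)`. -/
inductive Letter : Type
  | d
  | L (n : ℕ) (a : Gen)
  | R (n : ℕ) (a : Gen)

/-- The position of a letter in the order `L_0^v < L_0^g < L_1^v < L_1^g < ∂ < L_2^v < L_2^g < ⋯`,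
`L_n^a < R_m^b`, `R_0^v < R_0^g < R_1^v < ⋯`. -/
def Letter.key : Letter → ℕ ×ₗ ℕ ×ₗ ℕ
  | .L n a => toLex (if n ≤ 1 then 0 else 2, toLex (n, a.idx))
  | .d => toLex (1, toLex (0, 0))
  | .R n a => toLex (3, toLex (n, a.idx))

/-- The order on the letters. -/
def Letter.Lt (x y : Letter) : Prop := x.key < y.key

/-- Whether a letter is one of the `R_n^a`. -/
def Letter.isR : Letter → Bool
  | .R _ _ => true
  | _ => false

/-- The degree of a word in the letters `R_n^a`. -/
def degR (w : FreeMonoid Letter) : ℕ := w.toList.countP Letter.isR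

/-- The order on words: compare the degrees in the letters `R_n^a` first, then the lengths, then
lexicographically. -/
def wordLt (u w : FreeMonoid Letter) : Prop :=
  degR u < degR w ∨ (degR u = degR w ∧
    (u.length < w.length ∨ (u.length = w.length ∧ List.Lex Letter.Lt u.toList w.toList)))

/-- `∂` as a polynomial. -/
noncomputable def d (𝕜 : Type*) [Field 𝕜] : GS.FreeAlg 𝕜 Letter := GS.letter 𝕜 .d

/-- `L_n^a` as a polynomial. -/
noncomputable def l (𝕜 : Type*) [Field 𝕜] (n : ℕ) (a : Gen) : GS.FreeAlg 𝕜 Letter :=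
  GS.letter 𝕜 (.L n a)

/-- `R_n^a` as a polynomial. -/
noncomputable def r (𝕜 : Type*) [Field 𝕜] (n : ℕ) (a : Gen) : GS.FreeAlg 𝕜 Letter :=
  GS.letter 𝕜 (.R n a)

/-- The generator `a ∈ {v, g}` of the free module. -/
noncomputable def e (𝕜 : Type*) [Field 𝕜] (a : Gen) : GS.FreeMod 𝕜 Letter Gen := GS.gen 𝕜 Letter a

/-- The defining relations of the algebra `A(X, K₁)`. -/
inductive AlgRel (𝕜 : Type*) [Field 𝕜] : GS.FreeAlg 𝕜 Letter → GS.FreeAlg 𝕜 Letter → Prop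
  | d_l0 (x : Gen) : AlgRel 𝕜 (d 𝕜 * l 𝕜 0 x) (l 𝕜 0 x * d 𝕜)
  | d_l1 (x : Gen) : AlgRel 𝕜 (d 𝕜 * l 𝕜 1 x) (l 𝕜 1 x * d 𝕜 - l 𝕜 0 x)
  | l_d (n : ℕ) (x : Gen) (h : 2 ≤ n) :
      AlgRel 𝕜 (l 𝕜 n x * d 𝕜) (d 𝕜 * l 𝕜 n x + (n : 𝕜) • l 𝕜 (n - 1) x)
  | r_d (n : ℕ) (x : Gen) :
      AlgRel 𝕜 (r 𝕜 n x * d 𝕜) (d 𝕜 * r 𝕜 n x + (n : 𝕜) • r 𝕜 (n - 1) x)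
  | r_l (n m : ℕ) (x y : Gen) : AlgRel 𝕜 (r 𝕜 n x * l 𝕜 m y) (l 𝕜 m y * r 𝕜 n x)
  | l_vv (n m : ℕ) (h : m < n) :
      AlgRel 𝕜 (l 𝕜 n .v * l 𝕜 m .v)
        (l 𝕜 m .v * l 𝕜 n .v + ((n : 𝕜) - m) • l 𝕜 (n + m - 1) .v)
  | l_vg (n m : ℕ) (h : m < n) :
      AlgRel 𝕜 (l 𝕜 n .v * l 𝕜 m .g)
        (l 𝕜 m .g * l 𝕜 n .v + (1 / 2 * (n : 𝕜) - m) • l 𝕜 (n + m - 1) .g)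
  | l_gv (n m : ℕ) (h : m ≤ n) :
      AlgRel 𝕜 (l 𝕜 n .g * l 𝕜 m .v)
        (l 𝕜 m .v * l 𝕜 n .g + ((n : 𝕜) - 1 / 2 * m) • l 𝕜 (n + m - 1) .g)
  | l_gg (n m : ℕ) (h : m < n) :
      AlgRel 𝕜 (l 𝕜 n .g * l 𝕜 m .g)
        (-(l 𝕜 m .g * l 𝕜 n .g) - (1 / 2 : 𝕜) • l 𝕜 (n + m) .v)
  | l_gg_diag (n : ℕ) : AlgRel 𝕜 (l 𝕜 n .g * l 𝕜 n .g) (-((1 / 4 : 𝕜) • l 𝕜 (2 * n) .v))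

/-- The defining relations of `U(K₁; X, N)` as an `A(X, K₁)`-module. -/
inductive DefRel (𝕜 : Type*) [Field 𝕜] :
    GS.FreeMod 𝕜 Letter Gen → GS.FreeMod 𝕜 Letter Gen → Prop
  | l_loc (n : ℕ) (x y : Gen) (h : N x y ≤ n) : DefRel 𝕜 (l 𝕜 n x • e 𝕜 y) 0
  | r_loc (n : ℕ) (x y : Gen) (h : N y x ≤ n) : DefRel 𝕜 (r 𝕜 n x • e 𝕜 y) 0
  | r0_vv : DefRel 𝕜 (r 𝕜 0 .v • e 𝕜 .v)
      (l 𝕜 0 .v • e 𝕜 .v - (d 𝕜 * l 𝕜 1 .v) • e 𝕜 .v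
        + (1 / 2 : 𝕜) • (d 𝕜 * d 𝕜 * l 𝕜 2 .v) • e 𝕜 .v)
  | r1_vv : DefRel 𝕜 (r 𝕜 1 .v • e 𝕜 .v)
      (-(l 𝕜 1 .v • e 𝕜 .v) + (d 𝕜 * l 𝕜 2 .v) • e 𝕜 .v)
  | r2_vv : DefRel 𝕜 (r 𝕜 2 .v • e 𝕜 .v) (l 𝕜 2 .v • e 𝕜 .v)
  | r_mixed (n : ℕ) (x y : Gen) (hxy : x ≠ y) (hn : n ≤ 1) : DefRel 𝕜 (r 𝕜 n x • e 𝕜 y)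
      ((-1 : 𝕜) ^ n • (l 𝕜 n y • e 𝕜 x - (d 𝕜 * l 𝕜 (n + 1) y) • e 𝕜 x))
  | r0_gg : DefRel 𝕜 (r 𝕜 0 .g • e 𝕜 .g) (l 𝕜 0 .g • e 𝕜 .g - (d 𝕜 * l 𝕜 1 .g) • e 𝕜 .g)
  | r1_gg : DefRel 𝕜 (r 𝕜 1 .g • e 𝕜 .g) (-(l 𝕜 1 .g • e 𝕜 .g))
  | comm0_vv : DefRel 𝕜 (r 𝕜 0 .v • e 𝕜 .v) (l 𝕜 0 .v • e 𝕜 .v - d 𝕜 • e 𝕜 .v)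
  | comm1_vv : DefRel 𝕜 (r 𝕜 1 .v • e 𝕜 .v) (l 𝕜 1 .v • e 𝕜 .v - (2 : 𝕜) • e 𝕜 .v)
  | comm0_vg : DefRel 𝕜 (r 𝕜 0 .v • e 𝕜 .g) (l 𝕜 0 .v • e 𝕜 .g - d 𝕜 • e 𝕜 .g)
  | comm1_vg : DefRel 𝕜 (r 𝕜 1 .v • e 𝕜 .g) (l 𝕜 1 .v • e 𝕜 .g - (3 / 2 : 𝕜) • e 𝕜 .g)
  | comm0_gv : DefRel 𝕜 (r 𝕜 0 .g • e 𝕜 .v)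
      (l 𝕜 0 .g • e 𝕜 .v - (1 / 2 : 𝕜) • d 𝕜 • e 𝕜 .g)
  | comm1_gv : DefRel 𝕜 (r 𝕜 1 .g • e 𝕜 .v) (l 𝕜 1 .g • e 𝕜 .v - (3 / 2 : 𝕜) • e 𝕜 .g)
  | comm0_gg : DefRel 𝕜 (r 𝕜 0 .g • e 𝕜 .g) (-(l 𝕜 0 .g • e 𝕜 .g) - (1 / 2 : 𝕜) • e 𝕜 .v)
  | comm1_gg : DefRel 𝕜 (r 𝕜 1 .g • e 𝕜 .g) (-(l 𝕜 1 .g • e 𝕜 .g))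

/-- The relations that enrich the defining relations to a Gröbner–Shirshov basis; in the four
families `s ≥ 1`. -/
inductive ExtraRel (𝕜 : Type*) [Field 𝕜] :
    GS.FreeMod 𝕜 Letter Gen → GS.FreeMod 𝕜 Letter Gen → Prop
  | l2v_v : ExtraRel 𝕜 (l 𝕜 2 .v • e 𝕜 .v) (-((2 : 𝕜) • l 𝕜 1 .g • e 𝕜 .g))
  | l1v_v : ExtraRel 𝕜 (l 𝕜 1 .v • e 𝕜 .v)
      (-((2 : 𝕜) • l 𝕜 0 .g • e 𝕜 .g) + (1 / 2 : 𝕜) • e 𝕜 .v)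
  | l1g_v : ExtraRel 𝕜 (l 𝕜 1 .g • e 𝕜 .v) (-(l 𝕜 1 .v • e 𝕜 .g) + (3 / 2 : 𝕜) • e 𝕜 .g)
  | l1v_l1v_g : ExtraRel 𝕜 ((l 𝕜 1 .v * l 𝕜 1 .v) • e 𝕜 .g)
      ((3 / 2 : 𝕜) • l 𝕜 1 .v • e 𝕜 .g - (1 / 2 : 𝕜) • e 𝕜 .g)
  | l1v_l1g_g : ExtraRel 𝕜 ((l 𝕜 1 .v * l 𝕜 1 .g) • e 𝕜 .g) ((1 / 2 : 𝕜) • l 𝕜 1 .g • e 𝕜 .g)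
  | l0g_l1v_g : ExtraRel 𝕜 ((l 𝕜 0 .g * l 𝕜 1 .v) • e 𝕜 .g)
      ((1 / 2 : 𝕜) • (l 𝕜 0 .v * l 𝕜 1 .g) • e 𝕜 .g + (1 / 2 : 𝕜) • l 𝕜 0 .g • e 𝕜 .g)
  | l0g_l1g_g : ExtraRel 𝕜 ((l 𝕜 0 .g * l 𝕜 1 .g) • e 𝕜 .g)
      (-((1 / 2 : 𝕜) • l 𝕜 1 .v • e 𝕜 .g) + (1 / 4 : 𝕜) • e 𝕜 .g)
  | l1v_ds_v (s : ℕ) (hs : 1 ≤ s) : ExtraRel 𝕜 ((l 𝕜 1 .v * d 𝕜 ^ s) • e 𝕜 .v)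
      (-((2 : 𝕜) • (l 𝕜 0 .g * d 𝕜 ^ s) • e 𝕜 .g) + (1 / 2 : 𝕜) • d 𝕜 ^ s • e 𝕜 .v
        + (s : 𝕜) • (l 𝕜 0 .v * d 𝕜 ^ (s - 1)) • e 𝕜 .v)
  | l1g_ds_v (s : ℕ) (hs : 1 ≤ s) : ExtraRel 𝕜 ((l 𝕜 1 .g * d 𝕜 ^ s) • e 𝕜 .v)
      (-((l 𝕜 0 .v * d 𝕜 ^ (s - 1)) • e 𝕜 .g) + d 𝕜 ^ s • e 𝕜 .g
        + ((s : 𝕜) + 1) • (l 𝕜 0 .g * d 𝕜 ^ (s - 1)) • e 𝕜 .v)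
  | l1v_ds_g (s : ℕ) (hs : 1 ≤ s) : ExtraRel 𝕜 ((l 𝕜 1 .v * d 𝕜 ^ s) • e 𝕜 .g)
      (-((l 𝕜 0 .g * d 𝕜 ^ (s - 1)) • e 𝕜 .v) + (1 / 2 : 𝕜) • d 𝕜 ^ s • e 𝕜 .g
        + ((s : 𝕜) + 1) • (l 𝕜 0 .v * d 𝕜 ^ (s - 1)) • e 𝕜 .g)
  | l1g_ds_g (s : ℕ) (hs : 1 ≤ s) : ExtraRel 𝕜 ((l 𝕜 1 .g * d 𝕜 ^ s) • e 𝕜 .g)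
      (((s : 𝕜) + 2) • (l 𝕜 0 .g * d 𝕜 ^ (s - 1)) • e 𝕜 .g
        + (1 / 2 : 𝕜) • d 𝕜 ^ (s - 1) • e 𝕜 .v)

/-- The defining relations of `A(X, K₁)` as polynomials. -/
def algRels (𝕜 : Type*) [Field 𝕜] : Set (GS.FreeAlg 𝕜 Letter) :=
  {f | ∃ p q, AlgRel 𝕜 p q ∧ f = p - q}

/-- The defining relations of `U(K₁; X, N)` as elements of the free module. -/
def defRels (𝕜 : Type*) [Field 𝕜] : Set (GS.FreeMod 𝕜 Letter Gen) :=
  {f | ∃ p q, DefRel 𝕜 p q ∧ f = p - q}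

/-- The additional relations as elements of the free module. -/
def extraRels (𝕜 : Type*) [Field 𝕜] : Set (GS.FreeMod 𝕜 Letter Gen) :=
  {f | ∃ p q, ExtraRel 𝕜 p q ∧ f = p - q}

/-- The associative algebra `A(X, K₁)`. -/
abbrev A (𝕜 : Type*) [Field 𝕜] := RingQuot (AlgRel 𝕜)

/-- The projection of the free algebra onto `A(X, K₁)`. -/
noncomputable def toA (𝕜 : Type*) [Field 𝕜] : GS.FreeAlg 𝕜 Letter →ₐ[𝕜] A 𝕜 :=
  RingQuot.mkAlgHom 𝕜 (AlgRel 𝕜)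

/-- The projection of the free module over the free algebra onto the free `A(X, K₁)`-module. -/
noncomputable def toFreeA (𝕜 : Type*) [Field 𝕜] : GS.FreeMod 𝕜 Letter Gen →ₗ[𝕜] (Gen →₀ A 𝕜) :=
  Finsupp.mapRange.linearMap (toA 𝕜).toLinearMap

/-- The action of the letters on an envelope `(C, φ)` of `K₁`: `∂` acts as `∂`,
`L_n^a f = a (n) f`, and `R_n^a f = {f (n) a}`. -/
noncomputable def act {C : Type*} [AddCommGroup C] [Module 𝕜 C] (S : ConformalSuperalgebra 𝕜 C)
    (φ : K1 𝕜 →ₗ[𝕜] C) : Letter → C → C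
  | .d, f => S.der f
  | .L n a, f => S.prod n (φ (K1.gen 𝕜 a)) f
  | .R n a, f => S.curly n f (φ (K1.gen 𝕜 a))

end NeveuSchwartz

set_option linter.unusedSimpArgs false

/-! ### Leading monomials and a linear-independence criterion for Gröbner–Shirshov bases. -/

namespace GS

variable {𝕜 Z Y : Type*} [Field 𝕜]

/-! The module presented by the relations is compared with one concrete envelope. Call normal the
monomials `(L_0^v)^a (L_0^g)^o ∂^s y` with `o ≤ 1`, and `(L_0^v)^a L_1^x g`. Every other monomial is
the principal monomial of a multiple of a relation (`normal_or_red`), so the normal ones span the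
module. They are also independent, because their images are independent in `Cend_{1|1}`, the algebra
of polynomials in `∂` over the 2×2 matrices with entries in `𝕜[x]`, in which a constant matrix `a`
multiplies by `a (n) f = a (d/d∂ + d/dx)^n f`. There `v ↦ x - ½ ∂ e₂₂` and `g ↦ e₂₁ - ¼ x e₁₂`
define an envelope with the prescribed locality (`isPreEnvelope_model`,
`linearIndependent_normalMon`).

This independence settles the compositions of the module relations without computing them. A
composition is a difference of two multiples with the same principal monomial. Modulo trivial terms
it reduces to a combination of normal monomials, and its value in the model is zero, so that
combination is zero (`isModGSB_of_linearIndependent`). Only the compositions inside `A(X, K₁)` are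
computed: its relations are super-commutator relations of letters, and the overlaps resolve by the
super Jacobi identity (`overlap_mem`, `isAlgGSB_algRels`).

Every envelope is an `A(X, K₁)`-module that satisfies the defining relations (`freeAct_algRel`,
`ev_defRel`) and is generated by `v` and `g` (`ev_surjective`). The additional relations follow by
comparing the two expressions for `R_n^x y` and commuting letters past them (`ExtraRel.map_eq`). By
the normal forms, the kernel of the evaluation in the model is exactly the submodule of relations
(`ev_model_eq_zero_iff`). Hence the subalgebra of the model generated by `v` and `g` maps to every
envelope and is initial. Any universal envelope maps to it in turn, so it satisfies no further
relations either (`ev_eq_zero_iff`). -/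

theorem word_mul (a b : FreeMonoid Z) : word 𝕜 (a * b) = word 𝕜 a * word 𝕜 b := map_mul _ _ _

theorem word_one : word 𝕜 (1 : FreeMonoid Z) = 1 := map_one _

theorem coeff_word_self (w : FreeMonoid Z) : (word 𝕜 w).coeff w = 1 := by
  simp [word, MonoidAlgebra.of]

theorem coeff_word_of_ne {v w : FreeMonoid Z} (h : w ≠ v) : (word 𝕜 w).coeff v = 0 := by
  simp [word, MonoidAlgebra.of, h]

/-- The monomial `w y` of the free module. -/
noncomputable def mon (𝕜 : Type*) [Field 𝕜] {Z Y : Type*} (p : FreeMonoid Z × Y) :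
    FreeMod 𝕜 Z Y :=
  word 𝕜 p.1 • gen 𝕜 Z p.2

theorem smul_gen_eq_single (f : FreeAlg 𝕜 Z) (y : Y) :
    f • gen 𝕜 Z y = Finsupp.single y f := by
  simp [gen]

theorem coeff_mon_self (p : FreeMonoid Z × Y) : (mon 𝕜 p p.2).coeff p.1 = 1 := by
  rw [mon, smul_gen_eq_single, Finsupp.single_eq_same, coeff_word_self]

theorem coeff_mon_of_ne {p q : FreeMonoid Z × Y} (h : p ≠ q) : (mon 𝕜 p q.2).coeff q.1 = 0 := by
  rw [mon, smul_gen_eq_single]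
  by_cases hy : p.2 = q.2
  · rw [hy, Finsupp.single_eq_same, coeff_word_of_ne]
    intro hw
    exact h (Prod.ext hw hy)
  · rw [Finsupp.single_eq_of_ne (Ne.symm hy)]
    rfl

theorem word_smul_mon (a : FreeMonoid Z) (p : FreeMonoid Z × Y) :
    word 𝕜 a • mon 𝕜 p = mon 𝕜 (a * p.1, p.2) := by
  rw [mon, mon, smul_smul, word_mul]

/-- A well-founded strict order on words compatible with concatenation. -/
structure IsMonomialOrder (lt : FreeMonoid Z → FreeMonoid Z → Prop) : Prop where
  wf : WellFounded lt
  trans : ∀ {u v w}, lt u v → lt v w → lt u w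
  mul : ∀ {u v} (a b), lt u v → lt (a * u * b) (a * v * b)

variable {lt : FreeMonoid Z → FreeMonoid Z → Prop} {ltY : Y → Y → Prop}

theorem IsMonomialOrder.mul_left (h : IsMonomialOrder lt) {u v : FreeMonoid Z} (a : FreeMonoid Z)
    (huv : lt u v) : lt (a * u) (a * v) := by
  simpa using h.mul a 1 huv

theorem modLt_wf (h : WellFounded lt) (hY : WellFounded ltY) : WellFounded (modLt lt ltY) := by
  refine Subrelation.wf ?_ (WellFounded.prod_lex h hY)
  rintro ⟨a, x⟩ ⟨b, y⟩ (h | ⟨h1, h2⟩)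
  · exact Prod.Lex.left _ _ h
  · obtain rfl : a = b := h1
    exact Prod.Lex.right _ h2

theorem modLt_mul_left (h : IsMonomialOrder lt) {p q : FreeMonoid Z × Y} (a : FreeMonoid Z)
    (hpq : modLt lt ltY p q) : modLt lt ltY (a * p.1, p.2) (a * q.1, q.2) := by
  rcases hpq with hpq | ⟨h1, h2⟩
  · exact Or.inl (h.mul_left a hpq)
  · exact Or.inr ⟨by rw [h1], h2⟩

/-- The span of the words smaller than `w`. -/
noncomputable def below (𝕜 : Type*) [Field 𝕜] (lt : FreeMonoid Z → FreeMonoid Z → Prop)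
    (w : FreeMonoid Z) : Submodule 𝕜 (FreeAlg 𝕜 Z) :=
  Submodule.span 𝕜 (word 𝕜 '' {v | lt v w})

/-- The span of the module monomials smaller than `p`. -/
noncomputable def modBelow (𝕜 : Type*) [Field 𝕜] (lt : FreeMonoid Z → FreeMonoid Z → Prop)
    (ltY : Y → Y → Prop) (p : FreeMonoid Z × Y) : Submodule 𝕜 (FreeMod 𝕜 Z Y) :=
  Submodule.span 𝕜 (mon 𝕜 '' {q | modLt lt ltY q p})

theorem word_mem_below {v w : FreeMonoid Z} (h : lt v w) : word 𝕜 v ∈ below 𝕜 lt w :=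
  Submodule.subset_span ⟨v, h, rfl⟩

theorem mon_mem_modBelow {p q : FreeMonoid Z × Y} (h : modLt lt ltY q p) :
    mon 𝕜 q ∈ modBelow 𝕜 lt ltY p :=
  Submodule.subset_span ⟨q, h, rfl⟩

theorem coeff_eq_zero_of_mem_below {f : FreeAlg 𝕜 Z} {w v : FreeMonoid Z}
    (hf : f ∈ below 𝕜 lt w) (hv : ¬ lt v w) : f.coeff v = 0 := by
  induction hf using Submodule.span_induction with
  | mem x hx =>
    obtain ⟨u, hu, rfl⟩ := hx
    exact coeff_word_of_ne fun h => hv (h ▸ hu)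
  | zero => rfl
  | add x y _ _ hx hy => simp [hx, hy]
  | smul c x _ hx => simp [hx]

theorem coeff_eq_zero_of_mem_modBelow {f : FreeMod 𝕜 Z Y} {p q : FreeMonoid Z × Y}
    (hf : f ∈ modBelow 𝕜 lt ltY p) (hq : ¬ modLt lt ltY q p) : (f q.2).coeff q.1 = 0 := by
  induction hf using Submodule.span_induction with
  | mem x hx =>
    obtain ⟨u, hu, rfl⟩ := hx
    exact coeff_mon_of_ne fun h => hq (h ▸ hu)
  | zero => rfl
  | add x y _ _ hx hy => simp [hx, hy]
  | smul c x _ hx => simp [hx]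

theorem eq_sum_word (f : FreeAlg 𝕜 Z) : f = f.coeff.sum fun w c => c • word 𝕜 w := by
  conv_lhs => rw [← f.sum_coeff_single]
  refine Finsupp.sum_congr fun w _ => ?_
  simp [word, MonoidAlgebra.of]

/-- The predicate is arbitrary so that the lemma serves for monomials below a given one and, with
`True`, for the whole free module. -/
theorem mem_span_mon {f : FreeMod 𝕜 Z Y} {P : FreeMonoid Z × Y → Prop}
    (h : ∀ q : FreeMonoid Z × Y, (f q.2).coeff q.1 ≠ 0 → P q) :
    f ∈ Submodule.span 𝕜 (mon 𝕜 '' {q | P q}) := by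
  rw [← Finsupp.sum_single f]
  refine Submodule.sum_mem _ fun y _ => ?_
  have hy : Finsupp.single y (f y) = (f y).coeff.sum fun w c => c • mon 𝕜 (w, y) := by
    conv_lhs => rw [eq_sum_word (f y)]
    rw [← smul_gen_eq_single, Finsupp.sum, Finsupp.sum, Finset.sum_smul]
    exact Finset.sum_congr rfl fun w _ => smul_assoc _ _ _
  change Finsupp.single y (f y) ∈ _
  rw [hy]
  refine Submodule.sum_mem _ fun w hw => Submodule.smul_mem _ _ ?_
  exact Submodule.subset_span ⟨(w, y), h (w, y) (Finsupp.mem_support_iff.1 hw), rfl⟩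

/-- With the converse `IsLead.sub_mem`, this trades a condition on coefficients for membership in a
span of smaller words, which is stable under multiplication by words on both sides. -/
theorem isLead_of_sub_mem (h : WellFounded lt) {f : FreeAlg 𝕜 Z} {w : FreeMonoid Z}
    (hf : f - word 𝕜 w ∈ below 𝕜 lt w) : IsLead lt f w := by
  have key : f = (f - word 𝕜 w) + word 𝕜 w := by abel
  refine ⟨?_, fun v hv hvw => ?_⟩
  · rw [key, MonoidAlgebra.coeff_add, Finsupp.add_apply,
      coeff_eq_zero_of_mem_below hf (h.irrefl.irrefl w), coeff_word_self, zero_add]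
  · by_contra hlt
    apply hv
    rw [key, MonoidAlgebra.coeff_add, Finsupp.add_apply, coeff_eq_zero_of_mem_below hf hlt,
      coeff_word_of_ne (Ne.symm hvw), zero_add]

theorem IsLead.sub_mem {f : FreeAlg 𝕜 Z} {w : FreeMonoid Z} (hf : IsLead lt f w) :
    f - word 𝕜 w ∈ below 𝕜 lt w := by
  rw [eq_sum_word (f - word 𝕜 w)]
  refine Submodule.sum_mem _ fun v hv => Submodule.smul_mem _ _ (word_mem_below ?_)
  have hv := Finsupp.mem_support_iff.1 hv
  rw [MonoidAlgebra.coeff_sub, Finsupp.sub_apply] at hv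
  by_cases h : v = w
  · subst h
    simp [coeff_word_self, hf.1] at hv
  · rw [coeff_word_of_ne (Ne.symm h), sub_zero] at hv
    exact hf.2 v hv h

theorem isModLead_of_sub_mem (h : WellFounded (modLt lt ltY)) {f : FreeMod 𝕜 Z Y}
    {p : FreeMonoid Z × Y} (hf : f - mon 𝕜 p ∈ modBelow 𝕜 lt ltY p) : IsModLead lt ltY f p := by
  have key : f = (f - mon 𝕜 p) + mon 𝕜 p := by abel
  refine ⟨?_, fun q hq hqp => ?_⟩
  · rw [key, Finsupp.add_apply, MonoidAlgebra.coeff_add, Finsupp.add_apply,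
      coeff_eq_zero_of_mem_modBelow hf (h.irrefl.irrefl p), coeff_mon_self, zero_add]
  · by_contra hlt
    apply hq
    rw [key, Finsupp.add_apply, MonoidAlgebra.coeff_add, Finsupp.add_apply,
      coeff_eq_zero_of_mem_modBelow hf hlt, coeff_mon_of_ne (Ne.symm hqp), zero_add]

theorem IsModLead.sub_mem {f : FreeMod 𝕜 Z Y} {p : FreeMonoid Z × Y}
    (hf : IsModLead lt ltY f p) : f - mon 𝕜 p ∈ modBelow 𝕜 lt ltY p := by
  refine mem_span_mon fun q hq => ?_
  rw [Finsupp.sub_apply, MonoidAlgebra.coeff_sub, Finsupp.sub_apply] at hq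
  by_cases h : q = p
  · subst h
    simp [coeff_mon_self, hf.1] at hq
  · rw [coeff_mon_of_ne (Ne.symm h), sub_zero] at hq
    exact hf.2 q hq h

theorem IsLead.unique (h : WellFounded lt) {f : FreeAlg 𝕜 Z} {w w' : FreeMonoid Z}
    (hw : IsLead lt f w) (hw' : IsLead lt f w') : w = w' := by
  by_contra hne
  exact h.asymmetric _ _ (hw.2 w' (by simp [hw'.1]) (Ne.symm hne))
    (hw'.2 w (by simp [hw.1]) hne)

theorem mul_mem_below (h : IsMonomialOrder lt) {f : FreeAlg 𝕜 Z} {w : FreeMonoid Z}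
    (a b : FreeMonoid Z) (hf : f ∈ below 𝕜 lt w) :
    word 𝕜 a * f * word 𝕜 b ∈ below 𝕜 lt (a * w * b) := by
  induction hf using Submodule.span_induction with
  | mem x hx =>
    obtain ⟨u, hu, rfl⟩ := hx
    rw [← word_mul, ← word_mul]
    exact word_mem_below (h.mul a b hu)
  | zero => simp
  | add x y _ _ hx hy => rw [mul_add, add_mul]; exact add_mem hx hy
  | smul c x _ hx => rw [mul_smul_comm, smul_mul_assoc]; exact Submodule.smul_mem _ _ hx

theorem smul_gen_mem_modBelow {f : FreeAlg 𝕜 Z} {w : FreeMonoid Z} (y : Y)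
    (hf : f ∈ below 𝕜 lt w) : f • gen 𝕜 Z y ∈ modBelow 𝕜 lt ltY (w, y) := by
  induction hf using Submodule.span_induction with
  | mem x hx =>
    obtain ⟨u, hu, rfl⟩ := hx
    exact mon_mem_modBelow (q := (u, y)) (Or.inl hu)
  | zero => simp
  | add x y _ _ hx hy => rw [add_smul]; exact add_mem hx hy
  | smul c x _ hx => rw [smul_assoc]; exact Submodule.smul_mem _ _ hx

theorem word_smul_mem_modBelow (h : IsMonomialOrder lt) {f : FreeMod 𝕜 Z Y}
    {p : FreeMonoid Z × Y} (a : FreeMonoid Z) (hf : f ∈ modBelow 𝕜 lt ltY p) :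
    word 𝕜 a • f ∈ modBelow 𝕜 lt ltY (a * p.1, p.2) := by
  induction hf using Submodule.span_induction with
  | mem x hx =>
    obtain ⟨u, hu, rfl⟩ := hx
    rw [word_smul_mon]
    exact mon_mem_modBelow (modLt_mul_left h a hu)
  | zero => simp
  | add x y _ _ hx hy => rw [smul_add]; exact add_mem hx hy
  | smul c x _ hx => rw [smul_comm]; exact Submodule.smul_mem _ _ hx

theorem IsLead.smul_gen_sub_mem (h : IsMonomialOrder lt) {s : FreeAlg 𝕜 Z} {w : FreeMonoid Z}
    (hs : IsLead lt s w) (a b : FreeMonoid Z) (y : Y) :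
    (word 𝕜 a * s * word 𝕜 b) • gen 𝕜 Z y - mon 𝕜 (a * w * b, y) ∈
      modBelow 𝕜 lt ltY (a * w * b, y) := by
  have h1 := smul_gen_mem_modBelow (ltY := ltY) y (mul_mem_below h a b hs.sub_mem)
  rwa [mul_sub, sub_mul, sub_smul, ← word_mul, ← word_mul] at h1

theorem IsModLead.word_smul_sub_mem (h : IsMonomialOrder lt) {t : FreeMod 𝕜 Z Y}
    {p : FreeMonoid Z × Y} (ht : IsModLead lt ltY t p) (a : FreeMonoid Z) :
    word 𝕜 a • t - mon 𝕜 (a * p.1, p.2) ∈ modBelow 𝕜 lt ltY (a * p.1, p.2) := by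
  have h1 := word_smul_mem_modBelow h a ht.sub_mem
  rwa [smul_sub, word_smul_mon] at h1

/-- `f` is a multiple `a s b y` or `a t` of a relation, with principal monomial `p`. -/
inductive IsMultiple (lt : FreeMonoid Z → FreeMonoid Z → Prop) (ltY : Y → Y → Prop)
    (S : Set (FreeAlg 𝕜 Z)) (T : Set (FreeMod 𝕜 Z Y)) :
    FreeMod 𝕜 Z Y → FreeMonoid Z × Y → Prop
  | alg {s : FreeAlg 𝕜 Z} (hs : s ∈ S) {w : FreeMonoid Z} (hw : IsLead lt s w)
      (a b : FreeMonoid Z) (y : Y) :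
      IsMultiple lt ltY S T ((word 𝕜 a * s * word 𝕜 b) • gen 𝕜 Z y) (a * w * b, y)
  | mod {t : FreeMod 𝕜 Z Y} (ht : t ∈ T) {q : FreeMonoid Z × Y} (hq : IsModLead lt ltY t q)
      (a : FreeMonoid Z) : IsMultiple lt ltY S T (word 𝕜 a • t) (a * q.1, q.2)

variable {S : Set (FreeAlg 𝕜 Z)} {T : Set (FreeMod 𝕜 Z Y)}

theorem IsMultiple.sub_mem (h : IsMonomialOrder lt) {f : FreeMod 𝕜 Z Y} {p : FreeMonoid Z × Y}
    (hf : IsMultiple lt ltY S T f p) : f - mon 𝕜 p ∈ modBelow 𝕜 lt ltY p := by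
  cases hf with
  | alg hs hw a b y => exact hw.smul_gen_sub_mem h a b y
  | mod ht hq a => exact hq.word_smul_sub_mem h a

theorem IsMultiple.mem_trivialMod {f : FreeMod 𝕜 Z Y} {p q : FreeMonoid Z × Y}
    (hf : IsMultiple lt ltY S T f q) (hq : modLt lt ltY q p) : f ∈ trivialMod lt ltY S T p := by
  apply Submodule.subset_span
  cases hf with
  | alg hs hw a b y => exact Or.inl ⟨_, hs, a, b, _, y, hw, hq, rfl⟩
  | mod ht hw a => exact Or.inr ⟨_, ht, a, _, hw, hq, rfl⟩

/-- A monomial is reducible if it is the principal monomial of a multiple of a relation. -/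
def Reducible (lt : FreeMonoid Z → FreeMonoid Z → Prop) (ltY : Y → Y → Prop)
    (S : Set (FreeAlg 𝕜 Z)) (T : Set (FreeMod 𝕜 Z Y)) (p : FreeMonoid Z × Y) : Prop :=
  ∃ f, IsMultiple lt ltY S T f p

/-- Reducibility passes to left multiples, so the normal monomials can be determined by prepending
one letter at a time. -/
theorem Reducible.mul_left {p : FreeMonoid Z × Y} (hp : Reducible lt ltY S T p)
    (a : FreeMonoid Z) : Reducible lt ltY S T (a * p.1, p.2) := by
  obtain ⟨f, hf⟩ := hp
  cases hf with
  | alg hs hw a' b y =>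
    exact ⟨_, by simpa only [mul_assoc] using IsMultiple.alg hs hw (a * a') b y⟩
  | mod ht hq a' =>
    exact ⟨_, by simpa only [mul_assoc] using IsMultiple.mod (S := S) ht hq (a * a')⟩

variable {I : Type*} {nf : I → FreeMonoid Z × Y}

/-- Reduction to normal form: monomials in a downward closed set are congruent to combinations of
normal monomials modulo any subspace that contains the multiples of relations with principal
monomial in that set. -/
theorem mon_mem_sup (h : IsMonomialOrder lt) (hY : WellFounded ltY)
    (hred : ∀ p, p ∈ Set.range nf ∨ Reducible lt ltY S T p)
    {P : FreeMonoid Z × Y → Prop} (hP : ∀ p q, modLt lt ltY q p → P p → P q)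
    {K : Submodule 𝕜 (FreeMod 𝕜 Z Y)}
    (hK : ∀ f p, P p → IsMultiple lt ltY S T f p → f ∈ K) (p : FreeMonoid Z × Y) (hp : P p) :
    mon 𝕜 p ∈ Submodule.span 𝕜 (Set.range fun i => mon 𝕜 (nf i)) ⊔ K := by
  induction p using (modLt_wf h.wf hY).induction with
  | _ p ih =>
    rcases hred p with ⟨i, rfl⟩ | ⟨f, hf⟩
    · exact Submodule.mem_sup_left (Submodule.subset_span ⟨i, rfl⟩)
    -- One reduction step: modulo `K` the monomial becomes a combination of smaller ones, and these
    -- still satisfy `P`.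
    · have h1 : mon 𝕜 p = f - (f - mon 𝕜 p) := by abel
      rw [h1]
      refine sub_mem (Submodule.mem_sup_right (hK f p hp hf)) ?_
      have h2 : modBelow 𝕜 lt ltY p ≤
          Submodule.span 𝕜 (Set.range fun i => mon 𝕜 (nf i)) ⊔ K := by
        refine Submodule.span_le.2 ?_
        rintro _ ⟨q, hq, rfl⟩
        exact ih q hq (hP p q hq hp)
      exact h2 (hf.sub_mem h)

theorem eq_zero_of_mem_span_of_linearIndependent {V C : Type*} [AddCommGroup V] [Module 𝕜 V]
    [AddCommGroup C] [Module 𝕜 C] {b : I → V} {E : V →ₗ[𝕜] C}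
    (hE : LinearIndependent 𝕜 fun i => E (b i)) {x : V}
    (hx : x ∈ Submodule.span 𝕜 (Set.range b)) (h0 : E x = 0) : x = 0 := by
  obtain ⟨c, rfl⟩ := Finsupp.mem_span_range_iff_exists_finsupp.1 hx
  have : c = 0 := by
    apply linearIndependent_iff.1 hE c
    rw [← h0, Finsupp.linearCombination_apply, map_finsuppSum]
    simp
  simp [this]

/-- A criterion for Gröbner–Shirshov bases of modules: the images of the normal monomials in some
vector space on which all relations vanish are linearly independent. -/
theorem isModGSB_of_linearIndependent (h : IsMonomialOrder lt) (hY : WellFounded ltY)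
    (hS : IsAlgGSB lt S) (hT : ∀ t ∈ T, ∃ p, IsModLead lt ltY t p)
    (hred : ∀ p, p ∈ Set.range nf ∨ Reducible lt ltY S T p)
    (htrans : ∀ x y z : Y, ltY x y → ltY y z → ltY x z)
    {C : Type*} [AddCommGroup C] [Module 𝕜 C] (E : FreeMod 𝕜 Z Y →ₗ[𝕜] C)
    (hES : ∀ s ∈ S, ∀ a b y, E ((word 𝕜 a * s * word 𝕜 b) • gen 𝕜 Z y) = 0)
    (hET : ∀ t ∈ T, ∀ a : FreeMonoid Z, E (word 𝕜 a • t) = 0)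
    (hE : LinearIndependent 𝕜 fun i => E (mon 𝕜 (nf i))) : IsModGSB lt ltY S T := by
  have htr : ∀ p q r : FreeMonoid Z × Y, modLt lt ltY p q → modLt lt ltY q r →
      modLt lt ltY p r := by
    rintro p q r (h1 | ⟨h1, h1'⟩) (h2 | ⟨h2, h2'⟩)
    · exact Or.inl (h.trans h1 h2)
    · exact Or.inl (h2 ▸ h1)
    · exact Or.inl (h1 ▸ h2)
    · exact Or.inr ⟨h1.trans h2, htrans _ _ _ h1' h2'⟩
  -- Reduce `f` to a normal part plus a trivial part. The map `E` kills `f` and the trivial part,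
  -- hence the normal part, which is then zero by independence.
  have key : ∀ (p : FreeMonoid Z × Y) (f : FreeMod 𝕜 Z Y), f ∈ modBelow 𝕜 lt ltY p →
      E f = 0 → f ∈ trivialMod lt ltY S T p := by
    intro p f hf hf0
    have h1 : modBelow 𝕜 lt ltY p ≤
        Submodule.span 𝕜 (Set.range fun i => mon 𝕜 (nf i)) ⊔ trivialMod lt ltY S T p := by
      refine Submodule.span_le.2 ?_
      rintro _ ⟨q, hq, rfl⟩
      exact mon_mem_sup h hY hred (P := fun q => modLt lt ltY q p)
        (fun q r hr hq => htr _ _ _ hr hq) (fun f q hq hf => hf.mem_trivialMod hq) q hq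
    have h2 : trivialMod lt ltY S T p ≤ LinearMap.ker E := by
      refine Submodule.span_le.2 ?_
      rintro _ (⟨s, hs, a, b, ws, y, -, -, rfl⟩ | ⟨t, ht, a, q, -, -, rfl⟩)
      · exact hES s hs a b y
      · exact hET t ht a
    obtain ⟨n, hn, k, hk, rfl⟩ := Submodule.mem_sup.1 (h1 hf)
    have h3 : E k = 0 := h2 hk
    rw [map_add, h3, add_zero] at hf0
    rw [eq_zero_of_mem_span_of_linearIndependent hE hn hf0, zero_add]
    exact hk
  -- All three kinds of composition have this shape: two multiples with the same principal monomial,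
  -- both killed by `E`, so that the principal terms cancel.
  have key2 : ∀ p f g, f - mon 𝕜 p ∈ modBelow 𝕜 lt ltY p → g - mon 𝕜 p ∈ modBelow 𝕜 lt ltY p →
      E f = 0 → E g = 0 → f - g ∈ trivialMod lt ltY S T p := by
    intro p f g hf hg hf0 hg0
    refine key p _ ?_ (by rw [map_sub, hf0, hg0, sub_zero])
    have := sub_mem hf hg
    rwa [sub_sub_sub_cancel_right] at this
  refine ⟨hS, hT, ?_, ?_, ?_⟩
  · intro s hs t ht a b c y _ hs' ht'
    refine key2 _ _ _ ?_ ?_ ?_ (hET t ht a)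
    · simpa [word_one] using hs'.smul_gen_sub_mem h 1 b y
    · simpa only [mul_assoc] using ht'.word_smul_sub_mem h a
    · simpa [word_one] using hES s hs 1 b y
  · intro s hs t ht a b w y hs' ht'
    refine key2 _ _ _ ht'.sub_mem (hs'.smul_gen_sub_mem h a b y) ?_ (hES s hs a b y)
    simpa [word_one] using hET t ht 1
  · intro t ht t' ht' a w y hl hl'
    refine key2 _ _ _ hl.sub_mem (hl'.word_smul_sub_mem h a) ?_ (hET t' ht' a)
    simpa [word_one] using hET t ht 1

end GS

/-! ### The order on words is a monomial order. -/

namespace NeveuSchwartz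

open GS

theorem Letter.lt_wf : WellFounded Letter.Lt := InvImage.wf Letter.key wellFounded_lt

theorem Letter.lt_trans {x y z : Letter} (h1 : x.Lt y) (h2 : y.Lt z) : x.Lt z :=
  _root_.lt_trans (α := ℕ ×ₗ ℕ ×ₗ ℕ) h1 h2

theorem Letter.lt_irrefl (x : Letter) : ¬ x.Lt x := _root_.lt_irrefl (α := ℕ ×ₗ ℕ ×ₗ ℕ) _

theorem Gen.idx_injective : Function.Injective Gen.idx := by
  intro x y; cases x <;> cases y <;> simp [Gen.idx]

theorem Letter.key_injective : Function.Injective Letter.key := by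
  intro x y h
  cases x <;> cases y <;> simp only [Letter.key, toLex_inj, Prod.mk.injEq] at h
  · rfl
  · split_ifs at h <;> simp_all
  · simp_all
  · split_ifs at h <;> simp_all
  · obtain ⟨-, h1, h2⟩ := h
    rw [h1, Gen.idx_injective h2]
  · split_ifs at h <;> simp_all
  · simp_all
  · split_ifs at h <;> simp_all
  · obtain ⟨-, h1, h2⟩ := h
    rw [h1, Gen.idx_injective h2]

theorem Letter.lt_trichotomy (x y : Letter) : x.Lt y ∨ x = y ∨ y.Lt x := by
  rcases _root_.lt_trichotomy x.key y.key with h | h | h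
  · exact Or.inl h
  · exact Or.inr (Or.inl (Letter.key_injective h))
  · exact Or.inr (Or.inr h)

theorem Letter.L_lt_L {n m : ℕ} {a b : Gen} :
    (Letter.L n a).Lt (.L m b) ↔ n < m ∨ (n = m ∧ a.idx < b.idx) := by
  simp only [Letter.Lt, Letter.key, Prod.Lex.toLex_lt_toLex]
  split_ifs <;> omega

theorem Letter.L_lt_d {n : ℕ} {a : Gen} : (Letter.L n a).Lt .d ↔ n ≤ 1 := by
  simp only [Letter.Lt, Letter.key, Prod.Lex.toLex_lt_toLex]
  split_ifs <;> simp_all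

theorem Letter.d_lt_L {n : ℕ} {a : Gen} : Letter.d.Lt (.L n a) ↔ 2 ≤ n := by
  simp only [Letter.Lt, Letter.key, Prod.Lex.toLex_lt_toLex]
  split_ifs <;> simp <;> omega

theorem Letter.L_lt_R (n m : ℕ) (a b : Gen) : (Letter.L n a).Lt (.R m b) := by
  simp only [Letter.Lt, Letter.key, Prod.Lex.toLex_lt_toLex]
  split_ifs <;> omega

theorem Letter.d_lt_R (m : ℕ) (b : Gen) : Letter.d.Lt (.R m b) := by
  simp only [Letter.Lt, Letter.key, Prod.Lex.toLex_lt_toLex]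
  omega

theorem degR_mul (u w : FreeMonoid Letter) : degR (u * w) = degR u + degR w := by
  simp [degR]

/-- A list of letters as a word. -/
def W (l : List Letter) : FreeMonoid Letter := FreeMonoid.ofList l

/-- Length followed by lexicographic comparison is the shortlex order, which is well-founded over a
well-founded alphabet although the lexicographic order alone is not. -/
theorem wordLt_iff (u w : FreeMonoid Letter) : wordLt u w ↔
    degR u < degR w ∨ (degR u = degR w ∧ List.Shortlex Letter.Lt u.toList w.toList) := by
  rw [wordLt, List.shortlex_def]
  rfl

theorem wordLt_wf : WellFounded wordLt := by
  have h := WellFounded.prod_lex (wellFounded_lt (α := ℕ)) (List.Shortlex.wf Letter.lt_wf)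
  refine Subrelation.wf ?_ (InvImage.wf (fun w : FreeMonoid Letter => (degR w, w.toList)) h)
  intro u w huw
  rw [wordLt_iff] at huw
  rcases huw with h | ⟨h, h'⟩
  · exact Prod.Lex.left _ _ h
  · change Prod.Lex _ _ (degR u, u.toList) (degR w, w.toList)
    rw [h]
    exact Prod.Lex.right _ h'

/-- Equal length is essential: if `l` were a proper prefix of `l'`, the appended word could reverse
the comparison. -/
theorem lex_append_right {l l' : List Letter} (h : List.Lex Letter.Lt l l')
    (hl : l.length = l'.length) (m : List Letter) : List.Lex Letter.Lt (l ++ m) (l' ++ m) := by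
  induction h with
  | nil => simp at hl
  | rel h => exact .rel h
  | cons _ ih => exact .cons (ih (by simpa using hl))

theorem isMonomialOrder_wordLt : IsMonomialOrder wordLt where
  wf := wordLt_wf
  trans := by
    rintro u v w (h1 | ⟨h1, h1' | ⟨h1', h1''⟩⟩) (h2 | ⟨h2, h2' | ⟨h2', h2''⟩⟩)
    · exact Or.inl (h1.trans h2)
    · exact Or.inl (h2 ▸ h1)
    · exact Or.inl (h2 ▸ h1)
    · exact Or.inl (h1 ▸ h2)
    · exact Or.inr ⟨h1.trans h2, Or.inl (h1'.trans h2')⟩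
    · exact Or.inr ⟨h1.trans h2, Or.inl (h2' ▸ h1')⟩
    · exact Or.inl (h1 ▸ h2)
    · exact Or.inr ⟨h1.trans h2, Or.inl (h1' ▸ h2')⟩
    · exact Or.inr ⟨h1.trans h2, Or.inr ⟨h1'.trans h2',
        List.lex_trans (fun h h' => Letter.lt_trans h h') h1'' h2''⟩⟩
  mul := by
    rintro u v a b h
    simp only [wordLt, degR_mul, FreeMonoid.length_mul, FreeMonoid.toList_mul] at h ⊢
    rcases h with h | ⟨h, h' | ⟨h', h''⟩⟩
    · left; omega
    · right; refine ⟨by omega, Or.inl (by omega)⟩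
    · right
      refine ⟨by omega, Or.inr ⟨by omega, ?_⟩⟩
      exact lex_append_right (List.Lex.append_left _ h'' _)
        (by simpa [FreeMonoid.length] using h') _

theorem wordLt_of_length {u w : FreeMonoid Letter} (h : degR u ≤ degR w)
    (h' : u.length < w.length) : wordLt u w := by
  rcases h.lt_or_eq with h | h
  · exact Or.inl h
  · exact Or.inr ⟨h, Or.inl h'⟩

theorem wordLt_of_lex {u w : FreeMonoid Letter} (h : degR u = degR w)
    (h' : u.length = w.length) (hl : List.Lex Letter.Lt u.toList w.toList) : wordLt u w :=
  Or.inr ⟨h, Or.inr ⟨h', hl⟩⟩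

theorem Gen.lt_wf : WellFounded Gen.Lt := InvImage.wf Gen.idx wellFounded_lt

theorem Gen.lt_trans (x y z : Gen) (h1 : x.Lt y) (h2 : y.Lt z) : x.Lt z := Nat.lt_trans h1 h2

theorem letter_mul (x y : Letter) (𝕜 : Type*) [Field 𝕜] :
    letter 𝕜 x * letter 𝕜 y = word 𝕜 (W [x, y]) := by
  rw [letter, letter, ← word_mul]; rfl

end NeveuSchwartz

/-! ### The relations of `A(X, K₁)` as super-commutators, and the Jacobi identity. -/

namespace NeveuSchwartz

open GS

/-- The odd letters among `∂`, `L_n^a`; the letters `R_n^a` are regarded as even. -/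
def Letter.odd : Letter → Bool
  | .L _ .g => true
  | _ => false

/-- The sign in the super-commutator of two letters. -/
def sgn (𝕜 : Type*) [Field 𝕜] (x y : Letter) : 𝕜 := if x.odd && y.odd then -1 else 1

/-- The super-commutator of two letters is a multiple of this letter. -/
def brLetter : Letter → Letter → Letter
  | .L n .v, .L m .v => .L (n + m - 1) .v
  | .L n .v, .L m .g => .L (n + m - 1) .g
  | .L n .g, .L m .v => .L (n + m - 1) .g
  | .L n .g, .L m .g => .L (n + m) .v
  | .L n a, .d => .L (n - 1) a
  | .d, .L n a => .L (n - 1) a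
  | .R n a, _ => .R (n - 1) a
  | _, .R n a => .R (n - 1) a
  | .d, .d => .d

/-- The coefficient of `brLetter x y` in the super-commutator of `x` and `y`. -/
def brCoef (𝕜 : Type*) [Field 𝕜] : Letter → Letter → 𝕜
  | .L n .v, .L m .v => (n : 𝕜) - m
  | .L n .v, .L m .g => 1 / 2 * (n : 𝕜) - m
  | .L n .g, .L m .v => (n : 𝕜) - 1 / 2 * m
  | .L _ .g, .L _ .g => -(1 / 2)
  | .L n _, .d => n
  | .d, .L n _ => -n
  | .R n _, .d => n
  | .d, .R n _ => -n
  | _, _ => 0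

/-- The value of the super-commutator of two letters, as a polynomial. -/
noncomputable def br (𝕜 : Type*) [Field 𝕜] (x y : Letter) : FreeAlg 𝕜 Letter :=
  brCoef 𝕜 x y • letter 𝕜 (brLetter x y)

/-- The difference of the super-commutator of two letters and its value. -/
noncomputable def com (𝕜 : Type*) [Field 𝕜] (x y : Letter) : FreeAlg 𝕜 Letter :=
  letter 𝕜 x * letter 𝕜 y - sgn 𝕜 x y • (letter 𝕜 y * letter 𝕜 x) - br 𝕜 x y

/-- The words `x y` that are the principal words of the defining relations of `A(X, K₁)`. -/
def Adm (x y : Letter) : Prop := (y.Lt x ∧ y.isR = false) ∨ (x = y ∧ x.odd = true)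

open Classical in
/-- The defining relation of `A(X, K₁)` with principal word `x y`. -/
noncomputable def rel (𝕜 : Type*) [Field 𝕜] (x y : Letter) : FreeAlg 𝕜 Letter :=
  (if x = y then (1 / 2 : 𝕜) else 1) • com 𝕜 x y

variable {𝕜 : Type*} [Field 𝕜]

theorem rel_of_ne {x y : Letter} (h : y.Lt x) : rel 𝕜 x y = com 𝕜 x y := by
  rw [rel, if_neg, one_smul]
  rintro rfl
  exact Letter.lt_irrefl _ h

theorem rel_self (x : Letter) : rel 𝕜 x x = (1 / 2 : 𝕜) • com 𝕜 x x := by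
  rw [rel, if_pos rfl]

/-- This turns ten families of relations into one family indexed by admissible pairs, so that the
compositions can be treated uniformly. For `x = y` odd the super-commutator is `2 x x` minus its
value, which explains the factor `1 / 2` in `rel`. -/
theorem mem_algRels_iff [CharZero 𝕜] {f : FreeAlg 𝕜 Letter} :
    f ∈ algRels 𝕜 ↔ ∃ x y, Adm x y ∧ f = rel 𝕜 x y := by
  constructor
  · rintro ⟨p, q, h, rfl⟩
    cases h with
    | d_l0 x =>
      have h : (Letter.L 0 x).Lt .d := Letter.L_lt_d.2 (by norm_num)
      refine ⟨.d, .L 0 x, Or.inl ⟨h, rfl⟩, ?_⟩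
      rw [rel_of_ne h]
      simp [com, br, brCoef, sgn, Letter.odd, d, l]
    | d_l1 x =>
      have h : (Letter.L 1 x).Lt .d := Letter.L_lt_d.2 (by norm_num)
      refine ⟨.d, .L 1 x, Or.inl ⟨h, rfl⟩, ?_⟩
      rw [rel_of_ne h]
      simp [com, br, brCoef, brLetter, sgn, Letter.odd, d, l]
      abel
    | l_d n x hn =>
      have h : Letter.d.Lt (.L n x) := Letter.d_lt_L.2 hn
      refine ⟨.L n x, .d, Or.inl ⟨h, rfl⟩, ?_⟩
      rw [rel_of_ne h]
      cases x <;> simp [com, br, brCoef, brLetter, sgn, Letter.odd, d, l] <;> abel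
    | r_d n x =>
      have h : Letter.d.Lt (.R n x) := Letter.d_lt_R _ _
      refine ⟨.R n x, .d, Or.inl ⟨h, rfl⟩, ?_⟩
      rw [rel_of_ne h]
      simp [com, br, brCoef, brLetter, sgn, Letter.odd, d, r]
      abel
    | r_l n m x y =>
      have h : (Letter.L m y).Lt (.R n x) := Letter.L_lt_R _ _ _ _
      refine ⟨.R n x, .L m y, Or.inl ⟨h, rfl⟩, ?_⟩
      rw [rel_of_ne h]
      simp [com, br, brCoef, sgn, Letter.odd, l, r]
    | l_vv n m hn =>
      have h : (Letter.L m .v).Lt (.L n .v) := Letter.L_lt_L.2 (Or.inl hn)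
      refine ⟨.L n .v, .L m .v, Or.inl ⟨h, rfl⟩, ?_⟩
      rw [rel_of_ne h]
      simp [com, br, brCoef, brLetter, sgn, Letter.odd, l]
      abel
    | l_vg n m hn =>
      have h : (Letter.L m .g).Lt (.L n .v) := Letter.L_lt_L.2 (Or.inl hn)
      refine ⟨.L n .v, .L m .g, Or.inl ⟨h, rfl⟩, ?_⟩
      rw [rel_of_ne h]
      simp [com, br, brCoef, brLetter, sgn, Letter.odd, l]
      abel
    | l_gv n m hn =>
      have h : (Letter.L m .v).Lt (.L n .g) :=
        Letter.L_lt_L.2 (by rcases hn.lt_or_eq with h | h <;> simp [h, Gen.idx])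
      refine ⟨.L n .g, .L m .v, Or.inl ⟨h, rfl⟩, ?_⟩
      rw [rel_of_ne h]
      simp [com, br, brCoef, brLetter, sgn, Letter.odd, l]
      abel
    | l_gg n m hn =>
      have h : (Letter.L m .g).Lt (.L n .g) := Letter.L_lt_L.2 (Or.inl hn)
      refine ⟨.L n .g, .L m .g, Or.inl ⟨h, rfl⟩, ?_⟩
      rw [rel_of_ne h]
      simp [com, br, brCoef, brLetter, sgn, Letter.odd, l]
      abel
    | l_gg_diag n =>
      refine ⟨.L n .g, .L n .g, Or.inr ⟨rfl, rfl⟩, ?_⟩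
      rw [rel_self]
      simp only [com, br, brCoef, brLetter, sgn, Letter.odd, l, Bool.and_self, if_true, two_mul n]
      module
  · rintro ⟨x, y, h | ⟨rfl, h⟩, rfl⟩
    · rw [rel_of_ne h.1]
      obtain ⟨h, hR⟩ := h
      rcases x with _ | ⟨n, a⟩ | ⟨n, a⟩ <;> rcases y with _ | ⟨m, b⟩ | ⟨m, b⟩
      · exact absurd h (Letter.lt_irrefl _)
      · rw [Letter.L_lt_d] at h
        obtain rfl | rfl : m = 0 ∨ m = 1 := by omega
        · exact ⟨_, _, .d_l0 b, by simp [com, br, brCoef, sgn, Letter.odd, d, l]⟩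
        · refine ⟨_, _, .d_l1 b, ?_⟩
          simp [com, br, brCoef, brLetter, sgn, Letter.odd, d, l]
          abel
      · simp [Letter.isR] at hR
      · refine ⟨_, _, .l_d n a (Letter.d_lt_L.1 h), ?_⟩
        cases a <;> simp [com, br, brCoef, brLetter, sgn, Letter.odd, d, l] <;> abel
      · rw [Letter.L_lt_L] at h
        cases a <;> cases b <;> simp only [Gen.idx] at h
        · refine ⟨_, _, .l_vv n m (by omega), ?_⟩
          simp [com, br, brCoef, brLetter, sgn, Letter.odd, l]
          abel
        · refine ⟨_, _, .l_vg n m (by omega), ?_⟩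
          simp [com, br, brCoef, brLetter, sgn, Letter.odd, l]
          abel
        · refine ⟨_, _, .l_gv n m (by omega), ?_⟩
          simp [com, br, brCoef, brLetter, sgn, Letter.odd, l]
          abel
        · refine ⟨_, _, .l_gg n m (by omega), ?_⟩
          simp [com, br, brCoef, brLetter, sgn, Letter.odd, l]
          abel
      · simp [Letter.isR] at hR
      · refine ⟨_, _, .r_d n a, ?_⟩
        simp [com, br, brCoef, brLetter, sgn, Letter.odd, d, r]
        abel
      · exact ⟨_, _, .r_l n m a b, by simp [com, br, brCoef, sgn, Letter.odd, l, r]⟩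
      · simp [Letter.isR] at hR
    · rcases x with _ | ⟨n, _ | _⟩ | _ <;> simp [Letter.odd] at h
      rw [rel_self]
      refine ⟨_, _, .l_gg_diag n, ?_⟩
      simp only [com, br, brCoef, brLetter, sgn, Letter.odd, l, Bool.and_self, if_true, two_mul n]
      module

theorem sgn_mul_self (x y : Letter) : sgn 𝕜 x y * sgn 𝕜 x y = 1 := by
  unfold sgn; split_ifs <;> simp

theorem sgn_comm (x y : Letter) : sgn 𝕜 x y = sgn 𝕜 y x := by
  unfold sgn; rw [Bool.and_comm]

theorem br_symm (x y : Letter) (hy : x.isR = false ∨ y.isR = false) :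
    br 𝕜 x y = -(sgn 𝕜 x y • br 𝕜 y x) := by
  rcases x with _ | ⟨n, _ | _⟩ | ⟨n, a⟩ <;> rcases y with _ | ⟨m, _ | _⟩ | ⟨m, b⟩ <;>
    simp [Letter.isR] at hy <;>
    simp [br, brCoef, brLetter, sgn, Letter.odd, Nat.add_comm] <;> module

theorem com_symm (x y : Letter) (hy : x.isR = false ∨ y.isR = false) :
    com 𝕜 x y = -(sgn 𝕜 x y • com 𝕜 y x) := by
  rw [com, com, br_symm x y hy, sgn_comm y x, smul_sub, smul_sub, smul_smul, sgn_mul_self]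
  module

/-- Parities add under the super-commutator. The factor `brCoef` stays on both sides because
`brLetter` is an arbitrary letter, possibly of the wrong parity, when the super-commutator vanishes.
-/
theorem brCoef_smul_sgn (x y z : Letter) (hy : y.isR = false) (hz : z.isR = false) :
    brCoef 𝕜 x y * sgn 𝕜 (brLetter x y) z = brCoef 𝕜 x y * (sgn 𝕜 x z * sgn 𝕜 y z) := by
  rcases x with _ | ⟨n, _ | _⟩ | ⟨n, a⟩ <;> rcases y with _ | ⟨m, _ | _⟩ | ⟨m, b⟩ <;>
    rcases z with _ | ⟨k, _ | _⟩ | ⟨k, c⟩ <;>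
    simp [Letter.isR] at hy hz <;>
    simp [brCoef, brLetter, sgn, Letter.odd]

theorem brLetter_isR (x y : Letter) (hy : y.isR = false) : (brLetter x y).isR = x.isR := by
  rcases x with _ | ⟨n, _ | _⟩ | ⟨n, a⟩ <;> rcases y with _ | ⟨m, _ | _⟩ | ⟨m, b⟩ <;>
    simp [Letter.isR] at hy <;> rfl

/-- Truncated subtraction can give the three terms of a Jacobi identity different indices, but only
in terms with zero coefficient. The identity therefore reduces to one between scalars. -/
theorem smul_eq_sub_of_index {M : Type*} [AddCommGroup M] [Module 𝕜 M] (f : ℕ → M) (N : ℕ)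
    {i j k : ℕ} {a b c : 𝕜} (h : a = b - c) (hi : a = 0 ∨ i = N) (hj : b = 0 ∨ j = N)
    (hk : c = 0 ∨ k = N) : a • f i = b • f j - c • f k := by
  have key : ∀ {a : 𝕜} {i : ℕ}, a = 0 ∨ i = N → a • f i = a • f N := by
    rintro a i (rfl | rfl) <;> simp
  rw [key hi, key hj, key hk, h, sub_smul]

/-- The common index is `n + m + k - 2` if at most one letter is odd. Otherwise it is `n + m + k -
1`, because the super-commutator of two letters `L^g` does not lower the index. -/
theorem jacobi_L [CharZero 𝕜] (n m k : ℕ) (a b c : Gen) :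
    brCoef 𝕜 (.L m b) (.L k c) • br 𝕜 (.L n a) (brLetter (.L m b) (.L k c)) =
      brCoef 𝕜 (.L n a) (.L m b) • br 𝕜 (brLetter (.L n a) (.L m b)) (.L k c) -
        sgn 𝕜 (.L m b) (.L k c) • brCoef 𝕜 (.L n a) (.L k c) •
          br 𝕜 (brLetter (.L n a) (.L k c)) (.L m b) := by
  have cast : ∀ i : ℕ, i = 0 ∨ ((i - 1 : ℕ) : 𝕜) = (i : 𝕜) - 1 := by
    rintro (_ | i) <;> simp
  have hz : ∀ i j : ℕ, i + j = 0 → (i : 𝕜) = 0 ∧ (j : 𝕜) = 0 := by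
    intro i j h; simp; omega
  cases a <;> cases b <;> cases c <;>
    simp only [br, brCoef, brLetter, sgn, Letter.odd, smul_smul, Bool.and_true, Bool.and_false,
      Bool.and_self, Bool.false_eq_true, if_true, if_false]
  case v.v.v | v.v.g | v.g.v | g.v.v =>
    refine smul_eq_sub_of_index (fun i => letter 𝕜 (Letter.L i _)) (n + m + k - 2) ?_ ?_ ?_ ?_
    · rcases cast (m + k) with h1 | h1 <;> rcases cast (n + m) with h2 | h2 <;>
        rcases cast (n + k) with h3 | h3 <;>
        (try obtain ⟨h1, h1'⟩ := hz _ _ h1) <;> (try obtain ⟨h2, h2'⟩ := hz _ _ h2) <;>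
        (try obtain ⟨h3, h3'⟩ := hz _ _ h3) <;> (try simp only [*]) <;>
        push_cast <;> (try simp only [*]) <;> ring
    · rcases Nat.eq_zero_or_pos (m + k) with h | h
      · left; obtain ⟨h1, h2⟩ := hz _ _ h; simp [h1, h2]
      · right; omega
    · rcases Nat.eq_zero_or_pos (n + m) with h | h
      · left; obtain ⟨h1, h2⟩ := hz _ _ h; simp [h1, h2]
      · right; omega
    · rcases Nat.eq_zero_or_pos (n + k) with h | h
      · left; obtain ⟨h1, h2⟩ := hz _ _ h; simp [h1, h2]
      · right; omega
  case v.g.g | g.v.g | g.g.v | g.g.g =>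
    refine smul_eq_sub_of_index (fun i => letter 𝕜 (Letter.L i _)) (n + m + k - 1) ?_ ?_ ?_ ?_
    · rcases cast (m + k) with h1 | h1 <;> rcases cast (n + m) with h2 | h2 <;>
        rcases cast (n + k) with h3 | h3 <;>
        (try obtain ⟨h1, h1'⟩ := hz _ _ h1) <;> (try obtain ⟨h2, h2'⟩ := hz _ _ h2) <;>
        (try obtain ⟨h3, h3'⟩ := hz _ _ h3) <;> (try simp only [*]) <;>
        push_cast <;> (try simp only [*]) <;> ring
    · rcases Nat.eq_zero_or_pos (m + k) with h | h
      · first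
        | right; omega
        | left; obtain ⟨h1, h2⟩ := hz _ _ h; simp [h1, h2]
      · right; omega
    · rcases Nat.eq_zero_or_pos (n + m) with h | h
      · first
        | right; omega
        | left; obtain ⟨h1, h2⟩ := hz _ _ h; simp [h1, h2]
      · right; omega
    · rcases Nat.eq_zero_or_pos (n + k) with h | h
      · first
        | right; omega
        | left; obtain ⟨h1, h2⟩ := hz _ _ h; simp [h1, h2]
      · right; omega

theorem jacobi_d_L_L [CharZero 𝕜] (m k : ℕ) (a b : Gen) :
    brCoef 𝕜 (.L m a) (.L k b) • br 𝕜 .d (brLetter (.L m a) (.L k b)) =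
      brCoef 𝕜 .d (.L m a) • br 𝕜 (brLetter .d (.L m a)) (.L k b) -
        sgn 𝕜 (.L m a) (.L k b) • brCoef 𝕜 .d (.L k b) • br 𝕜 (brLetter .d (.L k b)) (.L m a) := by
  have cast : ∀ i : ℕ, i = 0 ∨ ((i - 1 : ℕ) : 𝕜) = (i : 𝕜) - 1 := by
    rintro (_ | i) <;> simp
  have hz : ∀ i j : ℕ, i + j = 0 → (i : 𝕜) = 0 ∧ (j : 𝕜) = 0 := by
    intro i j h; simp; omega
  have hz0 : ∀ i : ℕ, i = 0 → (i : 𝕜) = 0 := by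
    intro i h; simp [h]
  cases a <;> cases b <;>
    simp only [br, brCoef, brLetter, sgn, Letter.odd, smul_smul, Bool.and_true, Bool.and_false,
      Bool.false_and, Bool.and_self, Bool.false_eq_true, if_true, if_false]
  case v.v | v.g | g.v =>
    refine smul_eq_sub_of_index (fun i => letter 𝕜 (Letter.L i _)) (m + k - 2) ?_ ?_ ?_ ?_
    · rcases cast m with h1 | h1 <;> rcases cast k with h2 | h2 <;>
        rcases cast (m + k) with h3 | h3 <;>
        (try replace h1 := hz0 _ h1) <;> (try replace h2 := hz0 _ h2) <;>
        (try obtain ⟨h3, h3'⟩ := hz _ _ h3) <;> (try simp only [*]) <;>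
        push_cast <;> (try simp only [*]) <;> ring
    · rcases Nat.eq_zero_or_pos (m + k) with h | h
      · left; obtain ⟨h1, h2⟩ := hz _ _ h; simp [h1, h2]
      · right; omega
    · rcases Nat.eq_zero_or_pos m with h | h
      · left; simp [h]
      · right; omega
    · rcases Nat.eq_zero_or_pos k with h | h
      · left; simp [h]
      · right; omega
  case g.g =>
    refine smul_eq_sub_of_index (fun i => letter 𝕜 (Letter.L i _)) (m + k - 1) ?_ ?_ ?_ ?_
    · rcases cast m with h1 | h1 <;> rcases cast k with h2 | h2 <;>
        rcases cast (m + k) with h3 | h3 <;>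
        (try replace h1 := hz0 _ h1) <;> (try replace h2 := hz0 _ h2) <;>
        (try obtain ⟨h3, h3'⟩ := hz _ _ h3) <;> (try simp only [*]) <;>
        push_cast <;> (try simp only [*]) <;> ring
    · rcases Nat.eq_zero_or_pos (m + k) with h | h
      · left; obtain ⟨h1, h2⟩ := hz _ _ h; simp [h1, h2]
      · right; omega
    · rcases Nat.eq_zero_or_pos m with h | h
      · left; simp [h]
      · right; omega
    · rcases Nat.eq_zero_or_pos k with h | h
      · left; simp [h]
      · right; omega

theorem jacobi_L_d_L [CharZero 𝕜] (n k : ℕ) (a b : Gen) :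
    brCoef 𝕜 .d (.L k b) • br 𝕜 (.L n a) (brLetter .d (.L k b)) =
      brCoef 𝕜 (.L n a) .d • br 𝕜 (brLetter (.L n a) .d) (.L k b) -
        sgn 𝕜 .d (.L k b) • brCoef 𝕜 (.L n a) (.L k b) • br 𝕜 (brLetter (.L n a) (.L k b)) .d := by
  have cast : ∀ i : ℕ, i = 0 ∨ ((i - 1 : ℕ) : 𝕜) = (i : 𝕜) - 1 := by
    rintro (_ | i) <;> simp
  have hz : ∀ i j : ℕ, i + j = 0 → (i : 𝕜) = 0 ∧ (j : 𝕜) = 0 := by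
    intro i j h; simp; omega
  have hz0 : ∀ i : ℕ, i = 0 → (i : 𝕜) = 0 := by
    intro i h; simp [h]
  cases a <;> cases b <;>
    simp only [br, brCoef, brLetter, sgn, Letter.odd, smul_smul, Bool.and_true, Bool.and_false,
      Bool.false_and, Bool.and_self, Bool.false_eq_true, if_true, if_false]
  case v.v | v.g | g.v =>
    refine smul_eq_sub_of_index (fun i => letter 𝕜 (Letter.L i _)) (n + k - 2) ?_ ?_ ?_ ?_
    · rcases cast n with h1 | h1 <;> rcases cast k with h2 | h2 <;>
        rcases cast (n + k) with h3 | h3 <;>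
        (try replace h1 := hz0 _ h1) <;> (try replace h2 := hz0 _ h2) <;>
        (try obtain ⟨h3, h3'⟩ := hz _ _ h3) <;> (try simp only [*]) <;>
        push_cast <;> (try simp only [*]) <;> ring
    · rcases Nat.eq_zero_or_pos k with h | h
      · left; simp [h]
      · right; omega
    · rcases Nat.eq_zero_or_pos n with h | h
      · left; simp [h]
      · right; omega
    · rcases Nat.eq_zero_or_pos (n + k) with h | h
      · left; obtain ⟨h1, h2⟩ := hz _ _ h; simp [h1, h2]
      · right; omega
  case g.g =>
    refine smul_eq_sub_of_index (fun i => letter 𝕜 (Letter.L i _)) (n + k - 1) ?_ ?_ ?_ ?_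
    · rcases cast n with h1 | h1 <;> rcases cast k with h2 | h2 <;>
        rcases cast (n + k) with h3 | h3 <;>
        (try replace h1 := hz0 _ h1) <;> (try replace h2 := hz0 _ h2) <;>
        (try obtain ⟨h3, h3'⟩ := hz _ _ h3) <;> (try simp only [*]) <;>
        push_cast <;> (try simp only [*]) <;> ring
    · rcases Nat.eq_zero_or_pos k with h | h
      · left; simp [h]
      · right; omega
    · rcases Nat.eq_zero_or_pos n with h | h
      · left; simp [h]
      · right; omega
    · rcases Nat.eq_zero_or_pos (n + k) with h | h
      · left; obtain ⟨h1, h2⟩ := hz _ _ h; simp [h1, h2]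
      · right; omega

theorem jacobi_L_L_d [CharZero 𝕜] (n m : ℕ) (a b : Gen) :
    brCoef 𝕜 (.L m b) .d • br 𝕜 (.L n a) (brLetter (.L m b) .d) =
      brCoef 𝕜 (.L n a) (.L m b) • br 𝕜 (brLetter (.L n a) (.L m b)) .d -
        sgn 𝕜 (.L m b) .d • brCoef 𝕜 (.L n a) .d • br 𝕜 (brLetter (.L n a) .d) (.L m b) := by
  have cast : ∀ i : ℕ, i = 0 ∨ ((i - 1 : ℕ) : 𝕜) = (i : 𝕜) - 1 := by
    rintro (_ | i) <;> simp
  have hz : ∀ i j : ℕ, i + j = 0 → (i : 𝕜) = 0 ∧ (j : 𝕜) = 0 := by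
    intro i j h; simp; omega
  have hz0 : ∀ i : ℕ, i = 0 → (i : 𝕜) = 0 := by
    intro i h; simp [h]
  cases a <;> cases b <;>
    simp only [br, brCoef, brLetter, sgn, Letter.odd, smul_smul, Bool.and_true, Bool.and_false,
      Bool.false_and, Bool.and_self, Bool.false_eq_true, if_true, if_false]
  case v.v | v.g | g.v =>
    refine smul_eq_sub_of_index (fun i => letter 𝕜 (Letter.L i _)) (n + m - 2) ?_ ?_ ?_ ?_
    · rcases cast n with h1 | h1 <;> rcases cast m with h2 | h2 <;>
        rcases cast (n + m) with h3 | h3 <;>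
        (try replace h1 := hz0 _ h1) <;> (try replace h2 := hz0 _ h2) <;>
        (try obtain ⟨h3, h3'⟩ := hz _ _ h3) <;> (try simp only [*]) <;>
        push_cast <;> (try simp only [*]) <;> ring
    · rcases Nat.eq_zero_or_pos m with h | h
      · left; simp [h]
      · right; omega
    · rcases Nat.eq_zero_or_pos (n + m) with h | h
      · left; obtain ⟨h1, h2⟩ := hz _ _ h; simp [h1, h2]
      · right; omega
    · rcases Nat.eq_zero_or_pos n with h | h
      · left; simp [h]
      · right; omega
  case g.g =>
    refine smul_eq_sub_of_index (fun i => letter 𝕜 (Letter.L i _)) (n + m - 1) ?_ ?_ ?_ ?_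
    · rcases cast n with h1 | h1 <;> rcases cast m with h2 | h2 <;>
        rcases cast (n + m) with h3 | h3 <;>
        (try replace h1 := hz0 _ h1) <;> (try replace h2 := hz0 _ h2) <;>
        (try obtain ⟨h3, h3'⟩ := hz _ _ h3) <;> (try simp only [*]) <;>
        push_cast <;> (try simp only [*]) <;> ring
    · rcases Nat.eq_zero_or_pos m with h | h
      · left; simp [h]
      · right; omega
    · rcases Nat.eq_zero_or_pos (n + m) with h | h
      · left; obtain ⟨h1, h2⟩ := hz _ _ h; simp [h1, h2]
      · right; omega
    · rcases Nat.eq_zero_or_pos n with h | h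
      · left; simp [h]
      · right; omega

/-- Only `x` may be a right multiplication: the second letter of an admissible pair is never an `R`,
so in an overlap `x y z` only the leftmost letter can be one. -/
theorem jacobi [CharZero 𝕜] (x y z : Letter) (hy : y.isR = false) (hz : z.isR = false) :
    brCoef 𝕜 y z • br 𝕜 x (brLetter y z) =
      brCoef 𝕜 x y • br 𝕜 (brLetter x y) z - sgn 𝕜 y z • brCoef 𝕜 x z • br 𝕜 (brLetter x z) y := by
  rcases x with _ | ⟨n, a⟩ | ⟨n, a⟩ <;> rcases y with _ | ⟨m, b⟩ | ⟨m, b⟩ <;>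
    rcases z with _ | ⟨k, c⟩ | ⟨k, c⟩ <;> simp only [Letter.isR, Bool.true_eq_false] at hy hz
  case L.L.L => exact jacobi_L n m k a b c
  case d.L.L => exact jacobi_d_L_L m k b c
  case L.d.L => exact jacobi_L_d_L n k a c
  case L.L.d => exact jacobi_L_L_d n m a b
  case R.L.L => cases b <;> cases c <;> simp [br, brCoef, brLetter]
  all_goals
    simp [br, brCoef, brLetter, sgn, Letter.odd]

end NeveuSchwartz

/-! ### Compositions of the relations of `A(X, K₁)`. -/

namespace NeveuSchwartz
open GS
variable {𝕜 : Type*} [Field 𝕜]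

theorem sgn_eq (x y : Letter) : sgn 𝕜 x y = 1 ∨ sgn 𝕜 x y = -1 := by
  unfold sgn; split_ifs <;> simp

theorem sgn_self {x : Letter} (hx : x.odd = true) : sgn 𝕜 x x = -1 := by simp [sgn, hx]

theorem Letter.isR_of_odd {x : Letter} (hx : x.odd = true) : x.isR = false := by
  rcases x with _ | _ | _ <;> simp_all [Letter.isR, Letter.odd]

/-- For odd `x` the Jacobi identity reads `[x, [x, z]] = [[x, x], z] - [x, [x, z]]`, and the two
equal terms combine. Its halved form matches the relation `x x = ½ [x, x]`. -/
theorem jacobi_left [CharZero 𝕜] (x z : Letter) (hx : x.odd = true) (hz : z.isR = false) :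
    brCoef 𝕜 x z • br 𝕜 x (brLetter x z) =
      (1 / 2 : 𝕜) • brCoef 𝕜 x x • br 𝕜 (brLetter x x) z := by
  have hxR := Letter.isR_of_odd hx
  have h1 := jacobi (𝕜 := 𝕜) x x z hxR hz
  have h2 := brCoef_smul_sgn (𝕜 := 𝕜) x z x hz hxR
  rw [br_symm (brLetter x z) x (Or.inr hxR), smul_neg, smul_neg, smul_smul (brCoef 𝕜 x z), h2,
    sgn_self hx, sgn_comm z x, smul_smul] at h1
  have h3 : sgn 𝕜 x z * (brCoef 𝕜 x z * (-1 * sgn 𝕜 x z)) = -brCoef 𝕜 x z := by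
    linear_combination (-brCoef 𝕜 x z) * sgn_mul_self (𝕜 := 𝕜) x z
  rw [h3] at h1
  linear_combination (norm := module) (1 / 2 : 𝕜) • h1

theorem jacobi_right [CharZero 𝕜] (x y : Letter) (hy : y.odd = true) :
    (1 / 2 : 𝕜) • brCoef 𝕜 y y • br 𝕜 x (brLetter y y) =
      brCoef 𝕜 x y • br 𝕜 (brLetter x y) y := by
  have h1 := jacobi (𝕜 := 𝕜) x y y (Letter.isR_of_odd hy) (Letter.isR_of_odd hy)
  rw [sgn_self hy] at h1
  linear_combination (norm := module) (1 / 2 : 𝕜) • h1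

/-- For `x = L_n^g` the coefficient is `n - ½ · 2n`. -/
theorem jacobi_self [CharZero 𝕜] (x : Letter) (hx : x.odd = true) :
    br 𝕜 x (brLetter x x) = 0 := by
  rcases x with _ | ⟨n, _ | _⟩ | _ <;> simp [Letter.odd] at hx
  simp [br, brCoef, brLetter]
  left
  ring

theorem degR_W (l : List Letter) : degR (W l) = l.countP Letter.isR := rfl

theorem length_W (l : List Letter) : (W l).length = l.length := rfl

theorem toList_W (l : List Letter) : (W l).toList = l := rfl

theorem br_mem_below {x y : Letter} (hy : y.isR = false) :
    br 𝕜 x y ∈ below 𝕜 wordLt (W [x, y]) := by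
  refine Submodule.smul_mem _ _ (word_mem_below (v := W [brLetter x y]) ?_)
  refine wordLt_of_length ?_ ?_
  · simp [degR_W, List.countP_cons, brLetter_isR x y hy, hy]
  · simp [length_W]

theorem isLead_rel [CharZero 𝕜] {x y : Letter} (h : Adm x y) :
    IsLead wordLt (rel 𝕜 x y) (W [x, y]) := by
  apply isLead_of_sub_mem wordLt_wf
  rcases h with ⟨h, hR⟩ | ⟨rfl, h⟩
  · rw [rel_of_ne h, com, letter_mul, letter_mul]
    have h1 : word 𝕜 (W [y, x]) ∈ below 𝕜 wordLt (W [x, y]) := by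
      refine word_mem_below (wordLt_of_lex ?_ rfl (.rel h))
      simp [degR_W, List.countP_cons, hR]
    have h2 := sub_mem (neg_mem (Submodule.smul_mem _ (sgn 𝕜 x y) h1)) (br_mem_below (𝕜 := 𝕜) (x := x) hR)
    convert h2 using 1
    abel
  · rw [rel_self, com, letter_mul, sgn_self h]
    convert Submodule.smul_mem _ (-(1 / 2) : 𝕜)
      (br_mem_below (𝕜 := 𝕜) (x := x) (Letter.isR_of_odd h)) using 1
    module

theorem com_self_eq_zero {x : Letter} (hx : x.odd = false) (hR : x.isR = false) :
    com 𝕜 x x = 0 := by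
  rcases x with _ | ⟨n, _ | _⟩ | _ <;> simp [Letter.odd, Letter.isR] at hx hR <;>
    simp [com, sgn, br, brCoef, Letter.odd]

theorem com_mem_of_adm [CharZero 𝕜] {x y : Letter} (h : Adm x y) (a b w : FreeMonoid Letter)
    (hw : wordLt (a * W [x, y] * b) w) :
    word 𝕜 a * com 𝕜 x y * word 𝕜 b ∈ trivialAlg wordLt (algRels 𝕜) w := by
  have key : word 𝕜 a * rel 𝕜 x y * word 𝕜 b ∈ trivialAlg wordLt (algRels 𝕜) w :=
    Submodule.subset_span ⟨_, mem_algRels_iff.2 ⟨x, y, h, rfl⟩, a, b, _, isLead_rel h, hw, rfl⟩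
  rcases h with ⟨h, -⟩ | ⟨rfl, -⟩
  · rwa [rel_of_ne h] at key
  · rw [rel_self, mul_smul_comm, smul_mul_assoc] at key
    convert Submodule.smul_mem _ (2 : 𝕜) key using 1
    module

/-- Depending on which letter is larger, the relation involved has principal word `x y` or `y x`, so
both words have to lie below `w`. -/
theorem com_mem [CharZero 𝕜] {x y : Letter} (hR : x.isR = false ∨ y.isR = false)
    (a b w : FreeMonoid Letter)
    (hw : wordLt (a * W [x, y] * b) w) (hw' : wordLt (a * W [y, x] * b) w) :
    word 𝕜 a * com 𝕜 x y * word 𝕜 b ∈ trivialAlg wordLt (algRels 𝕜) w := by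
  have hlt : ∀ {x y : Letter}, x.isR = false ∨ y.isR = false → y.Lt x → Adm x y := by
    intro x y hR h
    refine Or.inl ⟨h, hR.elim (fun hx => ?_) id⟩
    rcases y with _ | _ | ⟨m, b⟩
    · rfl
    · rfl
    · rcases x with _ | ⟨n, a⟩ | _
      · exact absurd (Letter.lt_trans h (Letter.d_lt_R _ _)) (Letter.lt_irrefl _)
      · exact absurd (Letter.lt_trans h (Letter.L_lt_R _ _ _ _)) (Letter.lt_irrefl _)
      · simp [Letter.isR] at hx
  rcases Letter.lt_trichotomy x y with h | rfl | h
  · rw [com_symm x y hR, mul_neg, neg_mul, mul_smul_comm, smul_mul_assoc]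
    exact neg_mem (Submodule.smul_mem _ _ (com_mem_of_adm (hlt hR.symm h) a b w hw'))
  · by_cases hx : x.odd = true
    · exact com_mem_of_adm (Or.inr ⟨rfl, hx⟩) a b w hw
    · rw [com_self_eq_zero (by simpa using hx) (by simpa using hR)]
      simp
  · exact com_mem_of_adm (hlt hR h) a b w hw

theorem letter_mul_com_mem [CharZero 𝕜] (a : Letter) {x y : Letter}
    (hR : x.isR = false ∨ y.isR = false) {w : FreeMonoid Letter}
    (hw : wordLt (W [a, x, y]) w) (hw' : wordLt (W [a, y, x]) w) :
    letter 𝕜 a * com 𝕜 x y ∈ trivialAlg wordLt (algRels 𝕜) w := by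
  have h := com_mem (𝕜 := 𝕜) hR (W [a]) 1 w hw hw'
  rwa [word_one, mul_one] at h

theorem com_mul_letter_mem [CharZero 𝕜] (a : Letter) {x y : Letter}
    (hR : x.isR = false ∨ y.isR = false) {w : FreeMonoid Letter}
    (hw : wordLt (W [x, y, a]) w) (hw' : wordLt (W [y, x, a]) w) :
    com 𝕜 x y * letter 𝕜 a ∈ trivialAlg wordLt (algRels 𝕜) w := by
  have h := com_mem (𝕜 := 𝕜) hR 1 (W [a]) w hw hw'
  rwa [word_one, one_mul] at h

/-- Super-commutators with the super-commutator of two letters. -/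
theorem br_mul_sub_mem [CharZero 𝕜] {x y z : Letter} (hy : y.isR = false) (hz : z.isR = false)
    {w : FreeMonoid Letter} (hw : degR (W [x]) ≤ degR w) (hl : 2 < w.length) :
    br 𝕜 x y * letter 𝕜 z - (sgn 𝕜 x z * sgn 𝕜 y z) • (letter 𝕜 z * br 𝕜 x y) -
      brCoef 𝕜 x y • br 𝕜 (brLetter x y) z ∈ trivialAlg wordLt (algRels 𝕜) w := by
  have hR := brLetter_isR x y hy
  have h1 := Submodule.smul_mem _ (brCoef 𝕜 x y) (com_mem (𝕜 := 𝕜) (x := brLetter x y) (y := z)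
    (Or.inr hz) 1 1 w
    (wordLt_of_length (by simpa [degR_mul, degR_W, List.countP_cons, hR, hz] using hw) hl)
    (wordLt_of_length (by simpa [degR_mul, degR_W, List.countP_cons, hR, hz] using hw) hl))
  have h2 := brCoef_smul_sgn (𝕜 := 𝕜) x y z hy hz
  rw [word_one, one_mul, mul_one, com, smul_sub, smul_sub, smul_smul, h2] at h1
  convert h1 using 2
  rw [br, smul_mul_assoc, mul_smul_comm, smul_smul, mul_comm (brCoef 𝕜 x y)]

theorem mul_br_sub_mem [CharZero 𝕜] {x y z : Letter} (hy : y.isR = false) (hz : z.isR = false)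
    {w : FreeMonoid Letter} (hw : degR (W [x]) ≤ degR w) (hl : 2 < w.length) :
    letter 𝕜 x * br 𝕜 y z - (sgn 𝕜 x y * sgn 𝕜 x z) • (br 𝕜 y z * letter 𝕜 x) -
      brCoef 𝕜 y z • br 𝕜 x (brLetter y z) ∈ trivialAlg wordLt (algRels 𝕜) w := by
  have hR := brLetter_isR y z hz
  rw [hy] at hR
  have h1 := Submodule.smul_mem _ (brCoef 𝕜 y z) (com_mem (𝕜 := 𝕜) (x := x) (y := brLetter y z)
    (Or.inr hR) 1 1 w
    (wordLt_of_length (by simpa [degR_mul, degR_W, List.countP_cons, hR, hz] using hw) hl)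
    (wordLt_of_length (by simpa [degR_mul, degR_W, List.countP_cons, hR, hz] using hw) hl))
  have h2 : brCoef 𝕜 y z * sgn 𝕜 x (brLetter y z) = brCoef 𝕜 y z * (sgn 𝕜 x y * sgn 𝕜 x z) := by
    rw [sgn_comm x, sgn_comm x y, sgn_comm x z]
    unfold sgn
    generalize x.odd = o
    rcases y with _ | ⟨m, _ | _⟩ | ⟨m, b⟩ <;> rcases z with _ | ⟨k, _ | _⟩ | ⟨k, c⟩ <;>
      simp [Letter.isR] at hy hz <;> cases o <;> simp [brCoef, brLetter, Letter.odd]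
  rw [word_one, one_mul, mul_one, com, smul_sub, smul_sub, smul_smul, h2] at h1
  convert h1 using 2
  rw [br, smul_mul_assoc, mul_smul_comm, smul_smul, mul_comm (brCoef 𝕜 y z)]

/-- Compositions of intersection of the relations of `A(X, K₁)`. -/
theorem overlap_mem [CharZero 𝕜] {x y z : Letter} (hxy : Adm x y) (hyz : Adm y z) :
    rel 𝕜 x y * letter 𝕜 z - letter 𝕜 x * rel 𝕜 y z ∈
      trivialAlg wordLt (algRels 𝕜) (W [x, y, z]) := by
  have hdeg : degR (W [x]) ≤ degR (W [x, y, z]) := by simp [degR_W, List.countP_cons]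
  rcases hxy with ⟨h1, hy⟩ | ⟨rfl, hx⟩ <;> rcases hyz with ⟨h2, hz⟩ | ⟨rfl, hy'⟩
  · have h3 := Letter.lt_trans h2 h1
    rw [rel_of_ne h1, rel_of_ne h2]
    -- There are two ways from `x y z` to `z y x`, through `y x z, y z x` and through `x z y, z x
    -- y`. After their first swaps, which form the composition, the first way uses `e2, e4` and the
    -- second `e1, e3`, all on words below `x y z`.
    have e1 := com_mul_letter_mem (𝕜 := 𝕜) y (x := x) (y := z) (Or.inr hz) (w := W [x, y, z])
      (wordLt_of_lex (by simp [degR_W, List.countP_cons, hy, hz]) rfl (.cons (.rel h2)))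
      (wordLt_of_lex (by simp [degR_W, List.countP_cons, hy, hz]) rfl (.rel h3))
    have e2 := letter_mul_com_mem (𝕜 := 𝕜) y (x := x) (y := z) (Or.inr hz) (w := W [x, y, z])
      (wordLt_of_lex (by simp [degR_W, List.countP_cons, hy, hz]) rfl (.rel h1))
      (wordLt_of_lex (by simp [degR_W, List.countP_cons, hy, hz]) rfl (.rel h1))
    have e3 := letter_mul_com_mem (𝕜 := 𝕜) z (x := x) (y := y) (Or.inr hy) (w := W [x, y, z])
      (wordLt_of_lex (by simp [degR_W, List.countP_cons, hy, hz]) rfl (.rel h3))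
      (wordLt_of_lex (by simp [degR_W, List.countP_cons, hy, hz]) rfl (.rel h3))
    have e4 := com_mul_letter_mem (𝕜 := 𝕜) x (x := y) (y := z) (Or.inr hz) (w := W [x, y, z])
      (wordLt_of_lex (by simp [degR_W, List.countP_cons, hy, hz]) rfl (.rel h1))
      (wordLt_of_lex (by simp [degR_W, List.countP_cons, hy, hz]) rfl (.rel h3))
    have f1 := br_mul_sub_mem (𝕜 := 𝕜) (x := x) (y := y) (z := z) hy hz hdeg (by simp [length_W])
    have f2 := br_mul_sub_mem (𝕜 := 𝕜) (x := x) (y := z) (z := y) hz hy hdeg (by simp [length_W])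
    have f3 := mul_br_sub_mem (𝕜 := 𝕜) (x := x) (y := y) (z := z) hy hz hdeg (by simp [length_W])
    -- Moving the values of the commutators past the third letter leaves three double commutators;
    -- the Jacobi identity makes them cancel.
    rw [jacobi x y z hy hz] at f3
    have key := sub_mem (add_mem (sub_mem (sub_mem (add_mem
      (Submodule.smul_mem _ (sgn 𝕜 y z) e1)
      (Submodule.smul_mem _ (sgn 𝕜 y z * sgn 𝕜 x z) e3))
      (Submodule.smul_mem _ (sgn 𝕜 x y) e2))
      (Submodule.smul_mem _ (sgn 𝕜 x y * sgn 𝕜 x z) e4))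
      (add_mem (Submodule.smul_mem _ (sgn 𝕜 y z) f2) f3)) f1
    refine (congrArg (· ∈ _) ?_).mp key
    rw [sgn_comm z y]
    simp only [com, mul_sub, sub_mul, smul_mul_assoc, mul_smul_comm, mul_assoc]
    rcases sgn_eq (𝕜 := 𝕜) x y with h12 | h12 <;> rcases sgn_eq (𝕜 := 𝕜) x z with h13 | h13 <;>
      rcases sgn_eq (𝕜 := 𝕜) y z with h23 | h23 <;> rw [h12, h13, h23] <;> module
  · have hR := Letter.isR_of_odd hy'
    rw [rel_of_ne h1, rel_self]
    have e1 := letter_mul_com_mem (𝕜 := 𝕜) y (x := x) (y := y) (Or.inr hR) (w := W [x, y, y])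
      (wordLt_of_lex (by simp [degR_W, List.countP_cons, hR]) rfl (.rel h1))
      (wordLt_of_lex (by simp [degR_W, List.countP_cons, hR]) rfl (.rel h1))
    have e2 := com_mul_letter_mem (𝕜 := 𝕜) x (x := y) (y := y) (Or.inr hR) (w := W [x, y, y])
      (wordLt_of_lex (by simp [degR_W, List.countP_cons, hR]) rfl (.rel h1))
      (wordLt_of_lex (by simp [degR_W, List.countP_cons, hR]) rfl (.rel h1))
    have f1 := br_mul_sub_mem (𝕜 := 𝕜) (x := x) (y := y) (z := y) hR hR hdeg (by simp [length_W])
    have f3 := mul_br_sub_mem (𝕜 := 𝕜) (x := x) (y := y) (z := y) hR hR hdeg (by simp [length_W])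
    have j := jacobi_right (𝕜 := 𝕜) x y hy'
    have key := sub_mem (Submodule.smul_mem _ (1 / 2 : 𝕜) (sub_mem f3 e2))
      (add_mem f1 (Submodule.smul_mem _ (sgn 𝕜 x y) e1))
    refine (congrArg (· ∈ _) ?_).mp key
    rw [sgn_self hy']
    simp only [com, mul_sub, sub_mul, smul_mul_assoc, mul_smul_comm, mul_assoc, sgn_self hy']
    rcases sgn_eq (𝕜 := 𝕜) x y with h12 | h12 <;> rw [h12] <;> linear_combination (norm := module) -j
  · have hR := Letter.isR_of_odd hx
    rw [rel_of_ne h2, rel_self]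
    have e1 := com_mul_letter_mem (𝕜 := 𝕜) x (x := x) (y := z) (Or.inr hz) (w := W [x, x, z])
      (wordLt_of_lex (by simp [degR_W, List.countP_cons, hR, hz]) rfl (.cons (.rel h2)))
      (wordLt_of_lex (by simp [degR_W, List.countP_cons, hR, hz]) rfl (.rel h2))
    have e2 := letter_mul_com_mem (𝕜 := 𝕜) z (x := x) (y := x) (Or.inr hR) (w := W [x, x, z])
      (wordLt_of_lex (by simp [degR_W, List.countP_cons, hR, hz]) rfl (.rel h2))
      (wordLt_of_lex (by simp [degR_W, List.countP_cons, hR, hz]) rfl (.rel h2))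
    have f1 := br_mul_sub_mem (𝕜 := 𝕜) (x := x) (y := x) (z := z) hR hz hdeg (by simp [length_W])
    have f3 := mul_br_sub_mem (𝕜 := 𝕜) (x := x) (y := x) (z := z) hR hz hdeg (by simp [length_W])
    have j := jacobi_left (𝕜 := 𝕜) x z hx hz
    have key := add_mem (add_mem f3 (Submodule.smul_mem _ (sgn 𝕜 x z) e1))
      (Submodule.smul_mem _ (1 / 2 : 𝕜) (sub_mem e2 f1))
    refine (congrArg (· ∈ _) ?_).mp key
    rw [sgn_self hx]
    simp only [com, mul_sub, sub_mul, smul_mul_assoc, mul_smul_comm, mul_assoc, sgn_self hx]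
    rcases sgn_eq (𝕜 := 𝕜) x z with h13 | h13 <;> rw [h13] <;> linear_combination (norm := module) -j
  · have hR := Letter.isR_of_odd hx
    rw [rel_self]
    have f3 := mul_br_sub_mem (𝕜 := 𝕜) (x := x) (y := x) (z := x) hR hR hdeg (by simp [length_W])
    rw [jacobi_self x hx, sgn_self hx] at f3
    refine (congrArg (· ∈ _) ?_).mp (Submodule.smul_mem _ (1 / 2 : 𝕜) f3)
    simp only [com, mul_sub, sub_mul, smul_mul_assoc, mul_smul_comm, mul_assoc, sgn_self hx]
    module

theorem isAlgGSB_algRels [CharZero 𝕜] : IsAlgGSB wordLt (algRels 𝕜) := by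
  have hlead : ∀ {x y : Letter} {w : FreeMonoid Letter}, Adm x y → IsLead wordLt (rel 𝕜 x y) w →
      w = W [x, y] := fun h hw => hw.unique wordLt_wf (isLead_rel h)
  refine ⟨?_, ?_, ?_⟩
  · intro s hs
    obtain ⟨x, y, h, rfl⟩ := mem_algRels_iff.1 hs
    exact ⟨_, isLead_rel h⟩
  · intro s hs s' hs' a b c hc hl hl'
    obtain ⟨x, y, h, rfl⟩ := mem_algRels_iff.1 hs
    obtain ⟨x', y', h', rfl⟩ := mem_algRels_iff.1 hs'
    have h1 : a.toList ++ c.toList = [x, y] := hlead h hl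
    have h2 : c.toList ++ b.toList = [x', y'] := hlead h' hl'
    obtain ⟨a, rfl⟩ := FreeMonoid.ofList.surjective a
    obtain ⟨b, rfl⟩ := FreeMonoid.ofList.surjective b
    obtain ⟨c, rfl⟩ := FreeMonoid.ofList.surjective c
    simp only [FreeMonoid.toList_ofList] at h1 h2
    -- Principal words have two letters, so the overlap is one letter or the whole word. In the
    -- latter case the two relations coincide, since a relation is determined by its principal word.
    rcases c with _ | ⟨c1, _ | ⟨c2, c⟩⟩
    · exact absurd rfl hc
    · obtain ⟨rfl, rfl⟩ : a = [x] ∧ c1 = y := by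
        rcases a with _ | ⟨a1, _ | ⟨a2, a⟩⟩ <;> simp_all
      obtain ⟨rfl, rfl⟩ : c1 = x' ∧ b = [y'] := by simpa using h2
      exact overlap_mem h h'
    · obtain ⟨rfl, rfl⟩ : a = [] ∧ c = [] := by
        have := congrArg List.length h1
        simp at this
        constructor <;> apply List.eq_nil_of_length_eq_zero <;> omega
      obtain rfl : b = [] := by
        have := congrArg List.length h2
        simpa using this
      obtain ⟨rfl, rfl⟩ : x = x' ∧ y = y' := by simp_all
      have : rel 𝕜 x y * word 𝕜 (FreeMonoid.ofList []) - word 𝕜 (FreeMonoid.ofList []) * rel 𝕜 x y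
          = 0 := by
        rw [FreeMonoid.ofList_nil, word_one, mul_one, one_mul, sub_self]
      rw [this]
      exact zero_mem _
  · intro s hs s' hs' a b w hl hl'
    obtain ⟨x, y, h, rfl⟩ := mem_algRels_iff.1 hs
    obtain ⟨x', y', h', rfl⟩ := mem_algRels_iff.1 hs'
    obtain rfl := hlead h' hl'
    have h1 : a.toList ++ [x', y'] ++ b.toList = [x, y] := hlead h hl
    obtain ⟨a, rfl⟩ := FreeMonoid.ofList.surjective a
    obtain ⟨b, rfl⟩ := FreeMonoid.ofList.surjective b
    simp only [FreeMonoid.toList_ofList] at h1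
    obtain ⟨rfl, rfl⟩ : a = [] ∧ b = [] := by
      have := congrArg List.length h1
      simp at this
      constructor <;> apply List.eq_nil_of_length_eq_zero <;> omega
    obtain ⟨rfl, rfl⟩ : x' = x ∧ y' = y := by simpa using h1
    simp [word_one]

end NeveuSchwartz

/-! ### Principal monomials of the module relations and normal monomials. -/

namespace NeveuSchwartz
open GS
variable {𝕜 : Type*} [Field 𝕜]

theorem l_eq (n : ℕ) (a : Gen) : l 𝕜 n a = word 𝕜 (W [.L n a]) := rfl

theorem r_eq (n : ℕ) (a : Gen) : r 𝕜 n a = word 𝕜 (W [.R n a]) := rfl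

theorem d_eq : d 𝕜 = word 𝕜 (W [.d]) := rfl

theorem d_pow_eq (s : ℕ) : d 𝕜 ^ s = word 𝕜 (W (List.replicate s .d)) := by
  induction s with
  | zero => exact (word_one (𝕜 := 𝕜)).symm
  | succ s ih => rw [pow_succ', ih, d_eq, ← word_mul]; rfl

theorem word_W_mul (l₁ l₂ : List Letter) :
    word 𝕜 (W l₁) * word 𝕜 (W l₂) = word 𝕜 (W (l₁ ++ l₂)) := (word_mul _ _).symm

theorem word_smul_e (w : FreeMonoid Letter) (a : Gen) : word 𝕜 w • e 𝕜 a = mon 𝕜 (w, a) := rfl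

theorem e_eq (a : Gen) : e 𝕜 a = mon 𝕜 (W [], a) := by
  have h : (1 : FreeAlg 𝕜 Letter) • e 𝕜 a = e 𝕜 a := one_smul _ _
  rw [← h, ← word_one]
  rfl

theorem word_smul_mon_W (l₁ l₂ : List Letter) (a : Gen) :
    word 𝕜 (W l₁) • mon 𝕜 (W l₂, a) = mon 𝕜 (W (l₁ ++ l₂), a) := word_smul_mon _ _

theorem modLt_wf' : WellFounded (modLt wordLt Gen.Lt) := modLt_wf wordLt_wf Gen.lt_wf

theorem isModLead_mon_sub {p : FreeMonoid Letter × Gen} {q : FreeMod 𝕜 Letter Gen}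
    (hq : q ∈ modBelow 𝕜 wordLt Gen.Lt p) : IsModLead wordLt Gen.Lt (mon 𝕜 p - q) p := by
  apply isModLead_of_sub_mem modLt_wf'
  rw [sub_sub_cancel_left]
  exact neg_mem hq

theorem mon_mem_modBelow_of_degR {l l' : List Letter} {a b : Gen}
    (h : l.countP Letter.isR < l'.countP Letter.isR) :
    mon 𝕜 (W l, a) ∈ modBelow 𝕜 wordLt Gen.Lt (W l', b) :=
  mon_mem_modBelow (Or.inl (Or.inl h))

theorem mon_mem_modBelow_of_length {l l' : List Letter} {a b : Gen}
    (h : l.countP Letter.isR ≤ l'.countP Letter.isR) (h' : l.length < l'.length) :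
    mon 𝕜 (W l, a) ∈ modBelow 𝕜 wordLt Gen.Lt (W l', b) :=
  mon_mem_modBelow (Or.inl (wordLt_of_length h h'))

theorem mon_mem_modBelow_of_head {z z' : Letter} {l l' : List Letter} {a b : Gen} (hz : z.Lt z')
    (h : (z :: l).countP Letter.isR = (z' :: l').countP Letter.isR)
    (h' : (z :: l).length = (z' :: l').length) :
    mon 𝕜 (W (z :: l), a) ∈ modBelow 𝕜 wordLt Gen.Lt (W (z' :: l'), b) :=
  mon_mem_modBelow (Or.inl (wordLt_of_lex h h' (.rel hz)))

/-- The principal monomials of the defining relations. -/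
theorem DefRel.exists_isModLead {p q : FreeMod 𝕜 Letter Gen} (h : DefRel 𝕜 p q) :
    ∃ w : FreeMonoid Letter × Gen, p = mon 𝕜 w ∧ IsModLead wordLt Gen.Lt (p - q) w := by
  have key : ∀ {w : FreeMonoid Letter × Gen} {p q : FreeMod 𝕜 Letter Gen}, p = mon 𝕜 w →
      q ∈ modBelow 𝕜 wordLt Gen.Lt w →
      ∃ w : FreeMonoid Letter × Gen, p = mon 𝕜 w ∧ IsModLead wordLt Gen.Lt (p - q) w := by
    rintro w p q rfl hq
    exact ⟨w, rfl, isModLead_mon_sub hq⟩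
  have hd : Letter.isR .d = false := rfl
  have hL : ∀ n a, Letter.isR (.L n a) = false := fun _ _ => rfl
  have hR : ∀ n a, Letter.isR (.R n a) = true := fun _ _ => rfl
  cases h <;> refine key (by simp only [l_eq, r_eq, word_smul_e]; rfl) ?_ <;>
    try simp only [l_eq, r_eq, d_eq, word_W_mul, word_smul_e, e_eq, List.cons_append, List.nil_append,
      word_smul_mon_W]
  all_goals
    repeat' first
      | with_reducible apply add_mem | with_reducible apply sub_mem
      | with_reducible apply neg_mem | with_reducible exact zero_mem _
      | with_reducible apply Submodule.smul_mem
      | (apply mon_mem_modBelow_of_degR; simp [List.countP_cons, hd, hL, hR])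

/-- The additional relations are monic. -/
theorem ExtraRel.exists_isModLead {p q : FreeMod 𝕜 Letter Gen} (h : ExtraRel 𝕜 p q) :
    ∃ w : FreeMonoid Letter × Gen, p = mon 𝕜 w ∧ IsModLead wordLt Gen.Lt (p - q) w := by
  have key : ∀ {w : FreeMonoid Letter × Gen} {p q : FreeMod 𝕜 Letter Gen}, p = mon 𝕜 w →
      q ∈ modBelow 𝕜 wordLt Gen.Lt w →
      ∃ w : FreeMonoid Letter × Gen, p = mon 𝕜 w ∧ IsModLead wordLt Gen.Lt (p - q) w := by
    rintro w p q rfl hq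
    exact ⟨w, rfl, isModLead_mon_sub hq⟩
  have hd : Letter.isR .d = false := rfl
  have hL : ∀ n a, Letter.isR (.L n a) = false := fun _ _ => rfl
  cases h <;> refine key (by simp only [l_eq, d_pow_eq, word_W_mul, word_smul_e]; rfl) ?_ <;>
    simp only [l_eq, d_pow_eq, word_W_mul, word_smul_e, e_eq, List.cons_append,
      List.nil_append, word_smul_mon_W, List.append_nil]
  all_goals
    repeat' first
      | with_reducible apply add_mem | with_reducible apply sub_mem
      | with_reducible apply neg_mem | with_reducible exact zero_mem _
      | with_reducible apply Submodule.smul_mem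
      | (apply mon_mem_modBelow_of_length <;>
          simp [List.countP_cons, List.countP_replicate, hd, hL]; done)
      | (apply mon_mem_modBelow_of_length <;>
          simp [List.countP_cons, List.countP_replicate, hd, hL] <;> omega)
      | (apply mon_mem_modBelow_of_head <;>
          simp [List.countP_cons, List.countP_replicate, hd, hL, Letter.L_lt_L, Gen.idx]; done)

/-- Indices of the normal monomials. -/
inductive NormalIdx : Type
  | main (a : ℕ) (o : Bool) (s : ℕ) (y : Gen)
  | extra (a : ℕ) (x : Gen)

/-- The normal monomials `(L_0^v)^a (L_0^g)^o ∂^s y`, `o ≤ 1`, and `(L_0^v)^a L_1^x g`. -/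
def normalMon : NormalIdx → FreeMonoid Letter × Gen
  | .main a o s y =>
    (W (List.replicate a (.L 0 .v) ++ ((if o then [.L 0 .g] else []) ++ List.replicate s .d)), y)
  | .extra a x => (W (List.replicate a (.L 0 .v) ++ [.L 1 x]), .g)

/-- Reducibility with respect to the relations of the module. -/
abbrev Red (𝕜 : Type*) [Field 𝕜] (l : List Letter) (y : Gen) : Prop :=
  Reducible wordLt Gen.Lt (algRels 𝕜) (defRels 𝕜 ∪ extraRels 𝕜) (W l, y)

theorem red_of_adm [CharZero 𝕜] {x z : Letter} (h : Adm x z) (l : List Letter) (y : Gen) :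
    Red 𝕜 (x :: z :: l) y :=
  ⟨_, .alg (mem_algRels_iff.2 ⟨x, z, h, rfl⟩) (isLead_rel h) 1 (W l) y⟩

theorem red_of_defRel {l : List Letter} {y : Gen} {p q : FreeMod 𝕜 Letter Gen}
    (h : DefRel 𝕜 p q) (hp : p = mon 𝕜 (W l, y)) : Red 𝕜 l y := by
  obtain ⟨w, hw, hl⟩ := h.exists_isModLead
  -- The monomial `mon` determines its word and generator, so the principal monomial is the expected
  -- one.
  have : w = (W l, y) := by
    by_contra hne
    have h1 := coeff_mon_of_ne (𝕜 := 𝕜) hne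
    rw [← hw, hp, coeff_mon_self] at h1
    exact one_ne_zero h1
  subst this
  exact ⟨_, .mod (Or.inl ⟨p, q, h, rfl⟩) hl 1⟩

theorem red_of_extraRel {l : List Letter} {y : Gen} {p q : FreeMod 𝕜 Letter Gen}
    (h : ExtraRel 𝕜 p q) (hp : p = mon 𝕜 (W l, y)) : Red 𝕜 l y := by
  obtain ⟨w, hw, hl⟩ := h.exists_isModLead
  have : w = (W l, y) := by
    by_contra hne
    have h1 := coeff_mon_of_ne (𝕜 := 𝕜) hne
    rw [← hw, hp, coeff_mon_self] at h1
    exact one_ne_zero h1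
  subst this
  exact ⟨_, .mod (Or.inr ⟨p, q, h, rfl⟩) hl 1⟩

/-- No right multiplication survives in a normal form: beyond the locality bound it gives zero,
below it the relations rewrite it by left ones. Where two relations share a principal monomial,
either suffices. -/
theorem red_R (n : ℕ) (x y : Gen) : Red 𝕜 [.R n x] y := by
  by_cases h : N y x ≤ n
  · exact red_of_defRel (.r_loc n x y h) rfl
  · obtain ⟨rfl, rfl, rfl⟩ | hn : (x = .v ∧ y = .v ∧ n = 2) ∨ n ≤ 1 := by
      cases x <;> cases y <;> simp [N] at h ⊢ <;> omega
    · exact red_of_defRel .r2_vv rfl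
    · obtain rfl | rfl : n = 0 ∨ n = 1 := by omega
      all_goals cases x <;> cases y
      · exact red_of_defRel .r0_vv rfl
      · exact red_of_defRel .comm0_vg rfl
      · exact red_of_defRel .comm0_gv rfl
      · exact red_of_defRel .comm0_gg rfl
      · exact red_of_defRel .r1_vv rfl
      · exact red_of_defRel .comm1_vg rfl
      · exact red_of_defRel .comm1_gv rfl
      · exact red_of_defRel .comm1_gg rfl

theorem red_L (n : ℕ) (hn : 2 ≤ n) (x y : Gen) : Red 𝕜 [.L n x] y := by
  by_cases h : N x y ≤ n
  · exact red_of_defRel (.l_loc n x y h) rfl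
  · obtain ⟨rfl, rfl, rfl⟩ : x = .v ∧ y = .v ∧ n = 2 := by
      cases x <;> cases y <;> simp [N] at h ⊢ <;> omega
    exact red_of_extraRel .l2v_v rfl

theorem red_L1_d (s : ℕ) (x y : Gen) : Red 𝕜 (.L 1 x :: .d :: List.replicate s .d) y := by
  have h : ∀ x : Gen, (l 𝕜 1 x * d 𝕜 ^ (s + 1)) • e 𝕜 y =
      mon 𝕜 (W (.L 1 x :: .d :: List.replicate s .d), y) := by
    intro x
    rw [d_pow_eq, l_eq, word_W_mul]
    rfl
  cases x <;> cases y
  · exact red_of_extraRel (.l1v_ds_v (s + 1) (by omega)) (h _)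
  · exact red_of_extraRel (.l1v_ds_g (s + 1) (by omega)) (h _)
  · exact red_of_extraRel (.l1g_ds_v (s + 1) (by omega)) (h _)
  · exact red_of_extraRel (.l1g_ds_g (s + 1) (by omega)) (h _)

theorem mon_two (x z : Letter) (y : Gen) :
    (letter 𝕜 x * letter 𝕜 z) • e 𝕜 y = mon 𝕜 (W [x, z], y) := by
  rw [letter_mul]; rfl

theorem adm_of_lt {x z : Letter} (h : z.Lt x) (hz : z.isR = false) : Adm x z := Or.inl ⟨h, hz⟩

/-- Multiplying a normal monomial by a letter gives a normal or a reducible monomial. -/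
theorem normal_or_red_cons [CharZero 𝕜] (z : Letter) (i : NormalIdx) :
    (∃ j, normalMon j = (W (z :: (normalMon i).1.toList), (normalMon i).2)) ∨
      Red 𝕜 (z :: (normalMon i).1.toList) (normalMon i).2 := by
  have hd : Letter.isR .d = false := rfl
  have hL : ∀ n a, Letter.isR (.L n a) = false := fun _ _ => rfl
  have lLL : ∀ {n m a b}, (n < m ∨ (n = m ∧ a.idx < b.idx)) → Adm (.L m b) (.L n a) :=
    fun h => adm_of_lt (Letter.L_lt_L.2 h) rfl
  have hR1 : ∀ n x m a, Adm (.R n x) (.L m a) := fun n x m a => adm_of_lt (Letter.L_lt_R _ _ _ _) rfl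
  have hR2 : ∀ n x, Adm (.R n x) .d := fun n x => adm_of_lt (Letter.d_lt_R _ _) rfl
  have hdL : ∀ m a, m ≤ 1 → Adm .d (.L m a) := fun m a h => adm_of_lt (Letter.L_lt_d.2 h) rfl
  have hLd : ∀ m a, 2 ≤ m → Adm (.L m a) .d := fun m a h => adm_of_lt (Letter.d_lt_L.2 h) rfl
  cases i with
  | main a o s y =>
    rcases a with _ | a
    · rcases o with _ | _
      · rcases s with _ | s
        · rcases z with _ | ⟨n, x⟩ | ⟨n, x⟩
          · exact Or.inl ⟨.main 0 false 1 y, rfl⟩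
          · rcases n with _ | _ | n
            · cases x
              · exact Or.inl ⟨.main 1 false 0 y, rfl⟩
              · exact Or.inl ⟨.main 0 true 0 y, rfl⟩
            -- Here the second family of normal monomials arises: `L_1^x v` is the principal
            -- monomial of an additional relation, while `L_1^x g` is not reducible.
            · cases y
              · right
                cases x
                · exact red_of_extraRel .l1v_v rfl
                · exact red_of_extraRel .l1g_v rfl
              · exact Or.inl ⟨.extra 0 x, rfl⟩
            · exact Or.inr (red_L (n + 2) (by omega) x y)
          · exact Or.inr (red_R n x y)
        · rcases z with _ | ⟨n, x⟩ | ⟨n, x⟩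
          · exact Or.inl ⟨.main 0 false (s + 2) y, rfl⟩
          · rcases n with _ | _ | n
            · cases x
              · exact Or.inl ⟨.main 1 false (s + 1) y, rfl⟩
              · exact Or.inl ⟨.main 0 true (s + 1) y, rfl⟩
            · exact Or.inr (red_L1_d s x y)
            · exact Or.inr (red_of_adm (hLd _ _ (by omega)) _ _)
          · exact Or.inr (red_of_adm (hR2 _ _) _ _)
      · rcases z with _ | ⟨n, x⟩ | ⟨n, x⟩
        · exact Or.inr (red_of_adm (hdL _ _ (by omega)) _ _)
        · rcases n with _ | n
          · cases x
            · exact Or.inl ⟨.main 1 true s y, rfl⟩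
            · exact Or.inr (red_of_adm (Or.inr ⟨rfl, rfl⟩) _ _)
          · exact Or.inr (red_of_adm (lLL (by simp)) _ _)
        · exact Or.inr (red_of_adm (hR1 _ _ _ _) _ _)
    · rcases z with _ | ⟨n, x⟩ | ⟨n, x⟩
      · exact Or.inr (red_of_adm (hdL _ _ (by omega)) _ _)
      · rcases n with _ | n
        · cases x
          · exact Or.inl ⟨.main (a + 2) o s y, rfl⟩
          · exact Or.inr (red_of_adm (lLL (by simp [Gen.idx])) _ _)
        · exact Or.inr (red_of_adm (lLL (by simp)) _ _)
      · exact Or.inr (red_of_adm (hR1 _ _ _ _) _ _)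
  | extra a c =>
    rcases a with _ | a
    · rcases z with _ | ⟨n, x⟩ | ⟨n, x⟩
      · exact Or.inr (red_of_adm (hdL _ _ (by omega)) _ _)
      · rcases n with _ | _ | n
        · cases x
          · exact Or.inl ⟨.extra 1 c, rfl⟩
          · right
            cases c
            · exact red_of_extraRel .l0g_l1v_g (mon_two _ _ _)
            · exact red_of_extraRel .l0g_l1g_g (mon_two _ _ _)
        · right
          cases x
          · cases c
            · exact red_of_extraRel .l1v_l1v_g (mon_two _ _ _)
            · exact red_of_extraRel .l1v_l1g_g (mon_two _ _ _)
          · cases c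
            · exact red_of_adm (lLL (by simp [Gen.idx])) _ _
            · exact red_of_adm (Or.inr ⟨rfl, rfl⟩) _ _
        · exact Or.inr (red_of_adm (lLL (by simp)) _ _)
      · exact Or.inr (red_of_adm (hR1 _ _ _ _) _ _)
    · rcases z with _ | ⟨n, x⟩ | ⟨n, x⟩
      · exact Or.inr (red_of_adm (hdL _ _ (by omega)) _ _)
      · rcases n with _ | n
        · cases x
          · exact Or.inl ⟨.extra (a + 2) c, rfl⟩
          · exact Or.inr (red_of_adm (lLL (by simp [Gen.idx])) _ _)
        · exact Or.inr (red_of_adm (lLL (by simp)) _ _)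
      · exact Or.inr (red_of_adm (hR1 _ _ _ _) _ _)

/-- Induction on the length of the word: its tail is either reducible, and stays so after prepending
a letter, or normal. -/
theorem normal_or_red [CharZero 𝕜] (p : FreeMonoid Letter × Gen) : p ∈ Set.range normalMon ∨
    Reducible wordLt Gen.Lt (algRels 𝕜) (defRels 𝕜 ∪ extraRels 𝕜) p := by
  obtain ⟨w, y⟩ := p
  obtain ⟨l, rfl⟩ := FreeMonoid.ofList.surjective w
  induction l with
  | nil => exact Or.inl ⟨.main 0 false 0 y, rfl⟩
  | cons z l ih =>
    rcases ih with ⟨i, hi⟩ | h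
    · have h1 := normal_or_red_cons (𝕜 := 𝕜) z i
      rw [hi] at h1
      exact h1
    · exact Or.inr (h.mul_left (W [z]))

end NeveuSchwartz

/-! ### Identities in associative conformal superalgebras. -/

namespace ConformalSuperalgebra

variable {𝕜 C : Type*} [Field 𝕜] [AddCommGroup C] [Module 𝕜 C] (S : ConformalSuperalgebra 𝕜 C)

open Polynomial in
/-- The linear map `𝕜[X] → C` that sends `X ^ p` to `Q p`. -/
noncomputable def umbral (Q : ℕ → C) : 𝕜[X] →ₗ[𝕜] C :=
  Polynomial.lsum fun i => LinearMap.toSpanSingleton 𝕜 C (Q i)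

open Polynomial in
theorem umbral_X_pow (Q : ℕ → C) (p : ℕ) : umbral Q (X ^ p : 𝕜[X]) = Q p := by
  rw [umbral, Polynomial.lsum_apply, ← Polynomial.monomial_one_right_eq_X_pow,
    Polynomial.sum_monomial_index]
  · simp
  · simp

-- With `Q s` standing for `(x (s) y) (n + m - s) z`, associativity says that `x (n) (y (m) z)` is
-- the image of `(1 + X) ^ n`. Binomial identities thereby become identities between polynomials.
open Polynomial in
theorem umbral_X_pow_mul (Q : ℕ → C) (s k : ℕ) : umbral Q (X ^ s * (1 + X) ^ k : 𝕜[X]) =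
    ∑ j ∈ Finset.range (k + 1), (k.choose j : 𝕜) • Q (s + j) := by
  rw [add_comm, add_pow, Finset.mul_sum, map_sum]
  refine Finset.sum_congr rfl fun j _ => ?_
  have : (X ^ s * (X ^ j * 1 ^ (k - j) * (k.choose j : 𝕜[X])) : 𝕜[X]) =
      (k.choose j : 𝕜) • X ^ (s + j) := by
    rw [Polynomial.smul_eq_C_mul, pow_add, one_pow]
    simp only [map_natCast]
    ring
  rw [this, map_smul, umbral_X_pow]

/-- Associativity, solved for the iterated product on the left. -/
theorem prod_prod_left (hS : S.IsAssociative) (m n : ℕ) (x y z : C) :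
    S.prod n (S.prod m x y) z = ∑ j ∈ Finset.range (m + 1),
      ((-1 : 𝕜) ^ j * m.choose j) • S.prod (m - j) x (S.prod (n + j) y z) := by
  let Q : ℕ → C := fun s => S.prod (m + n - s) (S.prod s x y) z
  have h1 : ∀ j ∈ Finset.range (m + 1), S.prod (m - j) x (S.prod (n + j) y z) =
      umbral Q ((1 + Polynomial.X) ^ (m - j) : Polynomial 𝕜) := by
    intro j hj
    have h := umbral_X_pow_mul (𝕜 := 𝕜) Q 0 (m - j)
    rw [pow_zero, one_mul] at h
    rw [h, hS]
    refine Finset.sum_congr rfl fun s hs => ?_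
    have : m - j + (n + j) - s = m + n - (0 + s) := by
      have := Finset.mem_range.1 hj; omega
    simp only [Q, this]
    rw [zero_add]
  rw [Finset.sum_congr rfl fun j hj => by rw [h1 j hj, ← map_smul], ← map_sum]
  -- The expansion is inverted by writing `X = -1 + (1 + X)`.
  have h2 : ∑ j ∈ Finset.range (m + 1), ((-1 : 𝕜) ^ j * m.choose j) •
      ((1 + Polynomial.X) ^ (m - j) : Polynomial 𝕜) = Polynomial.X ^ m := by
    have h := add_pow (-1 : Polynomial 𝕜) (1 + Polynomial.X) m
    rw [neg_add_cancel_left] at h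
    rw [h]
    refine Finset.sum_congr rfl fun j _ => ?_
    rw [Polynomial.smul_eq_C_mul]
    simp only [map_mul, map_pow, map_neg, map_one, map_natCast]
    ring
  rw [h2, umbral_X_pow]
  simp [Q]

theorem prod_der_pow_left (j k : ℕ) (c f : C) : S.prod k ((S.der ^ j) c) f =
    ((-1 : 𝕜) ^ j * k.descFactorial j) • S.prod (k - j) c f := by
  induction j generalizing k with
  | zero => simp
  | succ j ih =>
    rw [pow_succ', Module.End.mul_apply, S.der_prod, ih, smul_smul, ← neg_smul, Nat.sub_sub,
      add_comm 1 j]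
    congr 1
    rcases k with _ | k
    · simp
    · rw [Nat.succ_descFactorial_succ]
      push_cast
      ring_nf

/-- The bound `M` need not be optimal, so that several of these sums can be cut off at a common
place. -/
theorem curly_eq_sum {n M : ℕ} {y x : C} (hM : ∀ s, M ≤ s → S.prod (n + s) y x = 0) :
    S.curly n y x = ∑ s ∈ Finset.range M,
      ((-1 : 𝕜) ^ (n + s) * (s.factorial : 𝕜)⁻¹) • (S.der ^ s) (S.prod (n + s) y x) := by
  refine finsum_eq_sum_of_support_subset _ ?_
  intro s hs
  rw [Finset.coe_range, Set.mem_Iio]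
  by_contra h
  refine hs ?_
  simp only
  rw [hM s (not_lt.1 h), map_zero, smul_zero]

theorem exists_bound (y x : C) : ∃ M, ∀ n s, M ≤ s → S.prod (n + s) y x = 0 := by
  obtain ⟨M, hM⟩ := S.locality y x
  exact ⟨M, fun n s hs => hM _ (by omega)⟩

/-- `f ↦ {f (n) x}` as a linear map. -/
noncomputable def curlyRight (n : ℕ) (x : C) : C →ₗ[𝕜] C where
  toFun f := S.curly n f x
  map_add' f g := by
    obtain ⟨M, hM⟩ := S.exists_bound f x
    obtain ⟨M', hM'⟩ := S.exists_bound g x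
    rw [S.curly_eq_sum (n := n) (M := M + M') (y := f) (fun s hs => hM n s (by omega)),
      S.curly_eq_sum (n := n) (M := M + M') (y := g) (fun s hs => hM' n s (by omega)),
      S.curly_eq_sum (n := n) (M := M + M') (y := f + g) (fun s hs => by
        rw [map_add, LinearMap.add_apply, hM n s (by omega), hM' n s (by omega), add_zero]),
      ← Finset.sum_add_distrib]
    refine Finset.sum_congr rfl fun s _ => ?_
    rw [map_add, LinearMap.add_apply, map_add, smul_add]
  map_smul' c f := by
    obtain ⟨M, hM⟩ := S.exists_bound f x
    rw [S.curly_eq_sum (n := n) (M := M) (y := f) (fun s hs => hM n s (by omega)),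
      S.curly_eq_sum (n := n) (M := M) (y := c • f) (fun s hs => by
        rw [map_smul, LinearMap.smul_apply, hM n s (by omega), smul_zero]),
      RingHom.id_apply, Finset.smul_sum]
    refine Finset.sum_congr rfl fun s _ => ?_
    rw [map_smul, LinearMap.smul_apply, map_smul, smul_comm]

theorem curlyRight_apply (n : ℕ) (x f : C) : S.curlyRight n x f = S.curly n f x := rfl

/-- `f ↦ {y (n) f}` as a linear map. -/
noncomputable def curlyLeft (n : ℕ) (y : C) : C →ₗ[𝕜] C where
  toFun f := S.curly n y f
  map_add' f g := by
    obtain ⟨M, hM⟩ := S.exists_bound y f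
    obtain ⟨M', hM'⟩ := S.exists_bound y g
    rw [S.curly_eq_sum (n := n) (M := M + M') (x := f) (fun s hs => hM n s (by omega)),
      S.curly_eq_sum (n := n) (M := M + M') (x := g) (fun s hs => hM' n s (by omega)),
      S.curly_eq_sum (n := n) (M := M + M') (x := f + g) (fun s hs => by
        rw [map_add, hM n s (by omega), hM' n s (by omega), add_zero]),
      ← Finset.sum_add_distrib]
    refine Finset.sum_congr rfl fun s _ => ?_
    rw [map_add, map_add, smul_add]
  map_smul' c f := by
    obtain ⟨M, hM⟩ := S.exists_bound y f
    rw [S.curly_eq_sum (n := n) (M := M) (x := f) (fun s hs => hM n s (by omega)),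
      S.curly_eq_sum (n := n) (M := M) (x := c • f) (fun s hs => by
        rw [map_smul, hM n s (by omega), smul_zero]),
      RingHom.id_apply, Finset.smul_sum]
    refine Finset.sum_congr rfl fun s _ => ?_
    rw [map_smul, map_smul, smul_comm]

theorem curlyLeft_apply (n : ℕ) (y f : C) : S.curlyLeft n y f = S.curly n y f := rfl

theorem prod_der_pow (m s : ℕ) (y h : C) : S.prod m y ((S.der ^ s) h) =
    ∑ ij ∈ Finset.HasAntidiagonal.antidiagonal s, s.choose ij.1 •
      ((m.descFactorial ij.1 : 𝕜) • (S.der ^ ij.2) (S.prod (m - ij.1) y h)) := by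
  induction s generalizing h with
  | zero => simp
  | succ s ih =>
    rw [pow_succ, Module.End.mul_apply, ih, Finset.sum_antidiagonal_choose_succ_nsmul
      (fun i j => (m.descFactorial i : 𝕜) • (S.der ^ j) (S.prod (m - i) y h)),
      ← Finset.sum_add_distrib]
    refine Finset.sum_congr rfl fun ij hij => ?_
    obtain ⟨i, j⟩ := ij
    rw [← Finset.HasAntidiagonal.mem_antidiagonal.1 hij]
    simp only
    rw [← Nat.choose_symm_add (a := i) (b := j), ← smul_add]
    congr 1
    rw [S.prod_der, map_add, smul_add, pow_succ S.der j, Module.End.mul_apply, map_smul, smul_smul,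
      Nat.descFactorial_succ, Nat.sub_sub]
    congr 2
    push_cast
    ring

variable [CharZero 𝕜]

theorem curly_der_left (n : ℕ) (f x : C) : S.curly n (S.der f) x =
    S.der (S.curly n f x) + (n : 𝕜) • S.curly (n - 1) f x := by
  obtain ⟨M, hM⟩ := S.exists_bound f x
  have h1 : S.curly n (S.der f) x = _ := S.curly_eq_sum (M := M + 1) (fun s hs => by
    rw [S.der_prod, Nat.add_sub_assoc (by omega), hM n (s - 1) (by omega), smul_zero, neg_zero])
  have h2 : S.curly n f x = _ := S.curly_eq_sum (M := M) (fun s hs => hM n s hs)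
  have h3 : S.curly (n - 1) f x = _ :=
    S.curly_eq_sum (M := M + 1) (fun s hs => hM (n - 1) s (by omega))
  have key : ∀ s, ((-1 : 𝕜) ^ (n + s) * (s.factorial : 𝕜)⁻¹) •
      (S.der ^ s) (S.prod (n + s) (S.der f) x) =
      ((s : 𝕜) * (-((-1 : 𝕜) ^ (n + s) * (s.factorial : 𝕜)⁻¹))) •
        (S.der ^ s) (S.prod (n + s - 1) f x) +
      (n : 𝕜) • (((-1 : 𝕜) ^ (n - 1 + s) * (s.factorial : 𝕜)⁻¹) •
        (S.der ^ s) (S.prod (n - 1 + s) f x)) := by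
    intro s
    rw [S.der_prod, map_neg, map_smul]
    rcases n with _ | n
    · simp only [Nat.cast_zero, zero_smul, add_zero]
      push_cast
      module
    · have : n + 1 + s - 1 = n + s := by omega
      rw [this, Nat.add_sub_cancel]
      push_cast
      rw [add_right_comm n 1 s, pow_succ]
      module
  rw [h1, Finset.sum_congr rfl fun s _ => key s, Finset.sum_add_distrib, h3, Finset.smul_sum]
  congr 1
  -- The term `s = 0` carries the factor `0`. In the others `s / s! = 1 / (s - 1)!`, and the shift
  -- of index yields `∂` applied to the original sum.
  rw [Finset.sum_range_succ', h2, map_sum]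
  simp only [Nat.cast_zero, zero_mul, zero_smul, add_zero]
  refine Finset.sum_congr rfl fun s _ => ?_
  rw [map_smul, ← add_assoc, Nat.add_sub_cancel, pow_succ' S.der, Module.End.mul_apply]
  congr 1
  have : (s.factorial : 𝕜) ≠ 0 := by exact_mod_cast s.factorial_ne_zero
  have : ((s : 𝕜) + 1) ≠ 0 := by exact_mod_cast s.succ_ne_zero
  rw [Nat.factorial_succ]
  push_cast
  field_simp
  ring

theorem curly_der_right (n : ℕ) (y x : C) : S.curly n y (S.der x) =
    -((n : 𝕜) • S.curly (n - 1) y x) := by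
  obtain ⟨M, hM⟩ := S.exists_bound y x
  have h1 : S.curly n y (S.der x) = _ := S.curly_eq_sum (M := M + 1) (fun s hs => by
    rw [S.prod_der, Nat.add_sub_assoc (by omega), hM n (s - 1) (by omega), hM n s (by omega),
      smul_zero, map_zero, add_zero])
  have h3 : S.curly (n - 1) y x = _ :=
    S.curly_eq_sum (M := M + 1) (fun s hs => hM (n - 1) s (by omega))
  have key : ∀ s, ((-1 : 𝕜) ^ (n + s) * (s.factorial : 𝕜)⁻¹) •
      (S.der ^ s) (S.prod (n + s) y (S.der x)) =
      (((-1 : 𝕜) ^ (n + s) * (s.factorial : 𝕜)⁻¹) • (S.der ^ (s + 1)) (S.prod (n + s) y x) +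
      ((s : 𝕜) * ((-1 : 𝕜) ^ (n + s) * (s.factorial : 𝕜)⁻¹)) •
        (S.der ^ s) (S.prod (n + s - 1) y x)) -
      (n : 𝕜) • (((-1 : 𝕜) ^ (n - 1 + s) * (s.factorial : 𝕜)⁻¹) •
        (S.der ^ s) (S.prod (n - 1 + s) y x)) := by
    intro s
    rw [S.prod_der, map_add, map_smul, pow_succ S.der, Module.End.mul_apply]
    rcases n with _ | n
    · simp only [Nat.cast_zero, zero_smul, sub_zero]
      push_cast
      module
    · have : n + 1 + s - 1 = n + s := by omega
      rw [this, Nat.add_sub_cancel]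
      push_cast
      rw [add_right_comm n 1 s, pow_succ]
      module
  rw [h1, Finset.sum_congr rfl fun s _ => key s, Finset.sum_sub_distrib, h3, Finset.smul_sum,
    sub_eq_neg_self, Finset.sum_add_distrib, Finset.sum_range_succ, hM n M le_rfl,
    Finset.sum_range_succ' _ M]
  simp only [map_zero, smul_zero, add_zero, Nat.cast_zero, zero_mul, zero_smul]
  -- After the shift of index the two sums cancel term by term.
  rw [← Finset.sum_add_distrib]
  refine Finset.sum_eq_zero fun s _ => ?_
  rw [← add_assoc, Nat.add_sub_cancel, ← add_smul]
  convert zero_smul 𝕜 _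
  have : (s.factorial : 𝕜) ≠ 0 := by exact_mod_cast s.factorial_ne_zero
  have : ((s : 𝕜) + 1) ≠ 0 := by exact_mod_cast s.succ_ne_zero
  rw [Nat.factorial_succ]
  push_cast
  field_simp
  ring

/-- A power `∂^j` in the left factor lowers `k` by `j` and contributes `(-1)^j k (k - 1) ⋯ (k - j +
1)`. Divided by `j!` this is a signed binomial coefficient, so the sum stops at `k` whatever the
locality bound. -/
theorem prod_curly_left {s k : ℕ} {b a f : C} {M : ℕ}
    (hM : ∀ j, M ≤ j → S.prod (s + j) b a = 0) : S.prod k (S.curly s b a) f =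
    ∑ j ∈ Finset.range (k + 1),
      ((-1 : 𝕜) ^ s * k.choose j) • S.prod (k - j) (S.prod (s + j) b a) f := by
  have h0 : S.curly s b a = _ := S.curly_eq_sum (M := M + (k + 1)) fun j hj => hM j (by omega)
  rw [h0, map_sum, LinearMap.sum_apply]
  have key : ∀ j, S.prod k (((-1 : 𝕜) ^ (s + j) * (j.factorial : 𝕜)⁻¹) •
      (S.der ^ j) (S.prod (s + j) b a)) f =
      ((-1 : 𝕜) ^ s * k.choose j) • S.prod (k - j) (S.prod (s + j) b a) f := by
    intro j
    rw [map_smul, LinearMap.smul_apply, prod_der_pow_left, smul_smul]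
    congr 1
    have : (j.factorial : 𝕜) ≠ 0 := by exact_mod_cast j.factorial_ne_zero
    rw [Nat.descFactorial_eq_factorial_mul_choose, pow_add]
    push_cast
    field_simp
    rw [← pow_mul, mul_comm j 2, pow_mul]
    simp
  rw [Finset.sum_congr rfl fun j _ => key j]
  symm
  refine Finset.sum_subset (Finset.range_mono (by omega)) fun j _ hj => ?_
  rw [Nat.choose_eq_zero_of_lt (by simpa using hj)]
  simp

/-- Left multiplications in the reverse order. -/
theorem prod_prod_eq_curly (hS : S.IsAssociative) (n m : ℕ) (a b f : C) :
    S.prod m b (S.prod n a f) = ∑ s ∈ Finset.range (n + 1),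
      (n.choose s : 𝕜) • S.prod (n + m - s) (S.curly s b a) f := by
  obtain ⟨M, hM⟩ := S.exists_bound b a
  let Q : ℕ → C := fun p => S.prod (n + m - p) (S.prod p b a) f
  have h1 : ∀ s ∈ Finset.range (n + 1), (n.choose s : 𝕜) • S.prod (n + m - s) (S.curly s b a) f =
      umbral Q (((n.choose s : 𝕜) * (-1) ^ s) •
        (Polynomial.X ^ s * (1 + Polynomial.X) ^ (n + m - s)) : Polynomial 𝕜) := by
    intro s _
    rw [S.prod_curly_left (hM s), map_smul, umbral_X_pow_mul, mul_smul]
    congr 1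
    rw [Finset.smul_sum]
    refine Finset.sum_congr rfl fun j _ => ?_
    simp only [Q]
    rw [mul_smul, Nat.sub_sub]
  rw [Finset.sum_congr rfl h1, ← map_sum]
  -- Expand `1 = (-X + (1 + X)) ^ n` and multiply by `(1 + X) ^ m`.
  have h2 : ∑ s ∈ Finset.range (n + 1), (((n.choose s : 𝕜) * (-1) ^ s) •
      (Polynomial.X ^ s * (1 + Polynomial.X) ^ (n + m - s)) : Polynomial 𝕜) =
      Polynomial.X ^ 0 * (1 + Polynomial.X) ^ m := by
    have h := add_pow (-Polynomial.X : Polynomial 𝕜) (1 + Polynomial.X) n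
    rw [show -Polynomial.X + (1 + Polynomial.X) = (1 : Polynomial 𝕜) by ring, one_pow] at h
    have h' := congrArg (· * (1 + Polynomial.X : Polynomial 𝕜) ^ m) h
    simp only [one_mul, Finset.sum_mul] at h'
    rw [pow_zero, one_mul, h']
    refine Finset.sum_congr rfl fun s hs => ?_
    have : n + m - s = (n - s) + m := by have := Finset.mem_range.1 hs; omega
    rw [this, pow_add, Polynomial.smul_eq_C_mul, neg_pow]
    simp only [map_mul, map_pow, map_neg, map_one, map_natCast]
    ring
  rw [h2, umbral_X_pow_mul, hS]
  refine Finset.sum_congr rfl fun p _ => ?_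
  simp only [Q, zero_add, add_comm n m]

/-- Left multiplications commute with the right multiplications `{· (n) x}`. -/
theorem curly_prod_left (hS : S.IsAssociative) (n m : ℕ) (x y f : C) :
    S.curly n (S.prod m y f) x = S.prod m y (S.curly n f x) := by
  obtain ⟨M, hM⟩ := S.exists_bound f x
  -- Both sides are sums of the same double family: `k` is the power of `∂` left outside and `i` the
  -- amount by which the index `m` drops. The left side sums over `k` and `i` separately, the right
  -- side along the diagonals `i + k = u`.
  let F : ℕ → ℕ → C := fun i k => ((-1 : 𝕜) ^ (n + k) * (k.factorial : 𝕜)⁻¹ *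
    ((-1) ^ i * m.choose i)) • (S.der ^ k) (S.prod (m - i) y (S.prod (n + (i + k)) f x))
  have hF1 : ∀ i k, m < i → F i k = 0 := fun i k h => by
    simp only [F, Nat.choose_eq_zero_of_lt h, Nat.cast_zero, mul_zero, zero_smul]
  have hF2 : ∀ i k, M ≤ k → F i k = 0 := fun i k h => by
    simp only [F, hM n (i + k) (by omega), map_zero, smul_zero]
  have h1 : S.curly n (S.prod m y f) x = ∑ k ∈ Finset.range M, ∑ i ∈ Finset.range (m + 1), F i k := by
    rw [S.curly_eq_sum (M := M) (fun s hs => by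
      rw [S.prod_prod_left hS]
      refine Finset.sum_eq_zero fun j _ => ?_
      rw [add_assoc, hM n (s + j) (by omega), map_zero, smul_zero])]
    refine Finset.sum_congr rfl fun k _ => ?_
    rw [S.prod_prod_left hS, map_sum, Finset.smul_sum]
    refine Finset.sum_congr rfl fun i _ => ?_
    simp only [F]
    rw [map_smul, smul_smul, add_assoc, add_comm k i]
  have h2 : S.curly n f x = _ := S.curly_eq_sum (M := m + 1 + M) (fun s hs => hM n s (by omega))
  rw [h1, h2, map_sum]
  have h3 : ∀ u, S.prod m y (((-1 : 𝕜) ^ (n + u) * (u.factorial : 𝕜)⁻¹) •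
      (S.der ^ u) (S.prod (n + u) f x)) = ∑ i ∈ Finset.range (u + 1), F i (u - i) := by
    intro u
    rw [map_smul, prod_der_pow, Finset.smul_sum, ← Finset.Nat.sum_antidiagonal_eq_sum_range_succ F]
    refine Finset.sum_congr rfl fun ij hij => ?_
    obtain ⟨i, k⟩ := ij
    rw [← Finset.HasAntidiagonal.mem_antidiagonal.1 hij]
    simp only [F]
    rw [← Nat.cast_smul_eq_nsmul 𝕜, smul_smul, smul_smul]
    congr 1
    have h0 : ((i + k).choose i : 𝕜) * (i.factorial * k.factorial) = (i + k).factorial := by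
      rw [← Nat.add_choose_mul_factorial_mul_factorial i k, Nat.choose_symm_add]; push_cast; ring
    have hi : (i.factorial : 𝕜) ≠ 0 := by exact_mod_cast i.factorial_ne_zero
    have hk : (k.factorial : 𝕜) ≠ 0 := by exact_mod_cast k.factorial_ne_zero
    have hik : ((i + k).factorial : 𝕜) ≠ 0 := by exact_mod_cast (i + k).factorial_ne_zero
    rw [Nat.descFactorial_eq_factorial_mul_choose]
    push_cast
    field_simp
    rw [← h0]
    ring
  rw [Finset.sum_congr rfl fun u _ => h3 u, Finset.sum_range_diag_flip, Finset.sum_comm]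
  symm
  rw [Finset.sum_range_add _ (m + 1) M, Finset.sum_eq_zero (s := Finset.range M), add_zero]
  · refine Finset.sum_congr rfl fun i hi => ?_
    symm
    refine Finset.sum_subset (Finset.range_mono (by have := Finset.mem_range.1 hi; omega))
      fun k _ hk => hF2 i k (by simpa using hk)
  · intro k _
    exact Finset.sum_eq_zero fun j _ => hF1 _ _ (by omega)

end ConformalSuperalgebra

/-! ### Envelopes without the generation condition. -/

namespace ConformalSuperalgebra

variable {𝕜 C L ι : Type*} [Field 𝕜] [AddCommGroup C] [Module 𝕜 C] [AddCommGroup L] [Module 𝕜 L]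

/-- An associative envelope that need not be generated by the image of `L`. -/
structure IsPreEnvelope (SL : ConformalSuperalgebra 𝕜 L) (X : ι → L) (N : ι → ι → ℕ)
    (S : ConformalSuperalgebra 𝕜 C) (φ : L →ₗ[𝕜] C) : Prop where
  assoc : S.IsAssociative
  map_der : ∀ x, φ (SL.der x) = S.der (φ x)
  map_grade : ∀ i, ∀ x ∈ SL.grade i, φ x ∈ S.grade i
  map_bracket : ∀ (n : ℕ) (i j : ZMod 2), ∀ x ∈ SL.grade i, ∀ y ∈ SL.grade j,
    φ (SL.prod n x y) = S.superComm i j n (φ x) (φ y)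
  bounded : ∀ a b n, N a b ≤ n → S.prod n (φ (X a)) (φ (X b)) = 0

theorem IsEnvelope.isPreEnvelope {SL : ConformalSuperalgebra 𝕜 L} {X : ι → L} {N : ι → ι → ℕ}
    {S : ConformalSuperalgebra 𝕜 C} {φ : L →ₗ[𝕜] C} (h : IsEnvelope SL X N S φ) :
    IsPreEnvelope SL X N S φ :=
  ⟨h.assoc, h.map_der, h.map_grade, h.map_bracket, h.bounded⟩

theorem neg_one_pow_mul_self' (k : ℕ) : (-1 : 𝕜) ^ k * (-1) ^ k = 1 := by
  rw [← mul_pow]; simp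

/-- On the image of the Lie algebra a right multiplication becomes a left one up to a bracket. This
is the source of the relations `comm0_vv`, ..., `comm1_gg`. -/
theorem IsPreEnvelope.curly_eq {SL : ConformalSuperalgebra 𝕜 L} {X : ι → L} {N : ι → ι → ℕ}
    {S : ConformalSuperalgebra 𝕜 C} {φ : L →ₗ[𝕜] C} (h : IsPreEnvelope SL X N S φ) (n : ℕ)
    {i j : ZMod 2} {x y : L} (hx : x ∈ SL.grade i) (hy : y ∈ SL.grade j) :
    S.curly n (φ y) (φ x) =
      (-1 : 𝕜) ^ (i.val * j.val) • (S.prod n (φ x) (φ y) - φ (SL.prod n x y)) := by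
  rw [h.map_bracket n i j x hx y hy, superComm, sub_sub_cancel, smul_smul, neg_one_pow_mul_self',
    one_smul]

/-- The commutation rule of left multiplications in an associative envelope. -/
theorem IsPreEnvelope.prod_prod [CharZero 𝕜] {SL : ConformalSuperalgebra 𝕜 L} {X : ι → L}
    {N : ι → ι → ℕ} {S : ConformalSuperalgebra 𝕜 C} {φ : L →ₗ[𝕜] C}
    (h : IsPreEnvelope SL X N S φ) (n m : ℕ)
    {i j : ZMod 2} {x y : L} (hx : x ∈ SL.grade i) (hy : y ∈ SL.grade j) (f : C) :
    S.prod n (φ x) (S.prod m (φ y) f) =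
      (-1 : 𝕜) ^ (i.val * j.val) • S.prod m (φ y) (S.prod n (φ x) f) +
      ∑ s ∈ Finset.range (n + 1), (n.choose s : 𝕜) • S.prod (n + m - s) (φ (SL.prod s x y)) f := by
  -- Both orders of multiplication are expanded over the same range `s ≤ n`, so the difference is a
  -- super-commutator in each term.
  rw [S.prod_prod_eq_curly h.assoc n m (φ x) (φ y) f, h.assoc n m, Finset.smul_sum, ← Finset.sum_add_distrib]
  refine Finset.sum_congr rfl fun s _ => ?_
  rw [h.curly_eq s hx hy, map_smul, LinearMap.smul_apply, smul_comm, smul_smul ((-1 : 𝕜) ^ _),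
    neg_one_pow_mul_self', one_smul, ← smul_add, map_sub, LinearMap.sub_apply, sub_add_cancel]

end ConformalSuperalgebra

/-! ### The action of `A(X, K₁)` on an envelope. -/

namespace NeveuSchwartz
open GS ConformalSuperalgebra Polynomial

variable {𝕜 : Type*} [Field 𝕜]

theorem lambdaBracket_gen (a b c : Gen) :
    lambdaBracket (K1.gen 𝕜 a) (K1.gen 𝕜 b) c = structConst 𝕜 a b c := by
  cases a <;> cases b <;> simp [lambdaBracket, sum_gen, K1.gen]

theorem bracket_gen (n : ℕ) (a b c : Gen) :
    bracket n (K1.gen 𝕜 a) (K1.gen 𝕜 b) c = (n.factorial : 𝕜) • (structConst 𝕜 a b c).coeff n := by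
  rw [bracket_apply, lambdaBracket_gen]

theorem bracket_vv0 : bracket 0 (K1.gen 𝕜 .v) (K1.gen 𝕜 .v) = der 𝕜 (K1.gen 𝕜 .v) := by
  funext c; rw [bracket_gen]; cases c <;> simp [structConst, der_apply, K1.gen]

theorem bracket_vv1 : bracket 1 (K1.gen 𝕜 .v) (K1.gen 𝕜 .v) = (2 : 𝕜) • K1.gen 𝕜 .v := by
  funext c; rw [bracket_gen]
  cases c <;> simp [structConst, K1.gen, coeff_X, Polynomial.smul_eq_C_mul, coeff_C]

theorem bracket_vg0 : bracket 0 (K1.gen 𝕜 .v) (K1.gen 𝕜 .g) = der 𝕜 (K1.gen 𝕜 .g) := by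
  funext c; rw [bracket_gen]; cases c <;> simp [structConst, der_apply, K1.gen]

theorem bracket_vg1 : bracket 1 (K1.gen 𝕜 .v) (K1.gen 𝕜 .g) = (3 / 2 : 𝕜) • K1.gen 𝕜 .g := by
  funext c; rw [bracket_gen]
  cases c <;> simp [structConst, K1.gen, coeff_X, Polynomial.smul_eq_C_mul, coeff_C]

theorem bracket_gv0 : bracket 0 (K1.gen 𝕜 .g) (K1.gen 𝕜 .v) =
    (1 / 2 : 𝕜) • der 𝕜 (K1.gen 𝕜 .g) := by
  funext c; rw [bracket_gen]
  cases c <;> simp [structConst, der_apply, K1.gen, Polynomial.smul_eq_C_mul]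

theorem bracket_gv1 : bracket 1 (K1.gen 𝕜 .g) (K1.gen 𝕜 .v) = (3 / 2 : 𝕜) • K1.gen 𝕜 .g := by
  funext c; rw [bracket_gen]
  cases c <;> simp [structConst, K1.gen, coeff_X, Polynomial.smul_eq_C_mul, coeff_C]

theorem bracket_gg0 : bracket 0 (K1.gen 𝕜 .g) (K1.gen 𝕜 .g) =
    -((1 / 2 : 𝕜) • K1.gen 𝕜 .v) := by
  funext c; rw [bracket_gen]
  cases c <;> simp [structConst, K1.gen, Polynomial.smul_eq_C_mul, neg_div]

theorem bracket_gg1 : bracket 1 (K1.gen 𝕜 .g) (K1.gen 𝕜 .g) = 0 := by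
  funext c; rw [bracket_gen]
  cases c <;> simp [structConst, K1.gen, coeff_C]

theorem bracket_gen_of_two_le {n : ℕ} (hn : 2 ≤ n) (a b : Gen) :
    bracket n (K1.gen 𝕜 a) (K1.gen 𝕜 b) = 0 := by
  obtain ⟨n, rfl⟩ := Nat.exists_eq_add_of_le' hn
  funext c; rw [bracket_gen]
  cases a <;> cases b <;> cases c <;> simp [structConst, K1.gen, coeff_X, coeff_C]

/-- The parity of a generator. -/
def Gen.parity : Gen → ZMod 2
  | .v => 0
  | .g => 1

theorem gen_mem_grade (a : Gen) : K1.gen 𝕜 a ∈ grade 𝕜 a.parity := by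
  rw [mem_grade]; cases a <;> simp [Gen.parity, K1.gen]

theorem toFreeA_single (x : Gen) (f : FreeAlg 𝕜 Letter) :
    toFreeA 𝕜 (Finsupp.single x f) = Finsupp.single x (toA 𝕜 f) := by
  simp [toFreeA]

theorem toFreeA_smul (a : FreeAlg 𝕜 Letter) (f : FreeMod 𝕜 Letter Gen) :
    toFreeA 𝕜 (a • f) = toA 𝕜 a • toFreeA 𝕜 f := by
  induction f using Finsupp.induction_linear with
  | zero => simp
  | add f g hf hg => rw [smul_add, map_add, hf, hg, map_add, smul_add]
  | single x b => rw [Finsupp.smul_single, toFreeA_single, toFreeA_single, Finsupp.smul_single,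
      smul_eq_mul, smul_eq_mul, map_mul]

section Action

variable {C : Type*} [AddCommGroup C] [Module 𝕜 C] (S : ConformalSuperalgebra 𝕜 C)
  (φ : K1 𝕜 →ₗ[𝕜] C)

/-- The action of the letters by linear maps. -/
noncomputable def actEnd : Letter → Module.End 𝕜 C
  | .d => S.der
  | .L n a => S.prod n (φ (K1.gen 𝕜 a))
  | .R n a => S.curlyRight n (φ (K1.gen 𝕜 a))

theorem actEnd_apply (z : Letter) (f : C) : actEnd S φ z f = act S φ z f := by
  cases z <;> rfl

/-- The action of the free algebra. -/
noncomputable def freeAct : FreeAlg 𝕜 Letter →ₐ[𝕜] Module.End 𝕜 C :=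
  MonoidAlgebra.lift 𝕜 (Module.End 𝕜 C) (FreeMonoid Letter) (FreeMonoid.lift (actEnd S φ))

theorem freeAct_letter (z : Letter) : freeAct S φ (letter 𝕜 z) = actEnd S φ z := by
  simp [freeAct, letter, word]

theorem freeAct_d (f : C) : freeAct S φ (d 𝕜) f = S.der f := by rw [d, freeAct_letter]; rfl
theorem freeAct_l (n : ℕ) (a : Gen) (f : C) :
    freeAct S φ (l 𝕜 n a) f = S.prod n (φ (K1.gen 𝕜 a)) f := by rw [l, freeAct_letter]; rfl
theorem freeAct_r (n : ℕ) (a : Gen) (f : C) :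
    freeAct S φ (r 𝕜 n a) f = S.curly n f (φ (K1.gen 𝕜 a)) := by rw [r, freeAct_letter]; rfl

variable {S φ}

/-- The bracket of two generators has degree at most one in `λ`, so only `s = 0` and `s = 1`
contribute. For `n = 0` the second term has coefficient zero. -/
theorem sum_bracket (n m : ℕ) (a b : Gen) (f : C) :
    ∑ s ∈ Finset.range (n + 1), (n.choose s : 𝕜) • S.prod (n + m - s)
      (φ ((K1.alg 𝕜).prod s (K1.gen 𝕜 a) (K1.gen 𝕜 b))) f =
    S.prod (n + m) (φ (bracket 0 (K1.gen 𝕜 a) (K1.gen 𝕜 b))) f +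
      (n : 𝕜) • S.prod (n + m - 1) (φ (bracket 1 (K1.gen 𝕜 a) (K1.gen 𝕜 b))) f := by
  change ∑ s ∈ Finset.range (n + 1), (n.choose s : 𝕜) • S.prod (n + m - s)
      (φ (bracket s (K1.gen 𝕜 a) (K1.gen 𝕜 b))) f = _
  rcases n with _ | n
  · simp
  rw [Finset.sum_range_succ', Finset.sum_range_succ', Finset.sum_eq_zero]
  · simp; abel
  · intro s _
    rw [bracket_gen_of_two_le (by omega)]; simp

variable [CharZero 𝕜]

/-- The relations with `∂` are sesquilinearity, those between `R` and `L` are the commutation of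
left and right multiplications, and those between two letters `L` are the commutator formula
`prod_prod` with the explicit brackets. -/
theorem freeAct_algRel (hS : IsPreEnvelope (K1.alg 𝕜) (K1.gen 𝕜) N S φ) {p q : FreeAlg 𝕜 Letter}
    (h : AlgRel 𝕜 p q) : freeAct S φ p = freeAct S φ q := by
  have hd : ∀ x, φ (der 𝕜 x) = S.der (φ x) := hS.map_der
  have key := fun (n m : ℕ) (a b : Gen) (f : C) =>
    hS.prod_prod n m (gen_mem_grade (𝕜 := 𝕜) a) (gen_mem_grade b) f
  simp only [sum_bracket] at key
  ext f
  induction h with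
  | d_l0 x => simp [freeAct_d, freeAct_l, S.prod_der]
  | d_l1 x => simp [freeAct_d, freeAct_l, S.prod_der]
  | l_d n x h => simp [freeAct_d, freeAct_l, S.prod_der]
  | r_d n x => simp [freeAct_d, freeAct_r, S.curly_der_left]
  | r_l n m x y => simp [freeAct_l, freeAct_r, S.curly_prod_left hS.assoc]
  | l_vv n m h =>
    have := key n m .v .v f
    simp only [map_mul, map_add, map_smul, freeAct_l, Module.End.mul_apply, LinearMap.add_apply,
      LinearMap.smul_apply, this, bracket_vv0, bracket_vv1, hd, S.der_prod, Gen.parity,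
      ZMod.val_zero]
    push_cast
    module
  | l_vg n m h =>
    have := key n m .v .g f
    simp only [map_mul, map_add, map_smul, freeAct_l, Module.End.mul_apply, LinearMap.add_apply,
      LinearMap.smul_apply, this, bracket_vg0, bracket_vg1, hd, S.der_prod, Gen.parity,
      ZMod.val_zero, zero_mul]
    push_cast
    module
  | l_gv n m h =>
    have := key n m .g .v f
    simp only [map_mul, map_add, map_smul, freeAct_l, Module.End.mul_apply, LinearMap.add_apply,
      LinearMap.smul_apply, this, bracket_gv0, bracket_gv1, hd, S.der_prod, Gen.parity,
      ZMod.val_zero, mul_zero]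
    push_cast
    module
  | l_gg n m h =>
    have := key n m .g .g f
    simp only [map_mul, map_sub, map_neg, map_smul, freeAct_l, Module.End.mul_apply,
      LinearMap.sub_apply, LinearMap.neg_apply,
      LinearMap.smul_apply, this, bracket_gg0, bracket_gg1, Gen.parity, map_zero,
      LinearMap.zero_apply]
    simp only [show (1 : ZMod 2).val = 1 from rfl]
    module
  | l_gg_diag n =>
    have := key n n .g .g f
    simp only [bracket_gg0, bracket_gg1, Gen.parity, map_zero, LinearMap.zero_apply, map_neg,
      map_smul, LinearMap.neg_apply, LinearMap.smul_apply, show (1 : ZMod 2).val = 1 from rfl] at this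
    simp only [map_mul, map_neg, map_smul, freeAct_l, Module.End.mul_apply, LinearMap.neg_apply,
      LinearMap.smul_apply, two_mul]
    linear_combination (norm := module) (1 / 2 : 𝕜) • this

/-- The action of `A(X, K₁)` on an envelope. -/
noncomputable def actA (hS : IsPreEnvelope (K1.alg 𝕜) (K1.gen 𝕜) N S φ) :
    A 𝕜 →ₐ[𝕜] Module.End 𝕜 C :=
  RingQuot.liftAlgHom 𝕜 ⟨freeAct S φ, fun _ _ h => freeAct_algRel hS h⟩

theorem actA_toA (hS : IsPreEnvelope (K1.alg 𝕜) (K1.gen 𝕜) N S φ) (f : FreeAlg 𝕜 Letter) :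
    actA hS (toA 𝕜 f) = freeAct S φ f := by
  simp [actA, toA]

theorem actA_letter (hS : IsPreEnvelope (K1.alg 𝕜) (K1.gen 𝕜) N S φ) (z : Letter) (u : C) :
    actA hS (toA 𝕜 (letter 𝕜 z)) u = act S φ z u := by
  rw [actA_toA, freeAct_letter, actEnd_apply]

/-- The evaluation of the free module on an envelope. -/
noncomputable def ev (hS : IsPreEnvelope (K1.alg 𝕜) (K1.gen 𝕜) N S φ) : (Gen →₀ A 𝕜) →ₗ[𝕜] C :=
  Finsupp.lsum 𝕜 fun x => (actA hS).toLinearMap.flip (φ (K1.gen 𝕜 x))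

theorem ev_single (hS : IsPreEnvelope (K1.alg 𝕜) (K1.gen 𝕜) N S φ) (x : Gen) (a : A 𝕜) :
    ev hS (Finsupp.single x a) = actA hS a (φ (K1.gen 𝕜 x)) := by
  simp [ev]

theorem ev_smul (hS : IsPreEnvelope (K1.alg 𝕜) (K1.gen 𝕜) N S φ) (a : A 𝕜) (f : Gen →₀ A 𝕜) :
    ev hS (a • f) = actA hS a (ev hS f) := by
  induction f using Finsupp.induction_linear with
  | zero => simp
  | add f g hf hg => rw [smul_add, map_add, hf, hg, map_add, map_add]
  | single x b => rw [Finsupp.smul_single, smul_eq_mul, ev_single, ev_single, map_mul]; rfl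

theorem ev_toFreeA_smul_e (hS : IsPreEnvelope (K1.alg 𝕜) (K1.gen 𝕜) N S φ) (f : FreeAlg 𝕜 Letter)
    (x : Gen) : ev hS (toFreeA 𝕜 (f • e 𝕜 x)) = freeAct S φ f (φ (K1.gen 𝕜 x)) := by
  rw [e, smul_gen_eq_single, toFreeA_single, ev_single, actA_toA]

theorem ev_toFreeA_e (hS : IsPreEnvelope (K1.alg 𝕜) (K1.gen 𝕜) N S φ) 
    (x : Gen) : ev hS (toFreeA 𝕜 (e 𝕜 x)) = φ (K1.gen 𝕜 x) := by
  rw [← one_smul (FreeAlg 𝕜 Letter) (e 𝕜 x), ev_toFreeA_smul_e, map_one, Module.End.one_apply]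

theorem two_le_N (x y : Gen) : 2 ≤ N x y := by cases x <;> cases y <;> simp [N]

/-- Each right multiplication of a generator is computed in two ways: as a finite sum by locality
(`hs`) and as a left multiplication corrected by a bracket (`hc`). Apart from vanishing, the
relations express one or the other. -/
theorem ev_defRel (hS : IsPreEnvelope (K1.alg 𝕜) (K1.gen 𝕜) N S φ) {p q : FreeMod 𝕜 Letter Gen}
    (h : DefRel 𝕜 p q) : ev hS (toFreeA 𝕜 p) = ev hS (toFreeA 𝕜 q) := by
  have hd : ∀ x, φ (der 𝕜 x) = S.der (φ x) := hS.map_der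
  have hb := hS.bounded
  have hc : ∀ (x y : Gen) (n : ℕ), S.curly n (φ (K1.gen 𝕜 y)) (φ (K1.gen 𝕜 x)) =
    (-1 : 𝕜) ^ (x.parity.val * y.parity.val) • (S.prod n (φ (K1.gen 𝕜 x)) (φ (K1.gen 𝕜 y)) -
      φ (bracket n (K1.gen 𝕜 x) (K1.gen 𝕜 y))) := fun x y n =>
    hS.curly_eq n (gen_mem_grade x) (gen_mem_grade y)
  have hs : ∀ (x y : Gen) (n : ℕ), S.curly n (φ (K1.gen 𝕜 y)) (φ (K1.gen 𝕜 x)) = _ :=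
    fun x y n => S.curly_eq_sum (M := N y x) fun s hs => hb y x (n + s) (by omega)
  induction h with
  | l_loc n x y h => rw [ev_toFreeA_smul_e, freeAct_l, hb _ _ _ h, map_zero, map_zero]
  | r_loc n x y h =>
    rw [ev_toFreeA_smul_e, freeAct_r, S.curly_eq_sum (M := 0) fun s _ => hb _ _ _ (by omega)]
    simp
  | r0_vv =>
    rw [ev_toFreeA_smul_e, freeAct_r, hs]
    simp [ev_toFreeA_smul_e, ev_toFreeA_e, freeAct_l, freeAct_d, N, Finset.sum_range_succ, pow_two,
      sub_eq_add_neg]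
  | r1_vv =>
    rw [ev_toFreeA_smul_e, freeAct_r, hs]
    have := hb .v .v 3 le_rfl
    simp [ev_toFreeA_smul_e, ev_toFreeA_e, freeAct_l, freeAct_d, N, Finset.sum_range_succ, this]
  | r2_vv =>
    rw [ev_toFreeA_smul_e, freeAct_r, hs]
    have := hb .v .v 3 le_rfl
    have := hb .v .v 4 (by decide)
    simp [ev_toFreeA_smul_e, ev_toFreeA_e, freeAct_l, freeAct_d, N, Finset.sum_range_succ, *]
  | r_mixed n x y hxy hn =>
    rw [ev_toFreeA_smul_e, freeAct_r, hs]
    have h2 : N y x = 2 := by cases x <;> cases y <;> simp_all [N]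
    rw [h2]
    simp [ev_toFreeA_smul_e, ev_toFreeA_e, freeAct_l, freeAct_d, Finset.sum_range_succ, pow_succ,
      smul_sub, sub_eq_add_neg]
  | r0_gg =>
    rw [ev_toFreeA_smul_e, freeAct_r, hs]
    simp [ev_toFreeA_smul_e, ev_toFreeA_e, freeAct_l, freeAct_d, N, Finset.sum_range_succ,
      sub_eq_add_neg]
  | r1_gg =>
    rw [ev_toFreeA_smul_e, freeAct_r, hs]
    have := hb .g .g 2 le_rfl
    simp [ev_toFreeA_smul_e, ev_toFreeA_e, freeAct_l, freeAct_d, N, Finset.sum_range_succ, this]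
  | comm0_vv | comm1_vv | comm0_vg | comm1_vg | comm0_gv | comm1_gv | comm0_gg | comm1_gg =>
    rw [ev_toFreeA_smul_e, freeAct_r, hc]
    simp [map_sub, map_neg, ← smul_assoc, ev_toFreeA_smul_e, ev_toFreeA_e, freeAct_l, freeAct_d,
      bracket_vv0, bracket_vv1,
      bracket_vg0, bracket_vg1, bracket_gv0, bracket_gv1, bracket_gg0, bracket_gg1, hd, Gen.parity,
      show (1 : ZMod 2).val = 1 from rfl, sub_eq_add_neg, add_comm]

theorem ev_eq_zero_of_mem_span (hS : IsPreEnvelope (K1.alg 𝕜) (K1.gen 𝕜) N S φ) {f : Gen →₀ A 𝕜}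
    (hf : f ∈ Submodule.span (A 𝕜) (toFreeA 𝕜 '' defRels 𝕜)) : ev hS f = 0 := by
  induction hf using Submodule.span_induction with
  | mem x hx =>
    obtain ⟨_, ⟨p, q, h, rfl⟩, rfl⟩ := hx
    rw [map_sub, map_sub, ev_defRel hS h, sub_self]
  | zero => exact map_zero _
  | add x y _ _ hx hy => rw [map_add, hx, hy, add_zero]
  | smul a x _ hx => rw [ev_smul, hx, map_zero]

end Action

end NeveuSchwartz

/-! ### An envelope is generated by `v` and `g` as a module. -/

namespace NeveuSchwartz
open GS ConformalSuperalgebra Polynomial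

variable {𝕜 : Type*} [Field 𝕜]

theorem K1.single_mem {q : Submodule 𝕜 (K1 𝕜)} {a : Gen} (hg : K1.gen 𝕜 a ∈ q)
    (hd : ∀ x ∈ q, der 𝕜 x ∈ q) (p : 𝕜[X]) : (Pi.single a p : K1 𝕜) ∈ q := by
  have h : ∀ n : ℕ, (Pi.single a (X ^ n) : K1 𝕜) ∈ q := by
    intro n
    induction n with
    | zero => rw [pow_zero]; exact hg
    | succ n ih =>
      convert hd _ ih using 1
      funext b
      rw [der_apply]
      by_cases hb : b = a
      · subst hb; simp [pow_succ']
      · simp [hb]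
  induction p using Polynomial.induction_on' with
  | add p r hp hr => rw [Pi.single_add]; exact q.add_mem hp hr
  | monomial n c =>
    rw [← mul_one c, ← smul_eq_mul, ← Polynomial.smul_monomial,
      Polynomial.monomial_one_right_eq_X_pow, Pi.single_smul]
    exact q.smul_mem _ (h n)

theorem K1.mem_of_gen_mem {q : Submodule 𝕜 (K1 𝕜)} (hg : ∀ a, K1.gen 𝕜 a ∈ q)
    (hd : ∀ x ∈ q, der 𝕜 x ∈ q) (x : K1 𝕜) : x ∈ q := by
  have hx : x = Pi.single .v (x .v) + Pi.single .g (x .g) := by funext b; cases b <;> simp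
  rw [hx]
  exact q.add_mem (K1.single_mem (hg _) hd _) (K1.single_mem (hg _) hd _)

variable {C : Type*} [AddCommGroup C] [Module 𝕜 C] {S : ConformalSuperalgebra 𝕜 C}
  {φ : K1 𝕜 →ₗ[𝕜] C} [CharZero 𝕜]

theorem ev_single_one (hS : IsPreEnvelope (K1.alg 𝕜) (K1.gen 𝕜) N S φ) (x : Gen) :
    ev hS (Finsupp.single x 1) = φ (K1.gen 𝕜 x) := by
  rw [ev_single, map_one, Module.End.one_apply]

theorem actA_mem_range (hS : IsPreEnvelope (K1.alg 𝕜) (K1.gen 𝕜) N S φ) (a : A 𝕜) {c : C}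
    (hc : c ∈ LinearMap.range (ev hS)) : actA hS a c ∈ LinearMap.range (ev hS) := by
  obtain ⟨f, rfl⟩ := hc
  exact ⟨a • f, ev_smul hS a f⟩

theorem der_mem_range (hS : IsPreEnvelope (K1.alg 𝕜) (K1.gen 𝕜) N S φ) {c : C}
    (hc : c ∈ LinearMap.range (ev hS)) : S.der c ∈ LinearMap.range (ev hS) := by
  have h := actA_mem_range hS (toA 𝕜 (d 𝕜)) hc
  rwa [actA_toA, freeAct_d] at h

theorem map_mem_range (hS : IsPreEnvelope (K1.alg 𝕜) (K1.gen 𝕜) N S φ) (x : K1 𝕜) :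
    φ x ∈ LinearMap.range (ev hS) := by
  refine K1.mem_of_gen_mem (q := (LinearMap.range (ev hS)).comap φ)
    (fun a => ⟨_, ev_single_one hS a⟩) (fun x hx => ?_) x
  have h := hS.map_der x
  rw [Submodule.mem_comap] at hx ⊢
  change φ ((K1.alg 𝕜).der x) ∈ _
  rw [h]
  exact der_mem_range hS hx

/-- The span of iterated left multiplications by generators and derivations is a subalgebra. -/
theorem ev_surjective (h : IsEnvelope (K1.alg 𝕜) (K1.gen 𝕜) N S φ) :
    Function.Surjective (ev h.isPreEnvelope) := by
  have hS := h.isPreEnvelope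
  let M := LinearMap.range (ev h.isPreEnvelope)
  -- `P` is the set of elements whose left multiplications preserve `M`. It contains the image of
  -- `K₁` and is closed under products because associativity can be solved for `(c (n) e) (k) m`.
  -- Hence `P` is everything, and `M` is itself closed under products.
  let P : Submodule 𝕜 C :=
    { carrier := {c | ∀ n, ∀ m ∈ M, S.prod n c m ∈ M}
      add_mem' := fun ha hb n m hm => by
        rw [map_add]; exact M.add_mem (ha n m hm) (hb n m hm)
      zero_mem' := fun n m _ => by rw [map_zero]; exact M.zero_mem
      smul_mem' := fun c a ha n m hm => by
        rw [map_smul]; exact M.smul_mem _ (ha n m hm) }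
  have hPd : ∀ c ∈ P, S.der c ∈ P := fun c hc n m hm => by
    rw [S.der_prod]
    exact M.neg_mem (M.smul_mem _ (hc _ m hm))
  have hPφ : ∀ x, φ x ∈ P := by
    refine K1.mem_of_gen_mem (q := P.comap φ) (fun a n m hm => ?_) fun x hx => ?_
    · have := actA_mem_range hS (toA 𝕜 (l 𝕜 n a)) hm
      rwa [actA_toA, freeAct_l] at this
    · have := hS.map_der x
      rw [Submodule.mem_comap] at hx ⊢
      change φ ((K1.alg 𝕜).der x) ∈ _
      rw [this]
      exact hPd _ hx
  have hP : P = ⊤ := h.generates P hPφ hPd fun n c hc e he k m hm => by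
    rw [S.prod_prod_left h.assoc]
    exact M.sum_mem fun j _ => M.smul_mem _ (hc _ _ (he _ m hm))
  have hM : M = ⊤ := h.generates M (map_mem_range hS) (fun c hc => der_mem_range hS hc)
    fun n c _ e he => (hP ▸ Submodule.mem_top : c ∈ P) n e he
  exact LinearMap.range_eq_top.1 hM

end NeveuSchwartz

/-! ### The additional relations are consequences of the defining ones. -/

namespace NeveuSchwartz
open GS

section Extra

variable {𝕜 M : Type*} [Field 𝕜] [CharZero 𝕜] [AddCommGroup M] [Module 𝕜 M]
  {ρ : FreeAlg 𝕜 Letter →ₐ[𝕜] Module.End 𝕜 M} {E : FreeMod 𝕜 Letter Gen →ₗ[𝕜] M}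

/-- In every `A(X, K₁)`-module the additional relations follow from the defining relations. -/
theorem ExtraRel.map_eq (hρ : ∀ p q, AlgRel 𝕜 p q → ρ p = ρ q)
    (hE : ∀ f m, E (f • m) = ρ f (E m)) (hdef : ∀ p q, DefRel 𝕜 p q → E p = E q)
    {p q : FreeMod 𝕜 Letter Gen} (h : ExtraRel 𝕜 p q) : E p = E q := by
  obtain ⟨D, hD⟩ : ∃ D, D = ρ (d 𝕜) := ⟨_, rfl⟩
  obtain ⟨V, hV⟩ : ∃ V : ℕ → Module.End 𝕜 M, ∀ n, ρ (l 𝕜 n .v) = V n := ⟨_, fun _ => rfl⟩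
  obtain ⟨G, hG⟩ : ∃ G : ℕ → Module.End 𝕜 M, ∀ n, ρ (l 𝕜 n .g) = G n := ⟨_, fun _ => rfl⟩
  obtain ⟨R, hR⟩ : ∃ R : ℕ → Gen → Module.End 𝕜 M, ∀ n a, ρ (r 𝕜 n a) = R n a :=
    ⟨_, fun _ _ => rfl⟩
  obtain ⟨v, hv⟩ : ∃ v, v = E (e 𝕜 .v) := ⟨_, rfl⟩
  obtain ⟨g, hg⟩ : ∃ g, g = E (e 𝕜 .g) := ⟨_, rfl⟩
  have alg := fun p q (h : AlgRel 𝕜 p q) f => LinearMap.congr_fun (hρ p q h) f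
  have dV0 := fun f => alg _ _ (.d_l0 .v) f
  have dG0 := fun f => alg _ _ (.d_l0 .g) f
  have dV1 := fun f => alg _ _ (.d_l1 .v) f
  have dG1 := fun f => alg _ _ (.d_l1 .g) f
  have V2d := fun f => alg _ _ (.l_d 2 .v le_rfl) f
  have rG := fun n x f => alg _ _ (.r_l n 1 x .g) f
  have rV := fun n x f => alg _ _ (.r_l n 1 x .v) f
  have V1G0 := fun f => alg _ _ (.l_vg 1 0 (by decide)) f
  have V2G0 := fun f => alg _ _ (.l_vg 2 0 (by decide)) f
  have V2G1 := fun f => alg _ _ (.l_vg 2 1 (by decide)) f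
  have G1V1 := fun f => alg _ _ (.l_gv 1 1 le_rfl) f
  have G1G0 := fun f => alg _ _ (.l_gg 1 0 (by decide)) f
  have G1G1 := fun f => alg _ _ (.l_gg_diag 1) f
  have V2g := hdef _ _ (.l_loc 2 .v .g le_rfl)
  have m0 := hdef _ _ (.r_mixed 0 .g .v (by decide) (by decide))
  have m1 := hdef _ _ (.r_mixed 1 .g .v (by decide) (by decide))
  have c0gv := hdef _ _ .comm0_gv
  have c1gv := hdef _ _ .comm1_gv
  have r0gg := hdef _ _ .r0_gg
  have r1gg := hdef _ _ .r1_gg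
  have c0gg := hdef _ _ .comm0_gg
  have c1vv := hdef _ _ .comm1_vv
  have c1vg := hdef _ _ .comm1_vg
  simp only [map_mul, map_add, map_sub, map_neg, map_smul, map_zero, hE, Module.End.mul_apply,
    LinearMap.add_apply, LinearMap.sub_apply, LinearMap.neg_apply, LinearMap.smul_apply, ← hD, hV,
    hG, hR, ← hv, ← hg, pow_zero, pow_one, one_smul, Nat.reduceAdd, Nat.reduceMul, Nat.reduceSub,
    Nat.cast_one, Nat.cast_zero, Nat.cast_ofNat] at dV0 dG0 dV1 dG1 V2d rG rV V1G0 V2G0 V2G1 G1V1 G1G0 G1G1 V2g m0 m1 c0gv c1gv r0gg r1gg c0gg c1vv c1vg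
  -- This identity and the next two compare the locality and the commutator expressions of `R_1^g
  -- v`, `R_0^g v` and `R_0^g g`.
  have l1g_v : G 1 v = -(V 1 g) + (3 / 2 : 𝕜) • g := by
    rw [V2g, map_zero] at m1
    linear_combination (norm := module) m1 - c1gv
  have dV1g : D (V 1 g) = V 0 g - G 0 v + (1 / 2 : 𝕜) • D g := by
    linear_combination (norm := module) m0 - c0gv
  have dG1g : D (G 1 g) = (2 : 𝕜) • G 0 g + (1 / 2 : 𝕜) • v := by
    linear_combination (norm := module) r0gg - c0gg
  have dG1v : D (G 1 v) = -(V 0 g) + D g + G 0 v := by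
    rw [l1g_v, map_add, map_neg, map_smul, dV1g]
    module
  -- Commute `∂` with `L_1^g` on `L_1^g g`. The left side vanishes, since `L_1^g L_1^g g` is a
  -- multiple of `L_2^v g = 0`.
  have l0g_l1g_g : G 0 (G 1 g) = -((1 / 2 : 𝕜) • V 1 g) + (1 / 4 : 𝕜) • g := by
    have h1 := dG1 (G 1 g)
    rw [dG1g, G1G1, V2g] at h1
    simp only [map_add, map_smul, map_neg, map_zero, smul_zero, neg_zero, G1G0, l1g_v] at h1
    linear_combination (norm := module) (1 / 3 : 𝕜) • h1
  -- Commute `R_0^g` with `L_1^g` on `v` and rewrite both orders by left multiplications.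
  have l1v_v : V 1 v = -((2 : 𝕜) • G 0 g) + (1 / 2 : 𝕜) • v := by
    have h1 := rG 0 .g v
    have h2 := dG1 g
    rw [dG1g] at h2
    rw [l1g_v, c0gv, map_add, map_neg, map_smul, rV, c0gg, map_sub, map_sub, map_neg, map_smul,
      map_smul, V1G0, G1G0, l1g_v, map_add, map_neg, map_smul] at h1
    linear_combination (norm := module) h1 + (1 / 2 : 𝕜) • h2
  -- `alpha` commutes `L_2^v` with `∂` and `beta` commutes `R_1^g` with `L_1^g`. These two linear
  -- equations determine both `L_1^v L_1^g g` and `L_2^v v` in terms of `L_1^g g`.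
  have alpha : (2 : 𝕜) • V 1 (G 1 g) = (2 : 𝕜) • G 1 g + (1 / 2 : 𝕜) • V 2 v := by
    have h1 := V2d (G 1 g)
    rw [dG1g, V2G1, V2g] at h1
    simp only [map_add, map_smul, map_zero, V2G0, V2g] at h1
    linear_combination (norm := module) -h1
  have beta : -((1 / 4 : 𝕜) • V 2 v) = V 1 (G 1 g) := by
    have h1 := rG 1 .g v
    rw [l1g_v, c1gv, map_add, map_neg, map_smul, rV, r1gg, map_sub, map_neg, map_smul, G1G1] at h1
    linear_combination (norm := module) -h1
  have l1v_l1g_g : V 1 (G 1 g) = (1 / 2 : 𝕜) • G 1 g := by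
    linear_combination (norm := module) (1 / 4 : 𝕜) • alpha - (1 / 2 : 𝕜) • beta
  have l1v_l1v_g : V 1 (V 1 g) = (3 / 2 : 𝕜) • V 1 g - (1 / 2 : 𝕜) • g := by
    have h1 := rG 1 .v v
    rw [c1vv, l1v_v, l1g_v] at h1
    simp only [map_add, map_smul, map_sub, map_neg, rV, c1vg, G1G0, l1g_v, l0g_l1g_g] at h1
    linear_combination (norm := module) -h1
  have l0g_l1v_g : G 0 (V 1 g) = (1 / 2 : 𝕜) • V 0 (G 1 g) + (1 / 2 : 𝕜) • G 0 g := by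
    have h1 := dV1 (G 1 g)
    rw [l1v_l1g_g, dG1g, map_smul, dG1g] at h1
    simp only [map_add, map_smul, V1G0, l1v_v] at h1
    linear_combination (norm := module) -(1 / 2 : 𝕜) • h1
  have powL0 : ∀ (L : Module.End 𝕜 M), (∀ f, D (L f) = L (D f)) → ∀ (s : ℕ) f,
      L ((D ^ s) f) = (D ^ s) (L f) := by
    intro L hL s
    induction s with
    | zero => intro f; simp
    | succ s ih => intro f; rw [pow_succ, Module.End.mul_apply, Module.End.mul_apply, ih, hL]
  -- One `∂` is kept next to `L f` instead of being collected in the power: for `f = v, g` the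
  -- element `∂ L_1^x f` is already known, and this yields the four infinite families.
  have powL1 : ∀ (L L' : Module.End 𝕜 M), (∀ f, D (L f) = L (D f) - L' f) →
      (∀ f, D (L' f) = L' (D f)) → ∀ (s : ℕ) f,
      L ((D ^ (s + 1)) f) = (D ^ s) (D (L f) + ((s : 𝕜) + 1) • L' f) := by
    intro L L' hL hL' s
    induction s with
    | zero => intro f; simp [hL]
    | succ s ih =>
      intro f
      rw [pow_succ, Module.End.mul_apply, ih, pow_succ D s, Module.End.mul_apply]
      congr 1
      have h1 := hL f
      rw [sub_eq_iff_eq_add.1 h1.symm, map_add, map_add, map_smul, hL']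
      push_cast
      module
  induction h with
  | l2v_v =>
    simp only [map_mul, map_pow, map_add, map_sub, map_neg, map_smul, hE, Module.End.mul_apply, ← hD, hV,
      hG, ← hv, ← hg]
    linear_combination (norm := module) -alpha - (2 : 𝕜) • beta
  | l1v_v =>
    simp only [map_mul, map_pow, map_add, map_sub, map_neg, map_smul, hE, Module.End.mul_apply, ← hD, hV,
      hG, ← hv, ← hg]
    linear_combination (norm := module) l1v_v
  | l1g_v =>
    simp only [map_mul, map_pow, map_add, map_sub, map_neg, map_smul, hE, Module.End.mul_apply, ← hD, hV,
      hG, ← hv, ← hg]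
    linear_combination (norm := module) l1g_v
  | l1v_l1v_g =>
    simp only [map_mul, map_pow, map_add, map_sub, map_neg, map_smul, hE, Module.End.mul_apply, ← hD, hV,
      hG, ← hv, ← hg]
    linear_combination (norm := module) l1v_l1v_g
  | l1v_l1g_g =>
    simp only [map_mul, map_pow, map_add, map_sub, map_neg, map_smul, hE, Module.End.mul_apply, ← hD, hV,
      hG, ← hv, ← hg]
    linear_combination (norm := module) l1v_l1g_g
  | l0g_l1v_g =>
    simp only [map_mul, map_pow, map_add, map_sub, map_neg, map_smul, hE, Module.End.mul_apply, ← hD, hV,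
      hG, ← hv, ← hg]
    linear_combination (norm := module) l0g_l1v_g
  | l0g_l1g_g =>
    simp only [map_mul, map_pow, map_add, map_sub, map_neg, map_smul, hE, Module.End.mul_apply, ← hD, hV,
      hG, ← hv, ← hg]
    linear_combination (norm := module) l0g_l1g_g
  | l1v_ds_v s hs =>
    obtain ⟨s, rfl⟩ := Nat.exists_eq_add_of_le' hs
    simp only [map_mul, map_pow, map_add, map_sub, map_neg, map_smul, hE, Module.End.mul_apply, ← hD, hV,
      hG, ← hv, ← hg, Nat.add_sub_cancel]
    rw [powL1 (V 1) (V 0) dV1 dV0]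
    simp only [powL0 (V 0) dV0, powL0 (G 0) dG0, pow_succ D, Module.End.mul_apply, dV1g, dG1g, dG1v, l1v_v, map_add, map_sub, map_neg, map_smul, dV0, dG0]
    push_cast
    module
  | l1g_ds_v s hs =>
    obtain ⟨s, rfl⟩ := Nat.exists_eq_add_of_le' hs
    simp only [map_mul, map_pow, map_add, map_sub, map_neg, map_smul, hE, Module.End.mul_apply, ← hD, hV,
      hG, ← hv, ← hg, Nat.add_sub_cancel]
    rw [powL1 (G 1) (G 0) dG1 dG0]
    simp only [powL0 (V 0) dV0, powL0 (G 0) dG0, pow_succ D, Module.End.mul_apply, dV1g, dG1g, dG1v, l1v_v, map_add, map_sub, map_neg, map_smul, dV0, dG0]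
    push_cast
    module
  | l1v_ds_g s hs =>
    obtain ⟨s, rfl⟩ := Nat.exists_eq_add_of_le' hs
    simp only [map_mul, map_pow, map_add, map_sub, map_neg, map_smul, hE, Module.End.mul_apply, ← hD, hV,
      hG, ← hv, ← hg, Nat.add_sub_cancel]
    rw [powL1 (V 1) (V 0) dV1 dV0]
    simp only [powL0 (V 0) dV0, powL0 (G 0) dG0, pow_succ D, Module.End.mul_apply, dV1g, dG1g, dG1v, l1v_v, map_add, map_sub, map_neg, map_smul, dV0, dG0]
    push_cast
    module
  | l1g_ds_g s hs =>
    obtain ⟨s, rfl⟩ := Nat.exists_eq_add_of_le' hs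
    simp only [map_mul, map_pow, map_add, map_sub, map_neg, map_smul, hE, Module.End.mul_apply, ← hD, hV,
      hG, ← hv, ← hg, Nat.add_sub_cancel]
    rw [powL1 (G 1) (G 0) dG1 dG0]
    simp only [powL0 (V 0) dV0, powL0 (G 0) dG0, pow_succ D, Module.End.mul_apply, dV1g, dG1g, dG1v, l1v_v, map_add, map_sub, map_neg, map_smul, dV0, dG0]
    push_cast
    module

end Extra

section Span

variable {𝕜 : Type*} [Field 𝕜]

/-- The quotient module enters only through these two properties: a linear action, and vanishing
exactly on `P`. -/
theorem exists_quotient.{w₁, w₂, w₃} {𝕜 : Type w₁} [Field 𝕜] {R : Type w₂} {Y : Type w₃} [Ring R] [Algebra 𝕜 R] (P : Submodule R (Y →₀ R)) :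
    ∃ (M : Type (max w₃ w₂)) (_ : AddCommGroup M) (_ : Module 𝕜 M) (q : (Y →₀ R) →ₗ[𝕜] M)
      (ρ : R →ₐ[𝕜] Module.End 𝕜 M),
      (∀ a f, q (a • f) = ρ a (q f)) ∧ ∀ f, q f = 0 ↔ f ∈ P :=
  ⟨(Y →₀ R) ⧸ P, inferInstance, inferInstance, P.mkQ.restrictScalars 𝕜, Algebra.lsmul 𝕜 𝕜 _,
    fun _ _ => rfl, fun _ => Submodule.Quotient.mk_eq_zero P⟩

variable [CharZero 𝕜]

/-- The additional relations belong to the submodule generated by the defining relations. -/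
theorem extraRel_mem_span.{w} {𝕜 : Type w} [Field 𝕜] [CharZero 𝕜] {p q : FreeMod 𝕜 Letter Gen} (h : ExtraRel 𝕜 p q) :
    toFreeA 𝕜 (p - q) ∈ Submodule.span (A 𝕜) (toFreeA 𝕜 '' defRels 𝕜) := by
  obtain ⟨M, _, _, π, ρ, h1, h2⟩ : ∃ (M : Type w) (_ : AddCommGroup M) (_ : Module 𝕜 M)
      (π : (Gen →₀ A 𝕜) →ₗ[𝕜] M) (ρ : A 𝕜 →ₐ[𝕜] Module.End 𝕜 M),
      (∀ a f, π (a • f) = ρ a (π f)) ∧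
        ∀ f, π f = 0 ↔ f ∈ Submodule.span (A 𝕜) (toFreeA 𝕜 '' defRels 𝕜) :=
    exists_quotient (𝕜 := 𝕜) _
  rw [← h2, map_sub, map_sub, sub_eq_zero]
  -- What holds in every module with the defining relations holds in the quotient of the free module
  -- by them, where vanishing means membership in their span.
  refine h.map_eq (ρ := ρ.comp (toA 𝕜)) (E := π ∘ₗ toFreeA 𝕜) (fun p q h => ?_) (fun f m => ?_)
    fun p q h => ?_
  · exact congrArg ρ (RingQuot.mkAlgHom_rel 𝕜 h)
  · rw [LinearMap.comp_apply, toFreeA_smul, h1]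
    rfl
  · have h3 : π (toFreeA 𝕜 (p - q)) = 0 :=
      (h2 _).2 (Submodule.subset_span ⟨_, ⟨p, q, h, rfl⟩, rfl⟩)
    rwa [map_sub, map_sub, sub_eq_zero] at h3

theorem span_defRels_union_extraRels :
    Submodule.span (A 𝕜) (toFreeA 𝕜 '' (defRels 𝕜 ∪ extraRels 𝕜)) =
      Submodule.span (A 𝕜) (toFreeA 𝕜 '' defRels 𝕜) := by
  refine le_antisymm (Submodule.span_le.2 ?_)
    (Submodule.span_mono (Set.image_mono Set.subset_union_left))
  rintro _ ⟨t, ht | ⟨p, q, h, rfl⟩, rfl⟩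
  · exact Submodule.subset_span ⟨t, ht, rfl⟩
  · exact extraRel_mem_span h

end Span

end NeveuSchwartz

/-! ### Conformal superalgebras of polynomials in `∂` over a differential superalgebra. -/

namespace ConformalSuperalgebra

section Reduction

variable {𝕜 C : Type*} [Field 𝕜] [AddCommGroup C] [Module 𝕜 C] (S : ConformalSuperalgebra 𝕜 C)

/-- The associativity of a triple of elements. -/
def AssocTriple (x y z : C) : Prop :=
  ∀ n m : ℕ, S.prod n x (S.prod m y z) =
    ∑ s ∈ Finset.range (n + 1), (n.choose s : 𝕜) • S.prod (n + m - s) (S.prod s x y) z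

variable {S}

/-- With `AssocTriple.der_mid`, this reduces associativity for polynomials in `∂` to constant first
and second factors. The identity behind it is `(s + 1) C(n + 1, s + 1) = (n + 1) C(n, s)`. -/
theorem AssocTriple.der_left {x y z : C} (h : S.AssocTriple x y z) :
    S.AssocTriple (S.der x) y z := by
  intro n m
  rw [S.der_prod, h]
  rcases n with _ | n
  · simp [S.der_prod]
  rw [Finset.sum_range_succ' _ (n + 1)]
  simp only [S.der_prod, Nat.cast_zero, zero_smul, neg_zero, map_zero, LinearMap.zero_apply,
    smul_zero, add_zero, Nat.add_sub_cancel, map_neg, LinearMap.neg_apply, map_smul,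
    LinearMap.smul_apply, Finset.smul_sum, ← Finset.sum_neg_distrib]
  refine Finset.sum_congr rfl fun s _ => ?_
  rw [show n + 1 + m - (s + 1) = n + m - s by omega, smul_neg, smul_smul, smul_smul]
  congr 2
  have := Nat.add_one_mul_choose_eq n s
  rw [← Nat.cast_mul, ← Nat.cast_mul, ← this]

theorem AssocTriple.der_mid {x y z : C} (h : S.AssocTriple x y z) :
    S.AssocTriple x (S.der y) z := by
  intro n m
  rw [S.der_prod, map_neg, map_smul, h]
  simp only [S.prod_der, map_add, LinearMap.add_apply, S.der_prod, map_smul, LinearMap.smul_apply,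
    smul_add, Finset.sum_add_distrib, smul_neg]
  rw [Finset.sum_range_succ' (fun s => (n.choose s : 𝕜) • (s : 𝕜) •
    S.prod (n + m - s) (S.prod (s - 1) x y) z)]
  simp only [Nat.cast_zero, zero_smul, smul_zero, add_zero]
  have h2 : ∑ s ∈ Finset.range n, (n.choose (s + 1) : 𝕜) • ((s + 1 : ℕ) : 𝕜) •
      S.prod (n + m - (s + 1)) (S.prod (s + 1 - 1) x y) z =
      ∑ s ∈ Finset.range (n + 1), (n.choose (s + 1) : 𝕜) • ((s + 1 : ℕ) : 𝕜) •
      S.prod (n + m - (s + 1)) (S.prod (s + 1 - 1) x y) z := by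
    rw [Finset.sum_range_succ]; simp
  rw [h2, ← Finset.sum_add_distrib, Finset.smul_sum, ← Finset.sum_neg_distrib]
  refine Finset.sum_congr rfl fun s hs => ?_
  have hs : s ≤ n := by have := Finset.mem_range.1 hs; omega
  rw [Nat.add_sub_cancel, smul_smul, smul_smul, smul_smul, ← neg_smul, ← neg_smul]
  -- The truncated `m - 1` makes `m = 0` a separate case: there the coefficients cancel by `(s + 1)
  -- C(n, s + 1) = (n - s) C(n, s)`.
  rcases m with _ | m
  · rw [← Nat.sub_sub, ← add_smul]
    simp only [add_zero, Nat.cast_zero, zero_mul, neg_zero, zero_smul]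
    convert (zero_smul 𝕜 _).symm
    have := congrArg (Nat.cast (R := 𝕜)) (Nat.choose_succ_right_eq n s)
    push_cast [Nat.cast_sub hs] at this ⊢
    linear_combination this
  · rw [show n + (m + 1 - 1) - s = n + (m + 1) - (s + 1) by omega,
      show n + (m + 1) - s - 1 = n + (m + 1) - (s + 1) by omega, ← add_smul]
    congr 1
    have := congrArg (Nat.cast (R := 𝕜)) (Nat.choose_succ_right_eq n s)
    rw [Nat.cast_sub (by omega)]
    push_cast [Nat.cast_sub hs] at this ⊢
    linear_combination -this

end Reduction

section Differential

open Polynomial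

variable {𝕜 B : Type*} [Field 𝕜] [Ring B] [Algebra 𝕜 B] (δ : B →ₗ[𝕜] B)

theorem coeff_sum_monomial (f : B[X]) (n : ℕ) :
    (f.sum fun i b => monomial i (δ b)).coeff n = δ (f.coeff n) := by
  rw [Polynomial.sum, finsetSum_coeff]
  simp only [coeff_monomial]
  rw [Finset.sum_ite_eq']
  split_ifs with h
  · rfl
  · rw [notMem_support_iff.1 h, map_zero]

/-- The coefficientwise extension of a linear map to polynomials. -/
noncomputable def mapCoeff : B[X] →ₗ[𝕜] B[X] where
  toFun f := f.sum fun i b => monomial i (δ b)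
  map_add' f g := by ext n; simp only [coeff_add, coeff_sum_monomial, map_add]
  map_smul' c f := by
    ext n; simp only [coeff_smul, coeff_sum_monomial, map_smul, RingHom.id_apply]

theorem coeff_mapCoeff (f : B[X]) (n : ℕ) : (mapCoeff δ f).coeff n = δ (f.coeff n) :=
  coeff_sum_monomial δ f n

theorem mapCoeff_monomial (i : ℕ) (b : B) : mapCoeff δ (monomial i b) = monomial i (δ b) := by
  ext n
  rw [coeff_mapCoeff, coeff_monomial, coeff_monomial]
  split_ifs <;> simp

/-- `d/d∂ + δ`. -/
noncomputable def totalDer : B[X] →ₗ[𝕜] B[X] :=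
  (derivative : B[X] →ₗ[B] B[X]).restrictScalars 𝕜 + mapCoeff δ

theorem totalDer_monomial (i : ℕ) (b : B) :
    totalDer δ (monomial i b) = monomial (i - 1) (b * i) + monomial i (δ b) := by
  rw [totalDer, LinearMap.add_apply, mapCoeff_monomial, LinearMap.restrictScalars_apply,
    derivative_monomial]

theorem totalDer_C (b : B) : totalDer δ (C b) = C (δ b) := by
  rw [← monomial_zero_left, totalDer_monomial]; simp

theorem totalDer_pow_C (n : ℕ) (b : B) : (totalDer δ ^ n) (C b) = C ((δ ^ n) b) := by
  induction n with
  | zero => rfl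
  | succ n ih => rw [pow_succ', pow_succ', Module.End.mul_apply, ih, totalDer_C]; rfl

theorem totalDer_X_mul (f : B[X]) : totalDer δ (X * f) = f + X * totalDer δ f := by
  induction f using Polynomial.induction_on' with
  | add p q hp hq => rw [mul_add, map_add, hp, hq, map_add, mul_add]; abel
  | monomial n a =>
    rw [X_mul_monomial, totalDer_monomial, totalDer_monomial, mul_add, X_mul_monomial,
      X_mul_monomial, ← add_assoc]
    congr 1
    rcases n with _ | n
    · simp
    · rw [Nat.add_sub_cancel, Nat.add_sub_cancel, ← map_add]
      push_cast
      congr 1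
      noncomm_ring

theorem totalDer_pow_X_mul (n : ℕ) (f : B[X]) :
    (totalDer δ ^ n) (X * f) = X * (totalDer δ ^ n) f + (n : 𝕜) • (totalDer δ ^ (n - 1)) f := by
  induction n with
  | zero => simp
  | succ n ih =>
    rw [pow_succ', Module.End.mul_apply, ih, map_add, totalDer_X_mul, map_smul,
      Nat.add_sub_cancel, Module.End.mul_apply]
    rcases n with _ | n
    · simp; abel
    · rw [Nat.add_sub_cancel, ← Module.End.mul_apply (totalDer δ) (totalDer δ ^ n), ← pow_succ']
      push_cast
      module

theorem totalDer_C_mul (hδ : ∀ a b, δ (a * b) = δ a * b + a * δ b) (a : B) (f : B[X]) :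
    totalDer δ (C a * f) = C (δ a) * f + C a * totalDer δ f := by
  induction f using Polynomial.induction_on' with
  | add p q hp hq => rw [mul_add, map_add, hp, hq, map_add, mul_add, mul_add]; abel
  | monomial n b =>
    rw [C_mul_monomial, totalDer_monomial, totalDer_monomial, mul_add, C_mul_monomial,
      C_mul_monomial, C_mul_monomial, hδ, map_add, mul_assoc]
    abel

theorem totalDer_pow_C_mul (hδ : ∀ a b, δ (a * b) = δ a * b + a * δ b) (n : ℕ) (a : B) (f : B[X]) :
    (totalDer δ ^ n) (C a * f) = ∑ ij ∈ Finset.HasAntidiagonal.antidiagonal n,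
      n.choose ij.1 • (C ((δ ^ ij.1) a) * (totalDer δ ^ ij.2) f) := by
  induction n generalizing f with
  | zero => simp
  | succ n ih =>
    rw [pow_succ', Module.End.mul_apply, ih, map_sum, Finset.sum_antidiagonal_choose_succ_nsmul
      (fun i j => C ((δ ^ i) a) * (totalDer δ ^ j) f), ← Finset.sum_add_distrib]
    refine Finset.sum_congr rfl fun ij hij => ?_
    obtain ⟨i, j⟩ := ij
    rw [← Finset.HasAntidiagonal.mem_antidiagonal.1 hij]
    simp only
    rw [← Nat.choose_symm_add (a := i) (b := j), ← smul_add, map_nsmul, totalDer_C_mul δ hδ,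
      pow_succ', pow_succ', Module.End.mul_apply, Module.End.mul_apply,
      add_comm (C (δ _) * _)]

/-- This gives locality. Since `totalDer δ` commutes with multiplication by `X` up to the identity,
each factor `X` delays nilpotency by at most one step. -/
theorem exists_totalDer_pow_eq_zero (hn : ∀ b, ∃ k, (δ ^ k) b = 0) (f : B[X]) :
    ∃ K, ∀ k, K ≤ k → (totalDer δ ^ k) f = 0 := by
  induction f using Polynomial.induction_on' with
  | add p q hp hq =>
    obtain ⟨K, hK⟩ := hp
    obtain ⟨K', hK'⟩ := hq
    exact ⟨K + K', fun k hk => by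
      rw [map_add, hK k (by omega), hK' k (by omega), add_zero]⟩
  | monomial n b =>
    induction n with
    | zero =>
      obtain ⟨K, hK⟩ := hn b
      refine ⟨K, fun k hk => ?_⟩
      obtain ⟨j, rfl⟩ := Nat.exists_eq_add_of_le' hk
      rw [monomial_zero_left, totalDer_pow_C, pow_add, Module.End.mul_apply, hK, map_zero, map_zero]
    | succ n ih =>
      obtain ⟨K, hK⟩ := ih
      refine ⟨K + 1, fun k hk => ?_⟩
      rw [← X_mul_monomial, totalDer_pow_X_mul, hK k (by omega), hK (k - 1) (by omega), mul_zero,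
        smul_zero, add_zero]

/-- The `n`-th product on polynomials in `∂` over a differential algebra. -/
noncomputable def diffProd (n : ℕ) : B[X] →ₗ[𝕜] B[X] →ₗ[𝕜] B[X] :=
  LinearMap.mk₂ 𝕜 (fun f g => ∑ i ∈ Finset.range (n + 1),
      ((-1 : 𝕜) ^ i * n.descFactorial i) • (C (f.coeff i) * (totalDer δ ^ (n - i)) g))
    (by intros; simp [add_mul, Finset.sum_add_distrib])
    (by
      intro c f g
      rw [Finset.smul_sum]
      refine Finset.sum_congr rfl fun i _ => ?_
      rw [coeff_smul, ← smul_C, smul_mul_assoc, smul_comm])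
    (by intros; simp [mul_add, Finset.sum_add_distrib])
    (by
      intro c f g
      rw [Finset.smul_sum]
      refine Finset.sum_congr rfl fun i _ => ?_
      rw [map_smul, mul_smul_comm, smul_comm])

theorem diffProd_apply (n : ℕ) (f g : B[X]) : diffProd δ n f g = ∑ i ∈ Finset.range (n + 1),
    ((-1 : 𝕜) ^ i * n.descFactorial i) • (C (f.coeff i) * (totalDer δ ^ (n - i)) g) := rfl

theorem diffProd_C (n : ℕ) (a : B) (g : B[X]) :
    diffProd δ n (C a) g = C a * (totalDer δ ^ n) g := by
  rw [diffProd_apply, Finset.sum_eq_single 0]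
  · simp
  · intro i _ hi
    rw [coeff_C_of_ne_zero hi, map_zero, zero_mul, smul_zero]
  · simp

theorem diffProd_X_mul_left (n : ℕ) (f g : B[X]) :
    diffProd δ n (X * f) g = -((n : 𝕜) • diffProd δ (n - 1) f g) := by
  rw [diffProd_apply, Finset.sum_range_succ']
  simp only [coeff_X_mul, mul_coeff_zero, coeff_X_zero, zero_mul, map_zero, smul_zero, add_zero]
  rcases n with _ | n
  · simp
  rw [Nat.add_sub_cancel, diffProd_apply, Finset.smul_sum, ← Finset.sum_neg_distrib]
  refine Finset.sum_congr rfl fun i _ => ?_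
  rw [smul_smul, ← neg_smul, Nat.succ_descFactorial_succ, Nat.add_sub_add_right]
  congr 1
  push_cast
  ring

theorem diffProd_X_mul_right (n : ℕ) (f g : B[X]) : diffProd δ n f (X * g) =
    X * diffProd δ n f g + (n : 𝕜) • diffProd δ (n - 1) f g := by
  -- The shorter sum is extended to the range of the longer one; the added term `i = n` has weight
  -- `n - i = 0`.
  have h : (n : 𝕜) • diffProd δ (n - 1) f g = ∑ i ∈ Finset.range (n + 1),
      ((-1 : 𝕜) ^ i * n.descFactorial i * (n - i : ℕ)) •
        (C (f.coeff i) * (totalDer δ ^ (n - 1 - i)) g) := by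
    rw [Finset.sum_range_succ]
    rcases n with _ | n
    · simp
    rw [Nat.sub_self, Nat.cast_zero, mul_zero, zero_smul, add_zero, diffProd_apply,
      Nat.add_sub_cancel, Finset.smul_sum]
    refine Finset.sum_congr rfl fun i _ => ?_
    rw [smul_smul]
    congr 1
    have := congrArg (Nat.cast (R := 𝕜)) (Nat.succ_descFactorial_succ n i)
    rw [Nat.descFactorial_succ] at this
    push_cast at this ⊢
    linear_combination -(-1) ^ i * this
  rw [h, diffProd_apply, diffProd_apply, Finset.mul_sum, ← Finset.sum_add_distrib]
  refine Finset.sum_congr rfl fun i _ => ?_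
  rw [totalDer_pow_X_mul, mul_add, smul_add, mul_smul_comm, smul_smul, mul_smul_comm,
    ← mul_assoc, ← mul_assoc, X_mul, Nat.sub_right_comm]

variable (Bg : ZMod 2 → Submodule 𝕜 B)

/-- The polynomials with homogeneous coefficients. -/
noncomputable def polyGrade (i : ZMod 2) : Submodule 𝕜 B[X] where
  carrier := {f | ∀ n, f.coeff n ∈ Bg i}
  add_mem' hf hg n := by rw [coeff_add]; exact add_mem (hf n) (hg n)
  zero_mem' n := by rw [coeff_zero]; exact zero_mem _
  smul_mem' c f hf n := by rw [coeff_smul]; exact Submodule.smul_mem _ _ (hf n)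

variable {Bg}

theorem monomial_mem_polyGrade {i : ZMod 2} {b : B} (hb : b ∈ Bg i) (n : ℕ) :
    monomial n b ∈ polyGrade Bg i := by
  intro m
  rw [coeff_monomial]
  split_ifs
  · exact hb
  · exact zero_mem _

theorem X_mul_mem_polyGrade {i : ZMod 2} {f : B[X]} (hf : f ∈ polyGrade Bg i) :
    X * f ∈ polyGrade Bg i := by
  intro n
  rcases n with _ | n
  · simp
  · rw [coeff_X_mul]; exact hf n

theorem C_mul_mem_polyGrade (hm : ∀ i j, ∀ x ∈ Bg i, ∀ y ∈ Bg j, x * y ∈ Bg (i + j)) {i j : ZMod 2}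
    {b : B} (hb : b ∈ Bg i) {f : B[X]} (hf : f ∈ polyGrade Bg j) : C b * f ∈ polyGrade Bg (i + j) := by
  intro n
  rw [coeff_C_mul]
  exact hm _ _ _ hb _ (hf n)

theorem totalDer_mem_polyGrade (hd : ∀ i, ∀ x ∈ Bg i, δ x ∈ Bg i) {i : ZMod 2} {f : B[X]}
    (hf : f ∈ polyGrade Bg i) : totalDer δ f ∈ polyGrade Bg i := by
  rw [f.as_sum_support, map_sum]
  refine sum_mem fun n _ => ?_
  rw [totalDer_monomial]
  refine add_mem (monomial_mem_polyGrade ?_ _) (monomial_mem_polyGrade (hd _ _ (hf n)) _)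
  rw [← nsmul_eq_mul', ← Nat.cast_smul_eq_nsmul 𝕜]
  exact Submodule.smul_mem _ _ (hf n)

end Differential
end ConformalSuperalgebra

namespace ConformalSuperalgebra

section DifferentialAlgebra

open Polynomial

variable {𝕜 B : Type*} [Field 𝕜] [Ring B] [Algebra 𝕜 B]

/-- The conformal superalgebra of polynomials in `∂` over a superalgebra with a locally nilpotent
even derivation. -/
noncomputable def ofDerivation (δ : B →ₗ[𝕜] B) (hn : ∀ b, ∃ k, (δ ^ k) b = 0)
    (Bg : ZMod 2 → Submodule 𝕜 B) (hB : IsCompl (Bg 0) (Bg 1))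
    (hm : ∀ i j, ∀ x ∈ Bg i, ∀ y ∈ Bg j, x * y ∈ Bg (i + j))
    (hd : ∀ i, ∀ x ∈ Bg i, δ x ∈ Bg i) : ConformalSuperalgebra 𝕜 B[X] where
  der := LinearMap.mulLeft 𝕜 X
  prod := diffProd δ
  grade := polyGrade Bg
  isCompl_grade := by
    rw [isCompl_iff, Submodule.disjoint_def, codisjoint_iff_le_sup]
    refine ⟨fun f h0 h1 => ?_, fun f _ => ?_⟩
    · ext1 n
      exact (Submodule.disjoint_def.1 hB.1) _ (h0 n) (h1 n)
    · rw [f.as_sum_support]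
      refine sum_mem fun n _ => ?_
      have h : f.coeff n ∈ Bg 0 ⊔ Bg 1 := by rw [hB.sup_eq_top]; trivial
      obtain ⟨b, hb, c, hc, hbc⟩ := Submodule.mem_sup.1 h
      rw [← hbc, map_add]
      exact Submodule.add_mem_sup (monomial_mem_polyGrade hb n) (monomial_mem_polyGrade hc n)
  der_mem _ _ hf := X_mul_mem_polyGrade hf
  prod_mem n i j f hf g hg := by
    rw [diffProd_apply]
    refine sum_mem fun k _ => Submodule.smul_mem _ _ (C_mul_mem_polyGrade hm (hf k) ?_)
    generalize n - k = p
    induction p with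
    | zero => exact hg
    | succ p ih =>
      rw [pow_succ', Module.End.mul_apply]
      exact totalDer_mem_polyGrade δ hd ih
  locality f g := by
    obtain ⟨K, hK⟩ := exists_totalDer_pow_eq_zero δ hn g
    refine ⟨f.natDegree + K, fun n hN => ?_⟩
    rw [diffProd_apply]
    refine Finset.sum_eq_zero fun i _ => ?_
    by_cases hi : f.natDegree < i
    · rw [coeff_eq_zero_of_natDegree_lt hi, map_zero, zero_mul, smul_zero]
    · rw [hK _ (by omega), mul_zero, smul_zero]
  der_prod n f g := diffProd_X_mul_left δ n f g
  prod_der n f g := diffProd_X_mul_right δ n f g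

/-- For constant `x` and `y`, associativity is the Leibniz rule for `totalDer δ ^ n` applied to a
constant times `totalDer δ ^ m z`. General `x` and `y` follow by linearity and multiplication by
`∂`. -/
theorem isAssociative_ofDerivation {δ : B →ₗ[𝕜] B} (hn : ∀ b, ∃ k, (δ ^ k) b = 0)
    {Bg : ZMod 2 → Submodule 𝕜 B} (hB : IsCompl (Bg 0) (Bg 1))
    (hm : ∀ i j, ∀ x ∈ Bg i, ∀ y ∈ Bg j, x * y ∈ Bg (i + j))
    (hd : ∀ i, ∀ x ∈ Bg i, δ x ∈ Bg i) (hδ : ∀ a b, δ (a * b) = δ a * b + a * δ b) :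
    (ofDerivation δ hn Bg hB hm hd).IsAssociative := by
  suffices h : ∀ x y z, (ofDerivation δ hn Bg hB hm hd).AssocTriple x y z from
    fun n m x y z => h x y z n m
  intro x y z
  induction x using Polynomial.induction_on' with
  | add p q hp hq =>
    intro n m
    rw [map_add, LinearMap.add_apply, hp, hq, ← Finset.sum_add_distrib]
    simp only [map_add, LinearMap.add_apply, smul_add]
  | monomial k a =>
    induction k with
    | succ k ih => rw [← X_mul_monomial]; exact ih.der_left
    | zero =>
      induction y using Polynomial.induction_on' with
      | add p q hp hq =>
        intro n m
        simp only [map_add, LinearMap.add_apply, smul_add, Finset.sum_add_distrib]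
        rw [hp, hq]
      | monomial k b =>
        induction k with
        | succ k ih => rw [← X_mul_monomial]; exact ih.der_mid
        | zero =>
          intro n m
          change diffProd δ n _ (diffProd δ m _ z) =
            ∑ s ∈ _, _ • diffProd δ (n + m - s) (diffProd δ s _ _) z
          rw [monomial_zero_left, monomial_zero_left, diffProd_C, diffProd_C,
            totalDer_pow_C_mul δ hδ, Finset.mul_sum,
            Finset.Nat.sum_antidiagonal_eq_sum_range_succ
              (fun i j => C a * n.choose i • (C ((δ ^ i) b) * (totalDer δ ^ j)
                ((totalDer δ ^ m) z)))]
          refine Finset.sum_congr rfl fun s hs => ?_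
          have hs : s ≤ n := by have := Finset.mem_range.1 hs; omega
          rw [diffProd_C, totalDer_pow_C, ← C_mul, diffProd_C, ← Module.End.mul_apply, ← pow_add,
            show n - s + m = n + m - s by omega, Nat.cast_smul_eq_nsmul, C_mul, mul_smul_comm,
            mul_assoc]

end DifferentialAlgebra

end ConformalSuperalgebra

/-! ### Checking the axioms of an envelope on the generators of `K₁`. -/

namespace NeveuSchwartz
open GS ConformalSuperalgebra Polynomial

section Lift

variable {𝕜 C : Type*} [Field 𝕜] [AddCommGroup C] [Module 𝕜 C]

/-- The `𝕜[∂]`-linear map on `K₁` with given values on `v`, `g`. -/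
noncomputable def K1.lift (D : Module.End 𝕜 C) (x : Gen → C) : K1 𝕜 →ₗ[𝕜] C :=
  ∑ a, (aeval D).toLinearMap.flip (x a) ∘ₗ LinearMap.proj a

theorem K1.lift_gen (D : Module.End 𝕜 C) (x : Gen → C) (a : Gen) :
    K1.lift D x (K1.gen 𝕜 a) = x a := by
  cases a <;> simp [K1.lift, sum_gen, K1.gen]

theorem K1.lift_der (D : Module.End 𝕜 C) (x : Gen → C) (y : K1 𝕜) :
    K1.lift D x (der 𝕜 y) = D (K1.lift D x y) := by
  simp [K1.lift, sum_gen, der_apply]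

theorem exists_single_of_mem_grade {i : ZMod 2} {x : K1 𝕜} (hx : x ∈ grade 𝕜 i) :
    ∃ a : Gen, a.parity = i ∧ ∃ p, x = Pi.single a p := by
  rw [mem_grade] at hx
  have h2 : ∀ k : ZMod 2, k = 0 ∨ k = 1 := by decide
  rcases h2 i with rfl | rfl
  · refine ⟨.v, rfl, x .v, ?_⟩
    funext b; cases b
    · simp
    · simpa using hx
  · refine ⟨.g, rfl, x .g, ?_⟩
    funext b; cases b
    · simpa using hx
    · simp

/-- It suffices to check the properties of an envelope on the generators of `K₁`. -/
theorem isPreEnvelope_of_gen [CharZero 𝕜] {S : ConformalSuperalgebra 𝕜 C} {φ : K1 𝕜 →ₗ[𝕜] C}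
    (hS : S.IsAssociative)
    (hd : ∀ x, φ (der 𝕜 x) = S.der (φ x)) (hg : ∀ a, φ (K1.gen 𝕜 a) ∈ S.grade a.parity)
    (hb : ∀ n a b, φ (bracket n (K1.gen 𝕜 a) (K1.gen 𝕜 b)) =
      S.superComm a.parity b.parity n (φ (K1.gen 𝕜 a)) (φ (K1.gen 𝕜 b)))
    (hN : ∀ a b n, N a b ≤ n → S.prod n (φ (K1.gen 𝕜 a)) (φ (K1.gen 𝕜 b)) = 0) :
    IsPreEnvelope (K1.alg 𝕜) (K1.gen 𝕜) N S φ where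
  assoc := hS
  map_der := hd
  map_grade i x hx := by
    obtain ⟨a, rfl, p, rfl⟩ := exists_single_of_mem_grade hx
    exact K1.single_mem (q := (S.grade a.parity).comap φ) (hg a)
      (fun x hx => by rw [Submodule.mem_comap, hd]; exact S.der_mem _ _ hx) p
  bounded := hN
  map_bracket n i j x hx y hy := by
    obtain ⟨a, rfl, p, rfl⟩ := exists_single_of_mem_grade hx
    obtain ⟨b, rfl, q, rfl⟩ := exists_single_of_mem_grade hy
    change φ (bracket n _ _) = _
    set ε : 𝕜 := (-1) ^ (a.parity.val * b.parity.val) with hε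
    have hsc : ∀ n x y, S.superComm a.parity b.parity n x y = S.prod n x y - ε • S.curly n y x :=
      fun _ _ _ => rfl
    have hder : ∀ n x y, bracket n (der 𝕜 x) y = -((n : 𝕜) • bracket (n - 1) x y) :=
      (K1.alg 𝕜).der_prod
    have hder' : ∀ n x y, bracket n x (der 𝕜 y) =
      der 𝕜 (bracket n x y) + (n : 𝕜) • bracket (n - 1) x y := (K1.alg 𝕜).prod_der
    have h1 : ∀ n, φ (bracket n (Pi.single a p) (K1.gen 𝕜 b)) =
        S.superComm a.parity b.parity n (φ (Pi.single a p)) (φ (K1.gen 𝕜 b)) := by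
      -- The condition is imposed for all `n` at once: a derivative lowers `n` by one, so the
      -- condition for a single `n` would not be `∂`-stable.
      have := K1.single_mem (a := a) (q := ⨅ n, LinearMap.eqLocus
        (φ ∘ₗ (bracket n).flip (K1.gen 𝕜 b))
        (((S.prod n).flip (φ (K1.gen 𝕜 b)) - ε • S.curlyLeft n (φ (K1.gen 𝕜 b))) ∘ₗ φ))
        ((Submodule.mem_iInf _).2 fun n => by
          simpa [LinearMap.mem_eqLocus, curlyLeft_apply, hsc] using hb n a b)
        (fun x hx => (Submodule.mem_iInf _).2 fun n => by
          have hx := (Submodule.mem_iInf _).1 hx (n - 1)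
          simp only [LinearMap.mem_eqLocus, LinearMap.comp_apply, LinearMap.flip_apply,
            LinearMap.sub_apply, LinearMap.smul_apply, curlyLeft_apply] at hx ⊢
          rw [hder, hd, S.der_prod, curly_der_right, map_neg, map_smul, hx]
          module) p
      intro n
      have := (Submodule.mem_iInf _).1 this n
      simpa [LinearMap.mem_eqLocus, curlyLeft_apply, hsc] using this
    have := K1.single_mem (a := b) (q := ⨅ n, LinearMap.eqLocus
        (φ ∘ₗ bracket n (Pi.single a p))
        ((S.prod n (φ (Pi.single a p)) - ε • S.curlyRight n (φ (Pi.single a p))) ∘ₗ φ))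
        ((Submodule.mem_iInf _).2 fun n => by
          simpa [LinearMap.mem_eqLocus, curlyRight_apply, hsc] using h1 n)
        (fun x hx => (Submodule.mem_iInf _).2 fun n => by
          have hx1 := (Submodule.mem_iInf _).1 hx (n - 1)
          have hx := (Submodule.mem_iInf _).1 hx n
          simp only [LinearMap.mem_eqLocus, LinearMap.comp_apply,
            LinearMap.sub_apply, LinearMap.smul_apply, curlyRight_apply] at hx hx1 ⊢
          rw [hder', hd, S.prod_der, curly_der_left, map_add, map_smul, hx1, hd, hx, map_sub,
            map_smul]
          module) q
    have := (Submodule.mem_iInf _).1 this n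
    simpa [LinearMap.mem_eqLocus, curlyRight_apply, hsc] using this

end Lift

end NeveuSchwartz

/-! ### The model of the envelope in `Cend_{1|1}`. -/

namespace NeveuSchwartz
open GS ConformalSuperalgebra Polynomial

section Model

variable {𝕜 : Type*} [Field 𝕜]

/-- Matrices over `𝕜[x]`. -/
abbrev Mat (𝕜 : Type*) [Field 𝕜] := Matrix (Fin 2) (Fin 2) 𝕜[X]

/-- The entrywise derivative. -/
noncomputable def matDer (𝕜 : Type*) [Field 𝕜] : Mat 𝕜 →ₗ[𝕜] Mat 𝕜 :=
  LinearMap.mapMatrix (derivative : 𝕜[X] →ₗ[𝕜] 𝕜[X])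

theorem matDer_apply (M : Mat 𝕜) (i j : Fin 2) : matDer 𝕜 M i j = derivative (M i j) := rfl

theorem matDer_mul (M M' : Mat 𝕜) : matDer 𝕜 (M * M') = matDer 𝕜 M * M' + M * matDer 𝕜 M' := by
  ext1 i j
  simp only [Matrix.add_apply, matDer_apply, Matrix.mul_apply, Fin.sum_univ_two, derivative_add,
    derivative_mul]
  ring

theorem matDer_pow_apply (n : ℕ) (M : Mat 𝕜) (i j : Fin 2) :
    (matDer 𝕜 ^ n) M i j = derivative^[n] (M i j) := by
  induction n with
  | zero => rfl
  | succ n ih =>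
    rw [pow_succ', Module.End.mul_apply, matDer_apply, ih, Function.iterate_succ_apply']

theorem exists_matDer_pow_eq_zero (M : Mat 𝕜) : ∃ k, (matDer 𝕜 ^ k) M = 0 := by
  refine ⟨(∑ i, ∑ j, (M i j).natDegree) + 1, ?_⟩
  ext1 i j
  rw [matDer_pow_apply, Matrix.zero_apply]
  refine iterate_derivative_eq_zero (Nat.lt_succ_of_le ?_)
  exact (Finset.single_le_sum (f := fun j => (M i j).natDegree) (fun _ _ => Nat.zero_le _)
    (Finset.mem_univ j)).trans (Finset.single_le_sum (f := fun i => ∑ j, (M i j).natDegree)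
      (fun _ _ => Nat.zero_le _) (Finset.mem_univ i))

/-- Diagonal matrices are even, antidiagonal matrices are odd. -/
noncomputable def matGrade (𝕜 : Type*) [Field 𝕜] (i : ZMod 2) : Submodule 𝕜 (Mat 𝕜) where
  carrier := {M | if i = 0 then M 0 1 = 0 ∧ M 1 0 = 0 else M 0 0 = 0 ∧ M 1 1 = 0}
  add_mem' := by
    intro M M' h h'
    split_ifs at h h' ⊢ with hi <;> simp_all
  zero_mem' := by simp
  smul_mem' := by
    intro c M h
    split_ifs at h ⊢ with hi <;> simp_all

theorem mem_matGrade_zero {M : Mat 𝕜} : M ∈ matGrade 𝕜 0 ↔ M 0 1 = 0 ∧ M 1 0 = 0 := Iff.rfl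

theorem mem_matGrade_one {M : Mat 𝕜} : M ∈ matGrade 𝕜 1 ↔ M 0 0 = 0 ∧ M 1 1 = 0 := Iff.rfl

theorem isCompl_matGrade : IsCompl (matGrade 𝕜 0) (matGrade 𝕜 1) := by
  rw [isCompl_iff, Submodule.disjoint_def, codisjoint_iff_le_sup]
  refine ⟨fun M h0 h1 => ?_, fun M _ => ?_⟩
  · rw [mem_matGrade_zero] at h0
    rw [mem_matGrade_one] at h1
    ext1 i j
    fin_cases i <;> fin_cases j <;> simp [h0, h1]
  · refine Submodule.mem_sup.2 ⟨!![M 0 0, 0; 0, M 1 1], ?_, !![0, M 0 1; M 1 0, 0], ?_, ?_⟩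
    · rw [mem_matGrade_zero]; simp
    · rw [mem_matGrade_one]; simp
    · ext1 i j
      fin_cases i <;> fin_cases j <;> simp

theorem mul_mem_matGrade (i j : ZMod 2) (M : Mat 𝕜) (hM : M ∈ matGrade 𝕜 i) (M' : Mat 𝕜)
    (hM' : M' ∈ matGrade 𝕜 j) : M * M' ∈ matGrade 𝕜 (i + j) := by
  have h2 : ∀ k : ZMod 2, k = 0 ∨ k = 1 := by decide
  have h11 : (1 + 1 : ZMod 2) = 0 := by decide
  rcases h2 i with rfl | rfl <;> rcases h2 j with rfl | rfl <;>
    simp only [h11, add_zero, zero_add, mem_matGrade_zero, mem_matGrade_one] at hM hM' ⊢ <;>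
    simp [Matrix.mul_apply, Fin.sum_univ_two, hM, hM']

theorem matDer_mem_matGrade (i : ZMod 2) (M : Mat 𝕜) (hM : M ∈ matGrade 𝕜 i) :
    matDer 𝕜 M ∈ matGrade 𝕜 i := by
  have h2 : ∀ k : ZMod 2, k = 0 ∨ k = 1 := by decide
  rcases h2 i with rfl | rfl <;> simp only [mem_matGrade_zero, mem_matGrade_one] at hM ⊢ <;>
    simp [matDer_apply, hM]

/-- The conformal superalgebra `Cend_{1|1}`. -/
noncomputable def model (𝕜 : Type*) [Field 𝕜] : ConformalSuperalgebra 𝕜 (Mat 𝕜)[X] :=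
  ofDerivation (matDer 𝕜) exists_matDer_pow_eq_zero (matGrade 𝕜) isCompl_matGrade mul_mem_matGrade
    matDer_mem_matGrade

theorem isAssociative_model : (model 𝕜).IsAssociative :=
  isAssociative_ofDerivation exists_matDer_pow_eq_zero isCompl_matGrade mul_mem_matGrade
    matDer_mem_matGrade matDer_mul

/-- `x`. -/
noncomputable def matX (𝕜 : Type*) [Field 𝕜] : Mat 𝕜 := !![X, 0; 0, X]

/-- The coefficient of `∂` in the image of `v`. -/
noncomputable def matE (𝕜 : Type*) [Field 𝕜] : Mat 𝕜 := !![0, 0; 0, (-1 / 2 : 𝕜) • 1]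

/-- The image of `g`. -/
noncomputable def matG (𝕜 : Type*) [Field 𝕜] : Mat 𝕜 := !![0, (-1 / 4 : 𝕜) • X; 1, 0]

/-- The images of `v` and `g` in `Cend_{1|1}`. -/
noncomputable def modelGen (𝕜 : Type*) [Field 𝕜] : Gen → (Mat 𝕜)[X]
  | .v => C (matX 𝕜) + X * C (matE 𝕜)
  | .g => C (matG 𝕜)

/-- The derivative of the image of `v`. -/
noncomputable def matV' (𝕜 : Type*) [Field 𝕜] : Mat 𝕜 := !![1, 0; 0, (1 / 2 : 𝕜) • 1]

/-- The derivative of the image of `g`. -/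
noncomputable def matG' (𝕜 : Type*) [Field 𝕜] : Mat 𝕜 := !![0, (-1 / 4 : 𝕜) • 1; 0, 0]

theorem totalDer_v [CharZero 𝕜] : totalDer (matDer 𝕜) (modelGen 𝕜 .v) = C (matV' 𝕜) := by
  have h : matDer 𝕜 (matE 𝕜) = 0 := by
    ext1 i j
    fin_cases i <;> fin_cases j <;> simp [matDer_apply, matE]
  rw [modelGen, map_add, totalDer_C, totalDer_X_mul, totalDer_C, h, map_zero, mul_zero, add_zero,
    ← map_add]
  congr 1
  ext1 i j
  fin_cases i <;> fin_cases j <;> simp [matDer_apply, matE, matX, matV']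
  rw [← sub_eq_zero]
  match_scalars
  norm_num

theorem totalDer_g : totalDer (matDer 𝕜) (modelGen 𝕜 .g) = C (matG' 𝕜) := by
  rw [modelGen, totalDer_C]
  congr 1
  ext1 i j
  fin_cases i <;> fin_cases j <;> simp [matDer_apply, matG, matG']

theorem totalDer_C_matV' : totalDer (matDer 𝕜) (C (matV' 𝕜)) = 0 := by
  rw [totalDer_C, ← C_0]
  congr 1
  ext1 i j
  fin_cases i <;> fin_cases j <;> simp [matDer_apply, matV']

theorem totalDer_C_matG' : totalDer (matDer 𝕜) (C (matG' 𝕜)) = 0 := by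
  rw [totalDer_C, ← C_0]
  congr 1
  ext1 i j
  fin_cases i <;> fin_cases j <;> simp [matDer_apply, matG']

theorem totalDer_pow_two_gen [CharZero 𝕜] (a : Gen) (n : ℕ) (hn : 2 ≤ n) :
    (totalDer (matDer 𝕜) ^ n) (modelGen 𝕜 a) = 0 := by
  obtain ⟨n, rfl⟩ := Nat.exists_eq_add_of_le' hn
  rw [pow_add, pow_two, Module.End.mul_apply, Module.End.mul_apply]
  cases a
  · rw [totalDer_v, totalDer_C_matV', map_zero]
  · rw [totalDer_g, totalDer_C_matG', map_zero]

theorem model_prod_v (n : ℕ) (f : (Mat 𝕜)[X]) : (model 𝕜).prod n (modelGen 𝕜 .v) f =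
    C (matX 𝕜) * (totalDer (matDer 𝕜) ^ n) f -
      (n : 𝕜) • (C (matE 𝕜) * (totalDer (matDer 𝕜) ^ (n - 1)) f) := by
  change diffProd (matDer 𝕜) n _ f = _
  rw [modelGen, map_add, LinearMap.add_apply, diffProd_C, diffProd_X_mul_left, diffProd_C,
    sub_eq_add_neg]

theorem model_prod_g (n : ℕ) (f : (Mat 𝕜)[X]) : (model 𝕜).prod n (modelGen 𝕜 .g) f =
    C (matG 𝕜) * (totalDer (matDer 𝕜) ^ n) f := diffProd_C _ _ _ _

/-- Polynomials over matrices as matrices over polynomials. -/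
noncomputable def entries (𝕜 : Type*) [Field 𝕜] : (Mat 𝕜)[X] →ₐ[𝕜[X]] Matrix (Fin 2) (Fin 2) 𝕜[X][X] :=
  matPolyEquiv.symm.toAlgHom

theorem entries_injective : Function.Injective (entries 𝕜) := matPolyEquiv.symm.injective

theorem entries_C (M : Mat 𝕜) : entries 𝕜 (C M) = M.map C := matPolyEquiv_symm_C M

theorem entries_X : entries 𝕜 X = Matrix.diagonal fun _ => X := matPolyEquiv_symm_X

theorem entries_smul (c : 𝕜) (f : (Mat 𝕜)[X]) : entries 𝕜 (c • f) = c • entries 𝕜 f := by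
  rw [← algebraMap_smul 𝕜[X] c f, map_smul, algebraMap_smul]

/-- Over the commutative ring `𝕜[x][∂]` the bracket identities can be checked entry by entry by
commutative algebra. -/
theorem eq_of_entries {f g : (Mat 𝕜)[X]} (h00 : entries 𝕜 f 0 0 = entries 𝕜 g 0 0)
    (h01 : entries 𝕜 f 0 1 = entries 𝕜 g 0 1) (h10 : entries 𝕜 f 1 0 = entries 𝕜 g 1 0)
    (h11 : entries 𝕜 f 1 1 = entries 𝕜 g 1 1) : f = g := by
  apply entries_injective
  ext1 i j
  fin_cases i <;> fin_cases j
  exacts [h00, h01, h10, h11]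

theorem entries_add_apply (f g : (Mat 𝕜)[X]) (i j : Fin 2) :
    entries 𝕜 (f + g) i j = entries 𝕜 f i j + entries 𝕜 g i j := by rw [map_add]; rfl

theorem entries_sub_apply (f g : (Mat 𝕜)[X]) (i j : Fin 2) :
    entries 𝕜 (f - g) i j = entries 𝕜 f i j - entries 𝕜 g i j := by rw [map_sub]; rfl

theorem entries_neg_apply (f : (Mat 𝕜)[X]) (i j : Fin 2) :
    entries 𝕜 (-f) i j = -entries 𝕜 f i j := by rw [map_neg]; rfl

theorem entries_smul_apply (c : 𝕜) (f : (Mat 𝕜)[X]) (i j : Fin 2) :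
    entries 𝕜 (c • f) i j = c • entries 𝕜 f i j := by rw [entries_smul]; rfl

theorem entries_mul_apply (f g : (Mat 𝕜)[X]) (i j : Fin 2) : entries 𝕜 (f * g) i j =
    entries 𝕜 f i 0 * entries 𝕜 g 0 j + entries 𝕜 f i 1 * entries 𝕜 g 1 j := by
  rw [map_mul, Matrix.mul_apply, Fin.sum_univ_two]

theorem entries_X_apply : entries 𝕜 X 0 0 = X ∧ entries 𝕜 X 0 1 = 0 ∧ entries 𝕜 X 1 0 = 0 ∧
    entries 𝕜 X 1 1 = X := by
  simp [entries_X]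

theorem entries_matX : entries 𝕜 (C (matX 𝕜)) 0 0 = C X ∧ entries 𝕜 (C (matX 𝕜)) 0 1 = 0 ∧
    entries 𝕜 (C (matX 𝕜)) 1 0 = 0 ∧ entries 𝕜 (C (matX 𝕜)) 1 1 = C X := by
  simp [entries_C, matX]

theorem entries_matE : entries 𝕜 (C (matE 𝕜)) 0 0 = 0 ∧ entries 𝕜 (C (matE 𝕜)) 0 1 = 0 ∧
    entries 𝕜 (C (matE 𝕜)) 1 0 = 0 ∧ entries 𝕜 (C (matE 𝕜)) 1 1 = (-1 / 2 : 𝕜) • 1 := by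
  simp [entries_C, matE, -smul_C, ← smul_C]

theorem entries_matG : entries 𝕜 (C (matG 𝕜)) 0 0 = 0 ∧
    entries 𝕜 (C (matG 𝕜)) 0 1 = (-1 / 4 : 𝕜) • C X ∧
    entries 𝕜 (C (matG 𝕜)) 1 0 = 1 ∧ entries 𝕜 (C (matG 𝕜)) 1 1 = 0 := by
  simp [entries_C, matG, -smul_C, ← smul_C]

theorem entries_matV' : entries 𝕜 (C (matV' 𝕜)) 0 0 = 1 ∧ entries 𝕜 (C (matV' 𝕜)) 0 1 = 0 ∧
    entries 𝕜 (C (matV' 𝕜)) 1 0 = 0 ∧ entries 𝕜 (C (matV' 𝕜)) 1 1 = (1 / 2 : 𝕜) • 1 := by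
  simp [entries_C, matV', -smul_C, ← smul_C]

theorem entries_matG' : entries 𝕜 (C (matG' 𝕜)) 0 0 = 0 ∧
    entries 𝕜 (C (matG' 𝕜)) 0 1 = (-1 / 4 : 𝕜) • 1 ∧
    entries 𝕜 (C (matG' 𝕜)) 1 0 = 0 ∧ entries 𝕜 (C (matG' 𝕜)) 1 1 = 0 := by
  simp [entries_C, matG', -smul_C, ← smul_C]

/-- The map from `K₁` to `Cend_{1|1}`. -/
noncomputable def modelMap (𝕜 : Type*) [Field 𝕜] : K1 𝕜 →ₗ[𝕜] (Mat 𝕜)[X] :=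
  K1.lift (model 𝕜).der (modelGen 𝕜)

theorem modelMap_gen (a : Gen) : modelMap 𝕜 (K1.gen 𝕜 a) = modelGen 𝕜 a := K1.lift_gen _ _ a

theorem modelMap_der (x : K1 𝕜) : modelMap 𝕜 (der 𝕜 x) = (model 𝕜).der (modelMap 𝕜 x) :=
  K1.lift_der _ _ x

/-- The square of the total derivative kills both images. Multiplication by `v` also involves the
power `n - 1`, which raises the bound for `v, v` to three; for `v, g` it stays two because `matE *
matG' = 0`. -/
theorem model_bounded [CharZero 𝕜] (a b : Gen) (n : ℕ) (hn : N a b ≤ n) :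
    (model 𝕜).prod n (modelGen 𝕜 a) (modelGen 𝕜 b) = 0 := by
  have h2 := (two_le_N a b).trans hn
  cases a
  · rw [model_prod_v, totalDer_pow_two_gen _ _ h2, mul_zero, zero_sub, neg_eq_zero]
    cases b
    · rw [totalDer_pow_two_gen _ _ (by simp [N] at hn; omega), mul_zero, smul_zero]
    · obtain ⟨n, rfl⟩ := Nat.exists_eq_add_of_le' h2
      have h : matE 𝕜 * matG' 𝕜 = 0 := by
        ext1 i j
        fin_cases i <;> fin_cases j <;> simp [matE, matG', Matrix.mul_apply, Fin.sum_univ_two]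
      rcases n with _ | n
      · rw [zero_add, show 2 - 1 = 1 from rfl, pow_one, totalDer_g, ← C_mul, h, map_zero, smul_zero]
      · rw [totalDer_pow_two_gen _ _ (by omega), mul_zero, smul_zero]
  · rw [model_prod_g, totalDer_pow_two_gen _ _ h2, mul_zero]

theorem model_vg1 : (model 𝕜).prod 1 (modelGen 𝕜 .v) (modelGen 𝕜 .g) =
    C (matX 𝕜) * C (matG' 𝕜) - C (matE 𝕜) * modelGen 𝕜 .g := by
  rw [model_prod_v, pow_one, totalDer_g]; simp

theorem model_gv0 : (model 𝕜).prod 0 (modelGen 𝕜 .g) (modelGen 𝕜 .v) =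
    C (matG 𝕜) * modelGen 𝕜 .v := by
  rw [model_prod_g]; simp

theorem model_gg0 : (model 𝕜).prod 0 (modelGen 𝕜 .g) (modelGen 𝕜 .g) =
    C (matG 𝕜) * modelGen 𝕜 .g := by
  rw [model_prod_g]; simp

theorem model_gg1 : (model 𝕜).prod 1 (modelGen 𝕜 .g) (modelGen 𝕜 .g) =
    C (matG 𝕜) * C (matG' 𝕜) := by
  rw [model_prod_g, pow_one, totalDer_g]

section Products

variable [CharZero 𝕜]

theorem model_vv0 : (model 𝕜).prod 0 (modelGen 𝕜 .v) (modelGen 𝕜 .v) =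
    C (matX 𝕜) * modelGen 𝕜 .v := by
  rw [model_prod_v]; simp

theorem model_vv1 : (model 𝕜).prod 1 (modelGen 𝕜 .v) (modelGen 𝕜 .v) =
    C (matX 𝕜) * C (matV' 𝕜) - C (matE 𝕜) * modelGen 𝕜 .v := by
  rw [model_prod_v, pow_one, totalDer_v]; simp

theorem model_vv2 : (model 𝕜).prod 2 (modelGen 𝕜 .v) (modelGen 𝕜 .v) =
    -((2 : 𝕜) • (C (matE 𝕜) * C (matV' 𝕜))) := by
  rw [model_prod_v, totalDer_pow_two_gen _ _ le_rfl, show 2 - 1 = 1 from rfl, pow_one, totalDer_v]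
  simp

theorem model_vg0 : (model 𝕜).prod 0 (modelGen 𝕜 .v) (modelGen 𝕜 .g) =
    C (matX 𝕜) * modelGen 𝕜 .g := by
  rw [model_prod_v]; simp

theorem model_gv1 : (model 𝕜).prod 1 (modelGen 𝕜 .g) (modelGen 𝕜 .v) =
    C (matG 𝕜) * C (matV' 𝕜) := by
  rw [model_prod_g, pow_one, totalDer_v]

theorem model_curly (a b : Gen) (n : ℕ) : (model 𝕜).curly n (modelGen 𝕜 b) (modelGen 𝕜 a) =
    ∑ s ∈ Finset.range (N b a), ((-1 : 𝕜) ^ (n + s) * (s.factorial : 𝕜)⁻¹) •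
      (X ^ s * (model 𝕜).prod (n + s) (modelGen 𝕜 b) (modelGen 𝕜 a)) := by
  rw [(model 𝕜).curly_eq_sum (M := N b a) fun s hs => model_bounded b a (n + s) (by omega)]
  have h : ∀ (s : ℕ) (f : (Mat 𝕜)[X]), ((model 𝕜).der ^ s) f = X ^ s * f := fun s f => by
    induction s with
    | zero => simp
    | succ s ih =>
      rw [pow_succ', pow_succ', Module.End.mul_apply, ih, mul_assoc]
      rfl
  exact Finset.sum_congr rfl fun s _ => by rw [h]

theorem model_curly0 {a b : Gen} (h : N b a = 2) :
    (model 𝕜).curly 0 (modelGen 𝕜 b) (modelGen 𝕜 a) =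
      (model 𝕜).prod 0 (modelGen 𝕜 b) (modelGen 𝕜 a) -
        X * (model 𝕜).prod 1 (modelGen 𝕜 b) (modelGen 𝕜 a) := by
  rw [model_curly, h]
  simp [Finset.sum_range_succ, sub_eq_add_neg]

theorem model_curly1 {a b : Gen} (h : N b a = 2) :
    (model 𝕜).curly 1 (modelGen 𝕜 b) (modelGen 𝕜 a) =
      -(model 𝕜).prod 1 (modelGen 𝕜 b) (modelGen 𝕜 a) := by
  rw [model_curly, h]
  have := model_bounded (𝕜 := 𝕜) b a 2 h.le
  simp [Finset.sum_range_succ, this]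

theorem model_curly0_vv : (model 𝕜).curly 0 (modelGen 𝕜 .v) (modelGen 𝕜 .v) =
      (model 𝕜).prod 0 (modelGen 𝕜 .v) (modelGen 𝕜 .v) -
        X * (model 𝕜).prod 1 (modelGen 𝕜 .v) (modelGen 𝕜 .v) +
        (1 / 2 : 𝕜) • (X * (X * (model 𝕜).prod 2 (modelGen 𝕜 .v) (modelGen 𝕜 .v))) := by
  rw [model_curly]
  simp [Finset.sum_range_succ, N, sub_eq_add_neg, pow_two, mul_assoc]

theorem model_curly1_vv : (model 𝕜).curly 1 (modelGen 𝕜 .v) (modelGen 𝕜 .v) =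
      -(model 𝕜).prod 1 (modelGen 𝕜 .v) (modelGen 𝕜 .v) +
        X * (model 𝕜).prod 2 (modelGen 𝕜 .v) (modelGen 𝕜 .v) := by
  rw [model_curly]
  have := model_bounded (𝕜 := 𝕜) .v .v 3 le_rfl
  simp [Finset.sum_range_succ, N, this]

theorem model_curly2_vv : (model 𝕜).curly 2 (modelGen 𝕜 .v) (modelGen 𝕜 .v) =
      (model 𝕜).prod 2 (modelGen 𝕜 .v) (modelGen 𝕜 .v) := by
  rw [model_curly]
  have h3 := model_bounded (𝕜 := 𝕜) .v .v 3 le_rfl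
  have h4 := model_bounded (𝕜 := 𝕜) .v .v 4 (by decide)
  simp [Finset.sum_range_succ, N, h3, h4]

theorem model_bracket_of_le {n : ℕ} {a b : Gen} (h2 : 2 ≤ n) (h : N a b ≤ n) (h' : N b a ≤ n) :
    modelMap 𝕜 (bracket n (K1.gen 𝕜 a) (K1.gen 𝕜 b)) =
      (model 𝕜).superComm a.parity b.parity n (modelGen 𝕜 a) (modelGen 𝕜 b) := by
  rw [superComm, bracket_gen_of_two_le h2, model_bounded a b n h, map_zero,
    (model 𝕜).curly_eq_sum (M := 0) fun s hs => model_bounded b a (n + s) (by omega)]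
  simp

theorem val_one_two : (1 : ZMod 2).val = 1 := rfl

theorem model_bracket_vv0 : modelMap 𝕜 (bracket 0 (K1.gen 𝕜 .v) (K1.gen 𝕜 .v)) =
      (model 𝕜).superComm 0 0 0 (modelGen 𝕜 .v) (modelGen 𝕜 .v) := by
  rw [superComm, bracket_vv0, modelMap_der, modelMap_gen, model_curly0_vv, model_vv0, model_vv1,
    model_vv2]
  change X * _ = _
  simp only [ZMod.val_zero, val_one_two, mul_one, mul_zero, zero_mul, pow_zero, pow_one, one_smul,
    neg_smul]
  apply eq_of_entries <;>
  simp only [entries_add_apply, entries_sub_apply, entries_neg_apply, entries_smul_apply,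
    entries_mul_apply, entries_X_apply, entries_matX, entries_matE, entries_matG, entries_matV',
    entries_matG', modelGen] <;> algebra

theorem model_bracket_vv1 : modelMap 𝕜 (bracket 1 (K1.gen 𝕜 .v) (K1.gen 𝕜 .v)) =
      (model 𝕜).superComm 0 0 1 (modelGen 𝕜 .v) (modelGen 𝕜 .v) := by
  rw [superComm, bracket_vv1, map_smul, modelMap_gen, model_curly1_vv, model_vv1, model_vv2]
  simp only [ZMod.val_zero, val_one_two, mul_one, mul_zero, zero_mul, pow_zero, pow_one, one_smul,
    neg_smul]
  apply eq_of_entries <;>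
  simp only [entries_add_apply, entries_sub_apply, entries_neg_apply, entries_smul_apply,
    entries_mul_apply, entries_X_apply, entries_matX, entries_matE, entries_matG, entries_matV',
    entries_matG', modelGen] <;> algebra

theorem model_bracket_vv2 : modelMap 𝕜 (bracket 2 (K1.gen 𝕜 .v) (K1.gen 𝕜 .v)) =
      (model 𝕜).superComm 0 0 2 (modelGen 𝕜 .v) (modelGen 𝕜 .v) := by
  rw [superComm, bracket_gen_of_two_le le_rfl, model_curly2_vv]
  simp

theorem model_bracket_vg0 : modelMap 𝕜 (bracket 0 (K1.gen 𝕜 .v) (K1.gen 𝕜 .g)) =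
      (model 𝕜).superComm 0 1 0 (modelGen 𝕜 .v) (modelGen 𝕜 .g) := by
  rw [superComm, bracket_vg0, modelMap_der, modelMap_gen, model_curly0 rfl, model_vg0, model_gv0, model_gv1]
  change X * _ = _
  simp only [ZMod.val_zero, val_one_two, mul_one, mul_zero, zero_mul, pow_zero, pow_one, one_smul,
    neg_smul]
  apply eq_of_entries <;>
  simp only [entries_add_apply, entries_sub_apply, entries_neg_apply, entries_smul_apply,
    entries_mul_apply, entries_X_apply, entries_matX, entries_matE, entries_matG, entries_matV',
    entries_matG', modelGen] <;> algebra

theorem model_bracket_vg1 : modelMap 𝕜 (bracket 1 (K1.gen 𝕜 .v) (K1.gen 𝕜 .g)) =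
      (model 𝕜).superComm 0 1 1 (modelGen 𝕜 .v) (modelGen 𝕜 .g) := by
  rw [superComm, bracket_vg1, map_smul, modelMap_gen, model_curly1 rfl, model_vg1, model_gv1]
  simp only [ZMod.val_zero, val_one_two, mul_one, mul_zero, zero_mul, pow_zero, pow_one, one_smul,
    neg_smul]
  apply eq_of_entries <;>
  simp only [entries_add_apply, entries_sub_apply, entries_neg_apply, entries_smul_apply,
    entries_mul_apply, entries_X_apply, entries_matX, entries_matE, entries_matG, entries_matV',
    entries_matG', modelGen] <;> algebra

theorem model_bracket_gv0 : modelMap 𝕜 (bracket 0 (K1.gen 𝕜 .g) (K1.gen 𝕜 .v)) =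
      (model 𝕜).superComm 1 0 0 (modelGen 𝕜 .g) (modelGen 𝕜 .v) := by
  rw [superComm, bracket_gv0, map_smul, modelMap_der, modelMap_gen, model_curly0 rfl, model_gv0, model_vg0, model_vg1]
  change _ • (X * _) = _
  simp only [ZMod.val_zero, val_one_two, mul_one, mul_zero, zero_mul, pow_zero, pow_one, one_smul,
    neg_smul]
  apply eq_of_entries <;>
  simp only [entries_add_apply, entries_sub_apply, entries_neg_apply, entries_smul_apply,
    entries_mul_apply, entries_X_apply, entries_matX, entries_matE, entries_matG, entries_matV',
    entries_matG', modelGen] <;> algebra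

theorem model_bracket_gv1 : modelMap 𝕜 (bracket 1 (K1.gen 𝕜 .g) (K1.gen 𝕜 .v)) =
      (model 𝕜).superComm 1 0 1 (modelGen 𝕜 .g) (modelGen 𝕜 .v) := by
  rw [superComm, bracket_gv1, map_smul, modelMap_gen, model_curly1 rfl, model_gv1, model_vg1]
  simp only [ZMod.val_zero, val_one_two, mul_one, mul_zero, zero_mul, pow_zero, pow_one, one_smul,
    neg_smul]
  apply eq_of_entries <;>
  simp only [entries_add_apply, entries_sub_apply, entries_neg_apply, entries_smul_apply,
    entries_mul_apply, entries_X_apply, entries_matX, entries_matE, entries_matG, entries_matV',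
    entries_matG', modelGen] <;> algebra

theorem model_bracket_gg0 : modelMap 𝕜 (bracket 0 (K1.gen 𝕜 .g) (K1.gen 𝕜 .g)) =
      (model 𝕜).superComm 1 1 0 (modelGen 𝕜 .g) (modelGen 𝕜 .g) := by
  rw [superComm, bracket_gg0, map_neg, map_smul, modelMap_gen, model_curly0 rfl, model_gg0, model_gg1]
  simp only [ZMod.val_zero, val_one_two, mul_one, mul_zero, zero_mul, pow_zero, pow_one, one_smul,
    neg_smul]
  apply eq_of_entries <;>
  simp only [entries_add_apply, entries_sub_apply, entries_neg_apply, entries_smul_apply,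
    entries_mul_apply, entries_X_apply, entries_matX, entries_matE, entries_matG, entries_matV',
    entries_matG', modelGen] <;> algebra

theorem model_bracket_gg1 : modelMap 𝕜 (bracket 1 (K1.gen 𝕜 .g) (K1.gen 𝕜 .g)) =
      (model 𝕜).superComm 1 1 1 (modelGen 𝕜 .g) (modelGen 𝕜 .g) := by
  rw [superComm, bracket_gg1, map_zero, model_curly1 rfl, model_gg1]
  simp [show (1 : ZMod 2).val = 1 from rfl]

theorem model_bracket (n : ℕ) (a b : Gen) :
    modelMap 𝕜 (bracket n (K1.gen 𝕜 a) (K1.gen 𝕜 b)) =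
      (model 𝕜).superComm a.parity b.parity n (modelGen 𝕜 a) (modelGen 𝕜 b) := by
  rcases n with _ | _ | n
  · cases a <;> cases b
    exacts [model_bracket_vv0, model_bracket_vg0, model_bracket_gv0, model_bracket_gg0]
  · cases a <;> cases b
    exacts [model_bracket_vv1, model_bracket_vg1, model_bracket_gv1, model_bracket_gg1]
  · cases a <;> cases b
    · rcases n with _ | n
      · exact model_bracket_vv2
      · exact model_bracket_of_le (by omega) (by simp [N]) (by simp [N])
    all_goals exact model_bracket_of_le (by omega) (by simp [N]) (by simp [N])

end Products

theorem C_mem_polyGrade {M : Mat 𝕜} {i : ZMod 2} (h : M ∈ matGrade 𝕜 i) :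
    (C M : (Mat 𝕜)[X]) ∈ polyGrade (matGrade 𝕜) i := by
  rw [← monomial_zero_left]
  exact monomial_mem_polyGrade h 0

theorem modelGen_mem_grade (a : Gen) : modelGen 𝕜 a ∈ (model 𝕜).grade a.parity := by
  cases a
  · refine add_mem (C_mem_polyGrade ?_)
      (X_mul_mem_polyGrade (C_mem_polyGrade ?_))
    · exact mem_matGrade_zero.2 (by simp [matX])
    · exact mem_matGrade_zero.2 (by simp [matE])
  · refine C_mem_polyGrade ?_
    exact mem_matGrade_one.2 (by simp [matG])

theorem isPreEnvelope_model [CharZero 𝕜] :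
    IsPreEnvelope (K1.alg 𝕜) (K1.gen 𝕜) N (model 𝕜) (modelMap 𝕜) := by
  refine isPreEnvelope_of_gen isAssociative_model modelMap_der (fun a => ?_) (fun n a b => ?_)
    fun a b n hn => ?_
  · rw [modelMap_gen]; exact modelGen_mem_grade a
  · rw [modelMap_gen, modelMap_gen]; exact model_bracket n a b
  · rw [modelMap_gen, modelMap_gen]; exact model_bounded a b n hn

end Model

end NeveuSchwartz

/-! ### Linear independence of the images of the normal monomials. -/

namespace NeveuSchwartz
open GS ConformalSuperalgebra Polynomial

section Independence

variable {𝕜 : Type*} [Field 𝕜]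

/-- The coordinates of the span of the normal monomials in `Cend_{1|1}`. -/
abbrev Coord (𝕜 : Type*) [Field 𝕜] := (𝕜[X][X] × 𝕜[X][X] × 𝕜[X]) × (𝕜[X][X] × 𝕜[X][X] × 𝕜[X])

/-- The coordinates of a normal monomial. -/
noncomputable def coord (𝕜 : Type*) [Field 𝕜] : NormalIdx → Coord 𝕜
  | .main a false s .v => ((monomial s (monomial a 1), 0, 0), 0)
  | .main a true s .g => ((0, monomial s (monomial a 1), 0), 0)
  | .extra a .g => ((0, 0, monomial a 1), 0)
  | .main a false s .g => (0, (monomial s (monomial a 1), 0, 0))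
  | .main a true s .v => (0, (0, monomial s (monomial a 1), 0))
  | .extra a .v => (0, (0, 0, monomial a 1))

/-- The coordinate functionals. -/
noncomputable def dualCoord (𝕜 : Type*) [Field 𝕜] : NormalIdx → Module.Dual 𝕜 (Coord 𝕜)
  | .main a false s .v =>
    lcoeff 𝕜 a ∘ₗ (lcoeff 𝕜[X] s).restrictScalars 𝕜 ∘ₗ LinearMap.fst _ _ _ ∘ₗ LinearMap.fst _ _ _
  | .main a true s .g =>
    lcoeff 𝕜 a ∘ₗ (lcoeff 𝕜[X] s).restrictScalars 𝕜 ∘ₗ LinearMap.fst _ _ _ ∘ₗ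
      LinearMap.snd _ _ _ ∘ₗ LinearMap.fst _ _ _
  | .extra a .g =>
    lcoeff 𝕜 a ∘ₗ LinearMap.snd _ _ _ ∘ₗ LinearMap.snd _ _ _ ∘ₗ LinearMap.fst _ _ _
  | .main a false s .g =>
    lcoeff 𝕜 a ∘ₗ (lcoeff 𝕜[X] s).restrictScalars 𝕜 ∘ₗ LinearMap.fst _ _ _ ∘ₗ LinearMap.snd _ _ _
  | .main a true s .v =>
    lcoeff 𝕜 a ∘ₗ (lcoeff 𝕜[X] s).restrictScalars 𝕜 ∘ₗ LinearMap.fst _ _ _ ∘ₗ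
      LinearMap.snd _ _ _ ∘ₗ LinearMap.snd _ _ _
  | .extra a .v =>
    lcoeff 𝕜 a ∘ₗ LinearMap.snd _ _ _ ∘ₗ LinearMap.snd _ _ _ ∘ₗ LinearMap.snd _ _ _

theorem coeff_coeff_monomial_monomial (s s' a a' : ℕ) :
    ((monomial s' (monomial a' (1 : 𝕜))).coeff s).coeff a = if s' = s ∧ a' = a then 1 else 0 := by
  rw [coeff_monomial]
  by_cases h : s' = s
  · simp [h, coeff_monomial]
  · simp [h]

theorem dualCoord_coord (i j : NormalIdx) : dualCoord 𝕜 i (coord 𝕜 j) = 0 ∨ i = j := by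
  rcases i with ⟨a, _ | _, s, _ | _⟩ | ⟨a, _ | _⟩ <;>
  rcases j with ⟨a', _ | _, s', _ | _⟩ | ⟨a', _ | _⟩ <;>
  simp [dualCoord, coord, coeff_coeff_monomial_monomial] <;> try simp [coeff_monomial]
  all_goals grind

theorem dualCoord_coord_self (i : NormalIdx) : dualCoord 𝕜 i (coord 𝕜 i) = 1 := by
  rcases i with ⟨a, _ | _, s, _ | _⟩ | ⟨a, _ | _⟩ <;> simp [dualCoord, coord]

theorem linearIndependent_coord : LinearIndependent 𝕜 (coord 𝕜) :=
  LinearIndependent.of_pairwise_dual_eq_zero_one _ (dualCoord 𝕜)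
    (fun i j h => (dualCoord_coord i j).resolve_right h) dualCoord_coord_self

/-- The entries of the element of `Cend_{1|1}` with given coordinates. -/
noncomputable def ofCoord (𝕜 : Type*) [Field 𝕜] :
    Coord 𝕜 →ₗ[𝕜] 𝕜[X][X] × 𝕜[X][X] × 𝕜[X][X] × 𝕜[X][X] where
  toFun w :=
    -- Write `G` for the image of `g`. The even coordinates multiply `v = diag(x, x - ∂/2)`, `G² =
    -- -x/4` and `L_1^g g = diag(0, -1/4)`; the odd ones multiply `G`, `G v` and `L_1^v g = ½ e₂₁ -
    -- ¼ x e₁₂`.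
    (C X * (w.1.1 - (1 / 4 : 𝕜) • w.1.2.1),
     (-1 / 4 : 𝕜) • (C X * (w.2.1 + (C X - (1 / 2 : 𝕜) • X) * w.2.2.1 + C w.2.2.2)),
     w.2.1 + C X * w.2.2.1 + (1 / 2 : 𝕜) • C w.2.2.2,
     (C X - (1 / 2 : 𝕜) • X) * w.1.1 - (1 / 4 : 𝕜) • (C X * w.1.2.1) - (1 / 4 : 𝕜) • C w.1.2.2)
  map_add' w w' := by
    obtain ⟨⟨p, q, r⟩, p', q', r'⟩ := w
    obtain ⟨⟨p₁, q₁, r₁⟩, p₁', q₁', r₁'⟩ := w'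
    simp only [Prod.mk_add_mk, Prod.mk.injEq, C_add]
    refine ⟨?_, ?_, ?_, ?_⟩ <;> algebra
  map_smul' c w := by
    obtain ⟨⟨p, q, r⟩, p', q', r'⟩ := w
    simp only [Prod.smul_mk, Prod.mk.injEq, ← smul_C, RingHom.id_apply]
    refine ⟨?_, ?_, ?_, ?_⟩ <;> algebra

/-- Elimination between the diagonal entries gives `∂ p + r / 2 = 0`, and between the antidiagonal
entries `∂ q' - r' = 0`. As `r` and `r'` do not involve `∂`, these four vanish, and then so do `q`
and `p'`. -/
theorem ker_ofCoord [CharZero 𝕜] : LinearMap.ker (ofCoord 𝕜) = ⊥ := by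
  rw [LinearMap.ker_eq_bot']
  rintro ⟨⟨p, q, r⟩, p', q', r'⟩ h
  simp only [ofCoord, LinearMap.coe_mk, AddHom.coe_mk, Prod.mk_eq_zero] at h
  obtain ⟨h00, h01, h10, h11⟩ := h
  have hx : (C X : 𝕜[X][X]) ≠ 0 := C_ne_zero.2 X_ne_zero
  have h4 : (-1 / 4 : 𝕜) ≠ 0 := by norm_num
  have e1 := (mul_eq_zero.1 h00).resolve_left hx
  have e2 := (mul_eq_zero.1 ((smul_eq_zero.1 h01).resolve_left h4)).resolve_left hx
  have key : ∀ (f : 𝕜[X][X]) (s : 𝕜[X]), X * f + C s = 0 → f = 0 ∧ s = 0 := by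
    intro f s hs
    have h0 : s = 0 := by
      have := congrArg (fun p => coeff p 0) hs
      simpa using this
    rw [h0, map_zero, add_zero] at hs
    exact ⟨(mul_eq_zero.1 hs).resolve_left X_ne_zero, h0⟩
  obtain ⟨hp, hr⟩ := key p ((1 / 2 : 𝕜) • r) (by
    rw [← smul_C]
    linear_combination (norm := algebra) (-2 : 𝕜) • h11 + (2 : 𝕜) • (C X * e1))
  obtain ⟨hq', hr'⟩ := key q' (-r') (by
    rw [map_neg]
    linear_combination (norm := algebra) (2 : 𝕜) • h10 - (2 : 𝕜) • e2)
  subst hp hq'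
  have hr : r = 0 := by simpa using hr
  have hr' : r' = 0 := by simpa using hr'
  subst hr hr'
  have hp' : p' = 0 := by simpa using h10
  have hq : q = 0 := by simpa using e1
  rw [hp', hq]
  rfl

/-- The entries of an element of `Cend_{1|1}`. -/
noncomputable def entriesVec (𝕜 : Type*) [Field 𝕜] :
    (Mat 𝕜)[X] →ₗ[𝕜] 𝕜[X][X] × 𝕜[X][X] × 𝕜[X][X] × 𝕜[X][X] where
  toFun f := (entries 𝕜 f 0 0, entries 𝕜 f 0 1, entries 𝕜 f 1 0, entries 𝕜 f 1 1)
  map_add' f g := by simp only [entries_add_apply, Prod.mk_add_mk]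
  map_smul' c f := by simp only [entries_smul_apply, Prod.smul_mk, RingHom.id_apply]

theorem entries_matX_pow_mul (a : ℕ) (f : (Mat 𝕜)[X]) (i j : Fin 2) :
    entries 𝕜 (C (matX 𝕜) ^ a * f) i j = C X ^ a * entries 𝕜 f i j := by
  induction a with
  | zero => simp
  | succ a ih =>
    rw [pow_succ', mul_assoc, entries_mul_apply, ← entries_mul_apply]
    have h : ∀ g : (Mat 𝕜)[X], entries 𝕜 (C (matX 𝕜) * g) i j = C X * entries 𝕜 g i j := by
      intro g
      rw [entries_mul_apply]
      fin_cases i <;> simp [entries_matX]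
    rw [h, ih, pow_succ', mul_assoc]

theorem entries_X_pow_mul (s : ℕ) (f : (Mat 𝕜)[X]) (i j : Fin 2) :
    entries 𝕜 (X ^ s * f) i j = X ^ s * entries 𝕜 f i j := by
  have h : ∀ g : (Mat 𝕜)[X], entries 𝕜 (X * g) i j = X * entries 𝕜 g i j := by
    intro g
    rw [entries_mul_apply]
    fin_cases i <;> simp [entries_X_apply]
  induction s with
  | zero => simp
  | succ s ih => rw [pow_succ', mul_assoc, h, ih, pow_succ', mul_assoc]

theorem monomial_monomial (s a : ℕ) :
    (monomial s (monomial a (1 : 𝕜)) : 𝕜[X][X]) = C X ^ a * X ^ s := by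
  rw [← C_mul_X_pow_eq_monomial, monomial_one_right_eq_X_pow, C_pow]

theorem C_monomial (a : ℕ) : (C (monomial a (1 : 𝕜)) : 𝕜[X][X]) = C X ^ a := by
  rw [monomial_one_right_eq_X_pow, C_pow]

theorem freeAct_W_cons {C : Type*} [AddCommGroup C] [Module 𝕜 C] (S : ConformalSuperalgebra 𝕜 C)
    (φ : K1 𝕜 →ₗ[𝕜] C) (z : Letter) (l : List Letter) (f : C) :
    freeAct S φ (word 𝕜 (W (z :: l))) f = actEnd S φ z (freeAct S φ (word 𝕜 (W l)) f) := by
  rw [show z :: l = [z] ++ l from rfl, ← word_W_mul, map_mul, ← freeAct_letter]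
  rfl

theorem freeAct_W_nil {C : Type*} [AddCommGroup C] [Module 𝕜 C] (S : ConformalSuperalgebra 𝕜 C)
    (φ : K1 𝕜 →ₗ[𝕜] C) (f : C) : freeAct S φ (word 𝕜 (W [])) f = f := by
  change freeAct S φ (word 𝕜 1) f = f
  rw [word_one, map_one, Module.End.one_apply]

theorem freeAct_model_L0v (a : ℕ) (l : List Letter) (f : (Mat 𝕜)[X]) :
    freeAct (model 𝕜) (modelMap 𝕜) (word 𝕜 (W (List.replicate a (.L 0 .v) ++ l))) f =
      C (matX 𝕜) ^ a * freeAct (model 𝕜) (modelMap 𝕜) (word 𝕜 (W l)) f := by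
  induction a with
  | zero => simp
  | succ a ih =>
    rw [List.replicate_succ, List.cons_append, freeAct_W_cons, ih, pow_succ', mul_assoc]
    change (model 𝕜).prod 0 (modelMap 𝕜 (K1.gen 𝕜 .v)) _ = _
    rw [modelMap_gen, model_prod_v]
    simp

theorem freeAct_model_d (s : ℕ) (f : (Mat 𝕜)[X]) :
    freeAct (model 𝕜) (modelMap 𝕜) (word 𝕜 (W (List.replicate s .d))) f = X ^ s * f := by
  induction s with
  | zero => rw [pow_zero, one_mul, List.replicate_zero, freeAct_W_nil]
  | succ s ih =>
    rw [List.replicate_succ, freeAct_W_cons, ih, pow_succ', mul_assoc]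
    rfl

variable [CharZero 𝕜]

theorem ev_mon {C : Type*} [AddCommGroup C] [Module 𝕜 C] {S : ConformalSuperalgebra 𝕜 C}
    {φ : K1 𝕜 →ₗ[𝕜] C} (hS : IsPreEnvelope (K1.alg 𝕜) (K1.gen 𝕜) N S φ)
    (p : FreeMonoid Letter × Gen) : ev hS (toFreeA 𝕜 (mon 𝕜 p)) =
      freeAct S φ (word 𝕜 p.1) (φ (K1.gen 𝕜 p.2)) := ev_toFreeA_smul_e hS _ _

/-- In the model `L_0^v` multiplies by the scalar matrix `x` and `∂` by the variable. Both factor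
out, leaving only `v`, `g`, `L_0^g v`, `L_0^g g`, `L_1^v g` and `L_1^g g` to compute. -/
theorem entriesVec_normalMon (i : NormalIdx) :
    entriesVec 𝕜 (ev isPreEnvelope_model (toFreeA 𝕜 (mon 𝕜 (normalMon i)))) =
      ofCoord 𝕜 (coord 𝕜 i) := by
  rw [ev_mon, modelMap_gen]
  have hG : ∀ (s : ℕ) (f : (Mat 𝕜)[X]), (model 𝕜).prod 0 (modelGen 𝕜 .g) (X ^ s * f) =
      X ^ s * (C (matG 𝕜) * f) := fun s f => by
    rw [model_prod_g, pow_zero, Module.End.one_apply, ← mul_assoc, ← X_pow_mul, mul_assoc]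
  rcases i with ⟨a, _ | _, s, _ | _⟩ | ⟨a, _ | _⟩ <;>
  simp only [normalMon, freeAct_model_L0v, freeAct_model_d, Bool.false_eq_true, if_false, if_true,
    List.nil_append, List.cons_append, freeAct_W_cons, actEnd, modelMap_gen, hG,
    freeAct_W_nil, model_vg1, model_gg1] <;>
  simp only [entriesVec, LinearMap.coe_mk, AddHom.coe_mk, entries_matX_pow_mul,
    entries_X_pow_mul] <;>
  simp only [ofCoord, coord, modelGen, entries_add_apply, entries_sub_apply,
    entries_mul_apply, entries_matX, entries_matE, entries_X_apply, entries_matG, entries_matG',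
    monomial_monomial, C_monomial, LinearMap.coe_mk, AddHom.coe_mk, Prod.mk.injEq, map_zero,
    Prod.fst_zero, Prod.snd_zero] <;>
  refine ⟨?_, ?_, ?_, ?_⟩ <;> algebra

theorem linearIndependent_normalMon : LinearIndependent 𝕜 fun i =>
    ev isPreEnvelope_model (toFreeA 𝕜 (mon 𝕜 (normalMon i))) := by
  refine LinearIndependent.of_comp (entriesVec 𝕜) ?_
  have h : (entriesVec 𝕜 ∘ fun i => ev isPreEnvelope_model (toFreeA 𝕜 (mon 𝕜 (normalMon i)))) =
      ofCoord 𝕜 ∘ coord 𝕜 := funext entriesVec_normalMon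
  rw [h]
  exact linearIndependent_coord.map' _ ker_ofCoord

end Independence

end NeveuSchwartz

/-! ### The Gröbner–Shirshov basis and the kernel of the evaluation. -/

namespace NeveuSchwartz
open GS ConformalSuperalgebra

section Kernel

variable {𝕜 : Type*} [Field 𝕜]

theorem exists_isModLead {t : FreeMod 𝕜 Letter Gen} (ht : t ∈ defRels 𝕜 ∪ extraRels 𝕜) :
    ∃ p, IsModLead wordLt Gen.Lt t p := by
  rcases ht with ⟨p, q, h, rfl⟩ | ⟨p, q, h, rfl⟩
  · obtain ⟨w, -, hw⟩ := h.exists_isModLead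
    exact ⟨w, hw⟩
  · obtain ⟨w, -, hw⟩ := h.exists_isModLead
    exact ⟨w, hw⟩

theorem toA_eq_zero {s : FreeAlg 𝕜 Letter} (hs : s ∈ algRels 𝕜) : toA 𝕜 s = 0 := by
  obtain ⟨p, q, h, rfl⟩ := hs
  rw [map_sub, sub_eq_zero]
  exact RingQuot.mkAlgHom_rel 𝕜 h

theorem toFreeA_mul_smul_gen {s : FreeAlg 𝕜 Letter} (hs : s ∈ algRels 𝕜) (a b : FreeAlg 𝕜 Letter)
    (y : Gen) : toFreeA 𝕜 ((a * s * b) • gen 𝕜 Letter y) = 0 := by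
  rw [toFreeA_smul, map_mul, map_mul, toA_eq_zero hs, mul_zero, zero_mul, zero_smul]

theorem toFreeA_surjective : Function.Surjective (toFreeA 𝕜) := by
  intro f
  induction f using Finsupp.induction_linear with
  | zero => exact ⟨0, map_zero _⟩
  | add f g hf hg =>
    obtain ⟨f, rfl⟩ := hf
    obtain ⟨g, rfl⟩ := hg
    exact ⟨f + g, map_add _ _ _⟩
  | single x a =>
    obtain ⟨a, rfl⟩ := RingQuot.mkAlgHom_surjective 𝕜 (AlgRel 𝕜) a
    exact ⟨Finsupp.single x a, toFreeA_single x a⟩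

/-- The elements of the free module that represent elements of the submodule of relations. -/
noncomputable def relSubmodule (𝕜 : Type*) [Field 𝕜] : Submodule 𝕜 (FreeMod 𝕜 Letter Gen) where
  carrier := {t | toFreeA 𝕜 t ∈ Submodule.span (A 𝕜) (toFreeA 𝕜 '' defRels 𝕜)}
  add_mem' hs ht := by
    simp only [Set.mem_ofPred_eq, map_add] at hs ht ⊢
    exact Submodule.add_mem _ hs ht
  zero_mem' := by
    simp only [Set.mem_ofPred_eq, map_zero]
    exact Submodule.zero_mem _
  smul_mem' c t ht := by
    simp only [Set.mem_ofPred_eq, map_smul] at ht ⊢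
    rw [← algebraMap_smul (A 𝕜) c]
    exact Submodule.smul_mem _ _ ht

theorem mem_relSubmodule {t : FreeMod 𝕜 Letter Gen} : t ∈ relSubmodule 𝕜 ↔
    toFreeA 𝕜 t ∈ Submodule.span (A 𝕜) (toFreeA 𝕜 '' defRels 𝕜) := Iff.rfl

variable [CharZero 𝕜]

theorem toFreeA_mem_span {t : FreeMod 𝕜 Letter Gen} (ht : t ∈ defRels 𝕜 ∪ extraRels 𝕜) :
    toFreeA 𝕜 t ∈ Submodule.span (A 𝕜) (toFreeA 𝕜 '' defRels 𝕜) := by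
  rw [← span_defRels_union_extraRels]
  exact Submodule.subset_span ⟨t, ht, rfl⟩

/-- The enriched relations form a Gröbner–Shirshov basis. -/
theorem isModGSB_defRels_union_extraRels :
    IsModGSB wordLt Gen.Lt (algRels 𝕜) (defRels 𝕜 ∪ extraRels 𝕜) :=
  isModGSB_of_linearIndependent isMonomialOrder_wordLt Gen.lt_wf isAlgGSB_algRels
    (fun _ ht => exists_isModLead ht) normal_or_red Gen.lt_trans
    (ev isPreEnvelope_model ∘ₗ toFreeA 𝕜)
    (fun s hs a b y => by
      rw [LinearMap.comp_apply, toFreeA_mul_smul_gen hs, map_zero])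
    (fun t ht a => by
      rw [LinearMap.comp_apply, toFreeA_smul, ev_smul,
        ev_eq_zero_of_mem_span isPreEnvelope_model (toFreeA_mem_span ht), map_zero])
    linearIndependent_normalMon

/-- The reduction to normal form, without a bound on principal monomials and modulo all consequences
of the relations. -/
theorem mem_span_normalMon_sup (t : FreeMod 𝕜 Letter Gen) :
    t ∈ Submodule.span 𝕜 (Set.range fun i => mon 𝕜 (normalMon i)) ⊔ relSubmodule 𝕜 := by
  have h := mem_span_mon (f := t) (P := fun _ => True) fun _ _ => trivial
  refine Submodule.span_le.2 ?_ h
  rintro _ ⟨p, -, rfl⟩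
  refine mon_mem_sup isMonomialOrder_wordLt Gen.lt_wf normal_or_red (P := fun _ => True)
    (fun _ _ _ _ => trivial) (fun f p _ hf => ?_) p trivial
  rw [mem_relSubmodule]
  cases hf with
  | alg hs hw a b y =>
    rw [toFreeA_mul_smul_gen hs]
    exact Submodule.zero_mem _
  | mod ht hq a =>
    rw [toFreeA_smul]
    exact Submodule.smul_mem _ _ (toFreeA_mem_span ht)

/-- Modulo the relations `f` is a combination of normal monomials, whose images in the model are
independent. The model is thus a faithful picture of the module presented by the relations. -/
theorem ev_model_eq_zero_iff (f : Gen →₀ A 𝕜) : ev isPreEnvelope_model f = 0 ↔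
    f ∈ Submodule.span (A 𝕜) (toFreeA 𝕜 '' defRels 𝕜) := by
  refine ⟨fun h => ?_, ev_eq_zero_of_mem_span isPreEnvelope_model⟩
  obtain ⟨t, rfl⟩ := toFreeA_surjective f
  obtain ⟨n, hn, k, hk, rfl⟩ := Submodule.mem_sup.1 (mem_span_normalMon_sup t)
  rw [mem_relSubmodule] at hk
  rw [map_add] at h ⊢
  rw [map_add, ev_eq_zero_of_mem_span isPreEnvelope_model hk, add_zero] at h
  rw [eq_zero_of_mem_span_of_linearIndependent (E := ev isPreEnvelope_model ∘ₗ toFreeA 𝕜)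
    linearIndependent_normalMon hn h, map_zero, zero_add]
  exact hk

end Kernel

end NeveuSchwartz

/-! ### Generated subalgebras and homomorphisms of envelopes. -/

namespace ConformalSuperalgebra

variable {𝕜 C D L ι : Type*} [Field 𝕜] [AddCommGroup C] [Module 𝕜 C] [AddCommGroup D] [Module 𝕜 D]
  [AddCommGroup L] [Module 𝕜 L]

section Closure

variable {S : ConformalSuperalgebra 𝕜 C} {q : ZMod 2 → Submodule 𝕜 C}

theorem der_mem_sup (hd : ∀ i, ∀ x ∈ q i, S.der x ∈ q i) (x : C) (hx : x ∈ q 0 ⊔ q 1) :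
    S.der x ∈ q 0 ⊔ q 1 := by
  obtain ⟨a, ha, b, hb, rfl⟩ := Submodule.mem_sup.1 hx
  rw [map_add]
  exact Submodule.add_mem_sup (hd _ _ ha) (hd _ _ hb)

theorem prod_mem_sup (hp : ∀ n i j, ∀ x ∈ q i, ∀ y ∈ q j, S.prod n x y ∈ q (i + j)) (n : ℕ)
    (x : C) (hx : x ∈ q 0 ⊔ q 1) (y : C) (hy : y ∈ q 0 ⊔ q 1) : S.prod n x y ∈ q 0 ⊔ q 1 := by
  obtain ⟨a, ha, b, hb, rfl⟩ := Submodule.mem_sup.1 hx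
  obtain ⟨c, hc, d, hd, rfl⟩ := Submodule.mem_sup.1 hy
  have h11 : (1 + 1 : ZMod 2) = 0 := by decide
  have h1 := hp n 0 0 a ha c hc
  have h2 := hp n 0 1 a ha d hd
  have h3 := hp n 1 0 b hb c hc
  have h4 := hp n 1 1 b hb d hd
  rw [h11] at h4
  rw [map_add, map_add, LinearMap.add_apply, LinearMap.add_apply]
  exact add_mem (add_mem (Submodule.mem_sup_left h1) (Submodule.mem_sup_right h3))
    (add_mem (Submodule.mem_sup_right h2) (Submodule.mem_sup_left h4))

theorem map_mem_sup {SL : ConformalSuperalgebra 𝕜 L} {φ : L →ₗ[𝕜] C}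
    (hq : ∀ i, ∀ x ∈ SL.grade i, φ x ∈ q i) (x : L) : φ x ∈ q 0 ⊔ q 1 := by
  have h : x ∈ SL.grade 0 ⊔ SL.grade 1 := by rw [SL.isCompl_grade.sup_eq_top]; trivial
  obtain ⟨a, ha, b, hb, rfl⟩ := Submodule.mem_sup.1 h
  rw [map_add]
  exact Submodule.add_mem_sup (hq _ _ ha) (hq _ _ hb)

end Closure

/-- The conformal subalgebra generated by the image of `φ`. -/
def closure (S : ConformalSuperalgebra 𝕜 C) (φ : L →ₗ[𝕜] C) : Submodule 𝕜 C :=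
  sInf {p | (∀ x, φ x ∈ p) ∧ (∀ c ∈ p, S.der c ∈ p) ∧ ∀ n, ∀ c ∈ p, ∀ d ∈ p, S.prod n c d ∈ p}

section Restrict

variable (S : ConformalSuperalgebra 𝕜 C) (φ : L →ₗ[𝕜] C)

theorem map_mem_closure (x : L) : φ x ∈ S.closure φ :=
  Submodule.mem_sInf.2 fun _ hp => hp.1 x

theorem der_mem_closure {c : C} (hc : c ∈ S.closure φ) : S.der c ∈ S.closure φ :=
  Submodule.mem_sInf.2 fun p hp => hp.2.1 c (Submodule.mem_sInf.1 hc p hp)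

theorem prod_mem_closure (n : ℕ) {c d : C} (hc : c ∈ S.closure φ) (hd : d ∈ S.closure φ) :
    S.prod n c d ∈ S.closure φ :=
  Submodule.mem_sInf.2 fun p hp =>
    hp.2.2 n c (Submodule.mem_sInf.1 hc p hp) d (Submodule.mem_sInf.1 hd p hp)

variable {φ} in
theorem closure_le {p : Submodule 𝕜 C} (h1 : ∀ x, φ x ∈ p) (h2 : ∀ c ∈ p, S.der c ∈ p)
    (h3 : ∀ n, ∀ c ∈ p, ∀ d ∈ p, S.prod n c d ∈ p) : S.closure φ ≤ p := sInf_le ⟨h1, h2, h3⟩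

/-- The sum of the homogeneous parts of the closure is itself a subalgebra containing the image of
`φ`, so it is the whole closure. This equips the generated subalgebra with its grading. -/
theorem closure_le_sup {SL : ConformalSuperalgebra 𝕜 L}
    (hg : ∀ i, ∀ x ∈ SL.grade i, φ x ∈ S.grade i) :
    S.closure φ ≤ (S.closure φ ⊓ S.grade 0) ⊔ (S.closure φ ⊓ S.grade 1) := by
  let q : ZMod 2 → Submodule 𝕜 C := fun i => S.closure φ ⊓ S.grade i
  exact S.closure_le (map_mem_sup (SL := SL) (q := q) fun i x hx => ⟨S.map_mem_closure φ x, hg i x hx⟩)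
    (der_mem_sup (q := q) fun i x hx => ⟨S.der_mem_closure φ hx.1, S.der_mem i x hx.2⟩)
    (prod_mem_sup (q := q) fun n i j x hx y hy =>
      ⟨S.prod_mem_closure φ n hx.1 hy.1, S.prod_mem n i j x hx.2 y hy.2⟩)

/-- The conformal superalgebra generated by the image of a graded map `φ`. -/
def restrict {SL : ConformalSuperalgebra 𝕜 L} (hg : ∀ i, ∀ x ∈ SL.grade i, φ x ∈ S.grade i) :
    ConformalSuperalgebra 𝕜 (S.closure φ) where
  der := S.der.restrict fun _ h => S.der_mem_closure φ h
  prod n := LinearMap.mk₂ 𝕜 (fun c d => ⟨S.prod n c d, S.prod_mem_closure φ n c.2 d.2⟩)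
    (fun _ _ _ => Subtype.ext (by simp)) (fun _ _ _ => Subtype.ext (by simp))
    (fun _ _ _ => Subtype.ext (by simp)) (fun _ _ _ => Subtype.ext (by simp))
  grade i := (S.grade i).comap (S.closure φ).subtype
  isCompl_grade := by
    rw [isCompl_iff, Submodule.disjoint_def, codisjoint_iff_le_sup]
    refine ⟨fun x h0 h1 => Subtype.ext (Submodule.disjoint_def.1 S.isCompl_grade.1 _ h0 h1),
      fun x _ => ?_⟩
    obtain ⟨a, ha, b, hb, hab⟩ := Submodule.mem_sup.1 (S.closure_le_sup φ hg x.2)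
    exact Submodule.mem_sup.2 ⟨⟨a, ha.1⟩, ha.2, ⟨b, hb.1⟩, hb.2, Subtype.ext hab⟩
  der_mem i x hx := S.der_mem i x hx
  prod_mem n i j x hx y hy := S.prod_mem n i j x hx y hy
  locality x y := by
    obtain ⟨N, hN⟩ := S.locality x y
    exact ⟨N, fun n hn => Subtype.ext (hN n hn)⟩
  der_prod n x y := Subtype.ext (S.der_prod n x y)
  prod_der n x y := Subtype.ext (S.prod_der n x y)

end Restrict

section Hom

variable {S : ConformalSuperalgebra 𝕜 C} {S' : ConformalSuperalgebra 𝕜 D} {f : C →ₗ[𝕜] D}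

theorem map_curly (hd : ∀ x, f (S.der x) = S'.der (f x))
    (hp : ∀ n x y, f (S.prod n x y) = S'.prod n (f x) (f y)) (n : ℕ) (y x : C) :
    f (S.curly n y x) = S'.curly n (f y) (f x) := by
  obtain ⟨M, hM⟩ := S.exists_bound y x
  have h : ∀ (s : ℕ) (c : C), f ((S.der ^ s) c) = (S'.der ^ s) (f c) := by
    intro s
    induction s with
    | zero => intro c; rfl
    | succ s ih => intro c; rw [pow_succ', pow_succ', Module.End.mul_apply, hd, ih]; rfl
  rw [S.curly_eq_sum (M := M) (hM n), S'.curly_eq_sum (M := M) fun s hs => by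
    rw [← hp, hM n s hs, map_zero], map_sum]
  exact Finset.sum_congr rfl fun s _ => by rw [map_smul, h, hp]

theorem map_superComm (hd : ∀ x, f (S.der x) = S'.der (f x))
    (hp : ∀ n x y, f (S.prod n x y) = S'.prod n (f x) (f y)) (i j : ZMod 2) (n : ℕ) (x y : C) :
    f (S.superComm i j n x y) = S'.superComm i j n (f x) (f y) := by
  rw [superComm, superComm, map_sub, map_smul, map_curly hd hp, hp]

end Hom

/-- The conformal superalgebra generated by the image of `L` is an envelope. -/
theorem IsPreEnvelope.isEnvelope_restrict {SL : ConformalSuperalgebra 𝕜 L} {X : ι → L}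
    {N : ι → ι → ℕ} {S : ConformalSuperalgebra 𝕜 C} {φ : L →ₗ[𝕜] C}
    (h : IsPreEnvelope SL X N S φ) :
    IsEnvelope SL X N (S.restrict φ h.map_grade)
      (φ.codRestrict (S.closure φ) (S.map_mem_closure φ)) where
  assoc n m x y z := by
    apply Subtype.ext
    change S.prod n x (S.prod m y z) = (S.closure φ).subtype _
    rw [h.assoc, map_sum]
    rfl
  map_der x := Subtype.ext (h.map_der x)
  map_grade i x hx := h.map_grade i x hx
  map_bracket n i j x hx y hy := by
    apply Subtype.ext
    refine (h.map_bracket n i j x hx y hy).trans ?_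
    exact (map_superComm (S := S.restrict φ h.map_grade) (S' := S) (f := (S.closure φ).subtype)
      (fun _ => rfl) (fun _ _ _ => rfl) i j n
      ⟨φ x, S.map_mem_closure φ x⟩ ⟨φ y, S.map_mem_closure φ y⟩).symm
  generates p h1 h2 h3 := by
    have h4 : S.closure φ ≤ p.map (S.closure φ).subtype := by
      refine S.closure_le (fun x => ⟨_, h1 x, rfl⟩) ?_ ?_
      · rintro _ ⟨c, hc, rfl⟩
        exact ⟨_, h2 c hc, rfl⟩
      · rintro n _ ⟨c, hc, rfl⟩ _ ⟨d, hd, rfl⟩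
        exact ⟨_, h3 n c hc d hd, rfl⟩
    refine eq_top_iff.2 fun x _ => ?_
    obtain ⟨y, hy, hyx⟩ := h4 x.2
    rwa [← Subtype.ext hyx]
  bounded a b n hn := Subtype.ext (h.bounded a b n hn)

/-- A linear map between envelopes that respects the action of the generators is a
homomorphism. -/
theorem IsEnvelope.isHom {SL : ConformalSuperalgebra 𝕜 L} {X : ι → L}
    {N : ι → ι → ℕ} {S : ConformalSuperalgebra 𝕜 C} {φ : L →ₗ[𝕜] C}
    {S' : ConformalSuperalgebra 𝕜 D} {φ' : L →ₗ[𝕜] D} (h : IsEnvelope SL X N S φ)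
    (h' : IsPreEnvelope SL X N S' φ') {f : C →ₗ[𝕜] D} (hd : ∀ x, f (S.der x) = S'.der (f x))
    (hφ : ∀ x, f (φ x) = φ' x)
    (hL : ∀ n x c, f (S.prod n (φ x) c) = S'.prod n (φ' x) (f c)) : IsHom S S' f := by
  have hp : ∀ n x y, f (S.prod n x y) = S'.prod n (f x) (f y) := by
    -- `P` consists of the left factors with which `f` is multiplicative. It is closed under
    -- products because associativity expresses multiplication by a product through iterated left
    -- multiplications.
    let P : Submodule 𝕜 C :=
      { carrier := {c | ∀ n u, f (S.prod n c u) = S'.prod n (f c) (f u)}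
        add_mem' := fun ha hb n u => by
          rw [map_add, LinearMap.add_apply, map_add, ha n u, hb n u, map_add, map_add,
            LinearMap.add_apply]
        zero_mem' := fun n u => by simp
        smul_mem' := fun c a ha n u => by
          rw [map_smul, LinearMap.smul_apply, map_smul, ha n u, map_smul, map_smul,
            LinearMap.smul_apply] }
    have hP : P = ⊤ := by
      refine h.generates P (fun x n u => by rw [hL, hφ]) (fun c hc n u => ?_)
        fun m c hc e he n u => ?_
      · rw [S.der_prod, hd, S'.der_prod, map_neg, map_smul, hc (n - 1) u]
      · rw [S.prod_prod_left h.assoc, hc m e, S'.prod_prod_left h'.assoc, map_sum]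
        refine Finset.sum_congr rfl fun j _ => ?_
        rw [map_smul, hc, he]
    intro n x y
    exact (hP ▸ Submodule.mem_top : x ∈ P) n y
  refine ⟨hd, hp, ?_⟩
  -- Parity comes for free: the homogeneous elements with image of the same parity span a subalgebra
  -- containing the image of `L`, hence everything. Uniqueness of the decomposition into even and
  -- odd parts then finishes the argument.
  let q : ZMod 2 → Submodule 𝕜 C := fun i => S.grade i ⊓ (S'.grade i).comap f
  have hq : q 0 ⊔ q 1 = ⊤ := h.generates _
    (map_mem_sup (SL := SL) fun i x hx => ⟨h.map_grade i x hx, by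
      change f (φ x) ∈ S'.grade i; rw [hφ]; exact h'.map_grade i x hx⟩)
    (der_mem_sup fun i x hx => ⟨S.der_mem i x hx.1, by
      change f (S.der x) ∈ S'.grade i; rw [hd]; exact S'.der_mem i _ hx.2⟩)
    (prod_mem_sup fun n i j x hx y hy => ⟨S.prod_mem n i j x hx.1 y hy.1, by
      change f (S.prod n x y) ∈ S'.grade (i + j); rw [hp]; exact S'.prod_mem n i j _ hx.2 _ hy.2⟩)
  have hdis := Submodule.disjoint_def.1 S.isCompl_grade.1
  have h2 : ∀ k : ZMod 2, k = 0 ∨ k = 1 := by decide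
  intro i x hx
  obtain ⟨a, ha, b, hb, rfl⟩ := Submodule.mem_sup.1 (hq ▸ Submodule.mem_top : x ∈ q 0 ⊔ q 1)
  rcases h2 i with rfl | rfl
  · have hb0 : b = 0 := hdis b (by simpa using sub_mem hx ha.1) hb.1
    rw [hb0, add_zero]
    exact ha.2
  · have ha0 : a = 0 := hdis a ha.1 (by simpa using sub_mem hx hb.1)
    rw [ha0, zero_add]
    exact hb.2

end ConformalSuperalgebra

/-! ### Universality of the envelope generated in the model. -/

theorem LinearMap.exists_factor {𝕜 V U D : Type*} [Field 𝕜] [AddCommGroup V] [Module 𝕜 V]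
    [AddCommGroup U] [Module 𝕜 U] [AddCommGroup D] [Module 𝕜 D] (g : V →ₗ[𝕜] U) (h : V →ₗ[𝕜] D)
    (hg : Function.Surjective g) (hk : ∀ x, g x = 0 → h x = 0) : ∃ f : U →ₗ[𝕜] D, ∀ x, f (g x) = h x := by
  obtain ⟨s, hs⟩ := g.exists_rightInverse_of_surjective (LinearMap.range_eq_top.2 hg)
  refine ⟨h ∘ₗ s, fun x => ?_⟩
  have h1 : g (s (g x)) = g x := LinearMap.congr_fun hs (g x)
  have h2 := hk (s (g x) - x) (by rw [map_sub, h1, sub_self])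
  rwa [map_sub, sub_eq_zero] at h2

namespace NeveuSchwartz
open GS ConformalSuperalgebra

section Universal

variable {𝕜 : Type*} [Field 𝕜] [CharZero 𝕜] {C D : Type*} [AddCommGroup C] [Module 𝕜 C]
  [AddCommGroup D] [Module 𝕜 D] {S : ConformalSuperalgebra 𝕜 C} {φ : K1 𝕜 →ₗ[𝕜] C}
  {S' : ConformalSuperalgebra 𝕜 D} {φ' : K1 𝕜 →ₗ[𝕜] D}

/-- Homomorphisms commute with the action of `A(X, K₁)`. -/
theorem map_actA (hS : IsPreEnvelope (K1.alg 𝕜) (K1.gen 𝕜) N S φ)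
    (hS' : IsPreEnvelope (K1.alg 𝕜) (K1.gen 𝕜) N S' φ') {f : C →ₗ[𝕜] D}
    (hd : ∀ x, f (S.der x) = S'.der (f x))
    (hp : ∀ n x y, f (S.prod n x y) = S'.prod n (f x) (f y)) (hφ : ∀ x, f (φ x) = φ' x)
    (a : A 𝕜) (u : C) : f (actA hS a u) = actA hS' a (f u) := by
  obtain ⟨a, rfl⟩ := RingQuot.mkAlgHom_surjective 𝕜 (AlgRel 𝕜) a
  change f (actA hS (toA 𝕜 a) u) = actA hS' (toA 𝕜 a) (f u)
  rw [actA_toA, actA_toA]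
  have hw : ∀ (l : List Letter) (u : C), f (freeAct S φ (word 𝕜 (W l)) u) =
      freeAct S' φ' (word 𝕜 (W l)) (f u) := by
    intro l
    induction l with
    | nil => intro u; rw [freeAct_W_nil, freeAct_W_nil]
    | cons z l ih =>
      intro u
      rw [freeAct_W_cons, freeAct_W_cons, ← ih]
      generalize freeAct S φ (word 𝕜 (W l)) u = c
      cases z with
      | d => exact hd c
      | L n x => exact (hp n _ c).trans (by rw [hφ]; rfl)
      | R n x => exact (map_curly hd hp n c _).trans (by rw [hφ]; rfl)
  rw [eq_sum_word a, Finsupp.sum, map_sum, map_sum, LinearMap.sum_apply, LinearMap.sum_apply,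
    map_sum]
  refine Finset.sum_congr rfl fun w _ => ?_
  rw [map_smul, map_smul, LinearMap.smul_apply, LinearMap.smul_apply, map_smul]
  exact congrArg _ (hw w.toList u)

theorem map_ev (hS : IsPreEnvelope (K1.alg 𝕜) (K1.gen 𝕜) N S φ)
    (hS' : IsPreEnvelope (K1.alg 𝕜) (K1.gen 𝕜) N S' φ') {f : C →ₗ[𝕜] D}
    (hd : ∀ x, f (S.der x) = S'.der (f x))
    (hp : ∀ n x y, f (S.prod n x y) = S'.prod n (f x) (f y)) (hφ : ∀ x, f (φ x) = φ' x)
    (t : Gen →₀ A 𝕜) : f (ev hS t) = ev hS' t := by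
  induction t using Finsupp.induction_linear with
  | zero => rw [map_zero, map_zero, map_zero]
  | add s t hs ht => rw [map_add, map_add, hs, ht, map_add]
  | single x a => rw [ev_single, ev_single, map_actA hS hS' hd hp hφ, hφ]

theorem prod_gen_ev (hS : IsPreEnvelope (K1.alg 𝕜) (K1.gen 𝕜) N S φ) (n : ℕ) (x : Gen)
    (t : Gen →₀ A 𝕜) : S.prod n (φ (K1.gen 𝕜 x)) (ev hS t) = ev hS (toA 𝕜 (l 𝕜 n x) • t) := by
  rw [ev_smul, actA_toA, freeAct_l]

theorem der_ev (hS : IsPreEnvelope (K1.alg 𝕜) (K1.gen 𝕜) N S φ)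
    (t : Gen →₀ A 𝕜) : S.der (ev hS t) = ev hS (toA 𝕜 (d 𝕜) • t) := by
  rw [ev_smul, actA_toA, freeAct_d]

/-- An envelope in which only the consequences of the defining relations hold maps to every other
envelope. -/
theorem exists_hom (h : IsEnvelope (K1.alg 𝕜) (K1.gen 𝕜) N S φ)
    (h' : IsPreEnvelope (K1.alg 𝕜) (K1.gen 𝕜) N S' φ')
    (hk : ∀ t, ev h.isPreEnvelope t = 0 →
      t ∈ Submodule.span (A 𝕜) (toFreeA 𝕜 '' defRels 𝕜)) :
    ∃ f : C →ₗ[𝕜] D, IsHom S S' f ∧ f ∘ₗ φ = φ' := by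
  -- Relations of the source are consequences of the defining ones, which hold in every envelope.
  -- The evaluation on the target thus factors through the one on the source.
  obtain ⟨f, hf⟩ : ∃ f : C →ₗ[𝕜] D, ∀ t, f (ev h.isPreEnvelope t) = ev h' t :=
    LinearMap.exists_factor (ev h.isPreEnvelope) (ev h') (ev_surjective h)
      fun t ht => ev_eq_zero_of_mem_span h' (hk t ht)
  have hd : ∀ x, f (S.der x) = S'.der (f x) := by
    intro x
    obtain ⟨t, rfl⟩ := ev_surjective h x
    rw [der_ev, hf, hf, der_ev]
  have hφ : ∀ x, f (φ x) = φ' x := by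
    intro x
    refine K1.mem_of_gen_mem (q := LinearMap.eqLocus (f ∘ₗ φ) φ') (fun a => ?_) (fun y hy => ?_) x
    · rw [LinearMap.mem_eqLocus, LinearMap.comp_apply, ← ev_single_one h.isPreEnvelope, hf,
        ev_single_one]
    · rw [LinearMap.mem_eqLocus, LinearMap.comp_apply] at hy ⊢
      have h1 : φ (der 𝕜 y) = S.der (φ y) := h.map_der y
      have h2 : φ' (der 𝕜 y) = S'.der (φ' y) := h'.map_der y
      rw [h1, h2, hd, hy]
  have hL : ∀ n x c, f (S.prod n (φ x) c) = S'.prod n (φ' x) (f c) := by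
    intro n x c
    -- All `n` are taken together again, so that the subspace is stable under `∂`.
    let q : Submodule 𝕜 (K1 𝕜) := ⨅ n, LinearMap.eqLocus (f ∘ₗ (S.prod n).flip c ∘ₗ φ)
      ((S'.prod n).flip (f c) ∘ₗ φ')
    refine (Submodule.mem_iInf _).1 (K1.mem_of_gen_mem (q := q)
      (fun a => (Submodule.mem_iInf _).2 fun n => ?_)
      (fun y hy => (Submodule.mem_iInf _).2 fun n => ?_) x) n
    · rw [LinearMap.mem_eqLocus]
      simp only [LinearMap.comp_apply, LinearMap.flip_apply]
      obtain ⟨t, rfl⟩ := ev_surjective h c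
      rw [prod_gen_ev, hf, hf, prod_gen_ev]
    · have hy := (Submodule.mem_iInf _).1 hy (n - 1)
      rw [LinearMap.mem_eqLocus] at hy ⊢
      simp only [LinearMap.comp_apply, LinearMap.flip_apply] at hy ⊢
      have h1 : φ (der 𝕜 y) = S.der (φ y) := h.map_der y
      have h2 : φ' (der 𝕜 y) = S'.der (φ' y) := h'.map_der y
      rw [h1, h2, S.der_prod, S'.der_prod, map_neg, map_smul, hy]
  exact ⟨f, h.isHom h' hd hφ hL, LinearMap.ext hφ⟩

/-- Every element of the source is an evaluation, and homomorphisms over `K₁` commute with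
evaluations. -/
theorem hom_unique (h : IsEnvelope (K1.alg 𝕜) (K1.gen 𝕜) N S φ)
    (h' : IsPreEnvelope (K1.alg 𝕜) (K1.gen 𝕜) N S' φ') {f f' : C →ₗ[𝕜] D}
    (hf : IsHom S S' f) (hφ : f ∘ₗ φ = φ') (hf' : IsHom S S' f') (hφ' : f' ∘ₗ φ = φ') : f = f' := by
  ext x
  obtain ⟨t, rfl⟩ := ev_surjective h x
  rw [map_ev h.isPreEnvelope h' hf.map_der hf.map_prod (LinearMap.congr_fun hφ),
    map_ev h.isPreEnvelope h' hf'.map_der hf'.map_prod (LinearMap.congr_fun hφ')]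

/-- The envelope generated by `v` and `g` in `Cend_{1|1}`. -/
theorem isEnvelope_closure : IsEnvelope (K1.alg 𝕜) (K1.gen 𝕜) N
    ((model 𝕜).restrict (modelMap 𝕜) isPreEnvelope_model.map_grade)
    ((modelMap 𝕜).codRestrict _ ((model 𝕜).map_mem_closure (modelMap 𝕜))) :=
  isPreEnvelope_model.isEnvelope_restrict

theorem ev_closure_eq_zero {t : Gen →₀ A 𝕜}
    (ht : ev (isEnvelope_closure (𝕜 := 𝕜)).isPreEnvelope t = 0) :
    t ∈ Submodule.span (A 𝕜) (toFreeA 𝕜 '' defRels 𝕜) := by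
  rw [← ev_model_eq_zero_iff, ← map_ev (isEnvelope_closure (𝕜 := 𝕜)).isPreEnvelope
    isPreEnvelope_model (f := ((model 𝕜).closure (modelMap 𝕜)).subtype) (fun _ => rfl)
    (fun _ _ _ => rfl) (fun _ => rfl), ht, map_zero]

end Universal

/-- The envelope generated by `v` and `g` in `Cend_{1|1}` is universal. -/
theorem isUniversalEnvelope_closure (𝕜 : Type u) [Field 𝕜] [CharZero 𝕜] :
    IsUniversalEnvelope (K1.alg 𝕜) (K1.gen 𝕜) N
      ((model 𝕜).restrict (modelMap 𝕜) isPreEnvelope_model.map_grade)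
      ((modelMap 𝕜).codRestrict _ ((model 𝕜).map_mem_closure (modelMap 𝕜))) := by
  refine ⟨isEnvelope_closure, fun D _ _ S' ψ h' => ?_⟩
  obtain ⟨f, hf, hφ⟩ := exists_hom isEnvelope_closure h'.isPreEnvelope fun t => ev_closure_eq_zero
  exact ⟨f, ⟨hf, hφ⟩, fun f' h => hom_unique isEnvelope_closure h'.isPreEnvelope h.1 h.2 hf hφ⟩

/-- In a universal envelope only the consequences of the defining relations hold. -/
theorem ev_eq_zero_iff {𝕜 U : Type u} [Field 𝕜] [CharZero 𝕜] [AddCommGroup U] [Module 𝕜 U]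
    {S : ConformalSuperalgebra 𝕜 U} {φ : K1 𝕜 →ₗ[𝕜] U}
    (h : IsUniversalEnvelope (K1.alg 𝕜) (K1.gen 𝕜) N S φ) (t : Gen →₀ A 𝕜) :
    ev h.1.isPreEnvelope t = 0 ↔ t ∈ Submodule.span (A 𝕜) (toFreeA 𝕜 '' defRels 𝕜) := by
  refine ⟨fun ht => ?_, ev_eq_zero_of_mem_span h.1.isPreEnvelope⟩
  -- Universality gives a homomorphism to the envelope inside the model. A relation valid in the
  -- universal envelope is therefore valid there, where only consequences of the defining relations
  -- hold.
  obtain ⟨f, ⟨hf, hφ⟩, -⟩ := h.2 _ _ _ (isEnvelope_closure (𝕜 := 𝕜))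
  apply ev_closure_eq_zero
  rw [← map_ev h.1.isPreEnvelope _ hf.map_der hf.map_prod (LinearMap.congr_fun hφ), ht, map_zero]

end NeveuSchwartz

theorem mainTheorem5 (𝕜 : Type u) [Field 𝕜] [CharZero 𝕜] :
    -- the enriched system of relations is a Gröbner–Shirshov basis
    GS.IsModGSB NeveuSchwartz.wordLt NeveuSchwartz.Gen.Lt (NeveuSchwartz.algRels 𝕜)
      (NeveuSchwartz.defRels 𝕜 ∪ NeveuSchwartz.extraRels 𝕜) ∧
    -- the universal envelope `U(K₁; X, N)` exists
    (∃ (U : Type u) (_ : AddCommGroup U) (_ : Module 𝕜 U) (S : ConformalSuperalgebra 𝕜 U)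
      (φ : NeveuSchwartz.K1 𝕜 →ₗ[𝕜] U),
      ConformalSuperalgebra.IsUniversalEnvelope (NeveuSchwartz.K1.alg 𝕜)
        (NeveuSchwartz.K1.gen 𝕜) NeveuSchwartz.N S φ) ∧
    -- and it is the `A(X, K₁)`-module generated by `v`, `g` with these relations
    ∀ (U : Type u) [AddCommGroup U] [Module 𝕜 U] (S : ConformalSuperalgebra 𝕜 U)
      (φ : NeveuSchwartz.K1 𝕜 →ₗ[𝕜] U),
      ConformalSuperalgebra.IsUniversalEnvelope (NeveuSchwartz.K1.alg 𝕜)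
        (NeveuSchwartz.K1.gen 𝕜) NeveuSchwartz.N S φ →
      ∃ ρ : NeveuSchwartz.A 𝕜 →ₐ[𝕜] Module.End 𝕜 U,
        (∀ z u, ρ (NeveuSchwartz.toA 𝕜 (GS.letter 𝕜 z)) u = NeveuSchwartz.act S φ z u) ∧
        (∀ u : U, ∃ f : NeveuSchwartz.Gen →₀ NeveuSchwartz.A 𝕜,
          (f.sum fun x a => ρ a (φ (NeveuSchwartz.K1.gen 𝕜 x))) = u) ∧
        ∀ f : NeveuSchwartz.Gen →₀ NeveuSchwartz.A 𝕜,
          ((f.sum fun x a => ρ a (φ (NeveuSchwartz.K1.gen 𝕜 x))) = 0 ↔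
            f ∈ Submodule.span (NeveuSchwartz.A 𝕜)
              (NeveuSchwartz.toFreeA 𝕜 '' NeveuSchwartz.defRels 𝕜)) ∧
          ((f.sum fun x a => ρ a (φ (NeveuSchwartz.K1.gen 𝕜 x))) = 0 ↔
            f ∈ Submodule.span (NeveuSchwartz.A 𝕜)
              (NeveuSchwartz.toFreeA 𝕜 ''
                (NeveuSchwartz.defRels 𝕜 ∪ NeveuSchwartz.extraRels 𝕜))) := by
  refine ⟨NeveuSchwartz.isModGSB_defRels_union_extraRels,
    ⟨_, _, _, _, _, NeveuSchwartz.isUniversalEnvelope_closure 𝕜⟩, fun U _ _ S φ h => ?_⟩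
  refine ⟨NeveuSchwartz.actA h.1.isPreEnvelope,
    fun z u => NeveuSchwartz.actA_letter h.1.isPreEnvelope z u,
    fun u => NeveuSchwartz.ev_surjective h.1 u, fun f => ?_⟩
  -- Both systems of relations generate the same submodule, so the two descriptions of the kernel
  -- coincide.
  rw [NeveuSchwartz.span_defRels_union_extraRels]
  exact ⟨NeveuSchwartz.ev_eq_zero_iff h f, NeveuSchwartz.ev_eq_zero_iff h f⟩
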